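/- Let $n\ge 0$. Consider, for $x\in[0,1]$ and $t\ge t_0\ge 0$, the semilinear hyperbolic PDE–ODE system $$u_t=-\lambda^u(x)\,u_x+f^u(x,(u,v)),\qquad v_t=\lambda^v(x)\,v_x+f^v(x,(u,v)),$$ $$\dot X(t)=f^0(X(t),v(0,t),t),\qquad u(0,t)=g^0(X(t),v(0,t),t),\qquad v(1,t)=U(t),$$ with $X(t)\in\mathbb R^n$, control input $U$, and initial data $u(\cdot,t_0)=u_0$, $v(\cdot,t_0)=v_0$ in $L^\infty(0,1)$, $X(t_0)=X_0\in\mathbb R^n$. Solutions are locally bounded broad solutions: the PDEs, integrated along characteristics, hold on almost every characteristic line, and the ODE holds in integral form. Assumptions. The speeds $\lambda^u,\lambda^v>0$ do not depend on the state, are measurable, and are bounded from below: $\sup_{x\in[0,1]}\max\{1/\lambda^u(x),1/\lambda^v(x)\}<\infty$. The functions $f^u,f^v$ (of $(x,w)\in[0,1]\times\mathbb R^2$), $f^0,g^0$ (of $(X,v,t)$) and $K$ (of $(X,t)\in\mathbb R^n\times[0,\infty)$) are measurable in $x$, respectively $t$, and globally Lipschitz in the state arguments, uniformly in $x$, respectively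 $t$. Moreover $f^u(x,0)=f^v(x,0)=0$ for all $x\in[0,1]$, and $f^0(0,0,t)=0$, $g^0(0,0,t)=0$, $K(0,t)=0$ for all $t\ge 0$. Finally, the origin is a globally asymptotically stable equilibrium of the ODE $\dot X(t)=f^0(X(t),K(X(t),t),t)$. Here, for a system with state norm $\|\cdot\|$, the origin is called a globally asymptotically stable equilibrium if the zero function is a solution and, for every initial time $t_0\ge 0$: for each $\varepsilon>0$ there is $\delta>0$ (which may depend on $t_0$) such that every solution starting at $t_0$ with initial norm less than $\delta$ has norm less than $\varepsilon$ at all $t\ge t_0$; and every solution starting at $t_0$ converges to $0$ as $t\to\infty$. For the PDE–ODE system the norm is $\max\{\|u(\cdot,t)\|_{L^\infty(0,1)},\|v(\cdot,t)\|_{L^\infty(0,1)},\|X(t)\|_\infty\}$. Control law. Put $\tau^v(t;x)=t+\int_x^1 d\xi/\lambda^v(\xi)$. At each time $t$, given the state $(u(\cdot,t),v(\cdot,t),X(t))$: 1. Predict $(\bar u,\bar v,\bar X)$ by solving the PDEs, the ODE and the boundary condition at $x=0$ (without a boundary condition at $x=1$) from this state at time $t$: $\bar u$ on $\{(x,s):x\in[0,1],\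 t\le s\le\tau^v(t;x)\}$, $\bar v$ on the same set without the line $s=\tau^v(t;x)$, and $\bar X$ on $[t,\tau^v(t;0)]$. 2. Set $U^*=K(\bar X(\tau^v(t;0)),\tau^v(t;0))$. 3. Solve $\frac{d}{dx}\bar v^*(x)=-f^v\big(x,(\bar u(x,\tau^v(t;x)),\bar v^*(x))\big)/\lambda^v(x)$ on $[0,1]$ with $\bar v^*(0)=U^*$, and set $U(t)=\bar v^*(1)$. Theorem. Under these assumptions: (a) for every $t\ge0$ and every state in $L^\infty(0,1)^2\times\mathbb R^n$, the control law yields exactly one value $U(t)$; (b) for every $t_0\ge0$ and every initial state in $L^\infty(0,1)^2\times\mathbb R^n$, the closed loop of the PDE–ODE system with this control law has a solution on $[t_0,\infty)$, and it is unique (for each $t\ge t_0$, $u(\cdot,t)$ and $v(\cdot,t)$ are unique up to null sets, and $X(t)$, $U(t)$ are unique); (c) the origin is a globally asymptotically stable equilibrium of the closed loop. -/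

import Mathlib

open MeasureTheory Set Filter Topology
open scoped NNReal ENNReal

/-- Data of a semilinear `2 × 2` hyperbolic system on `x ∈ [0,1]`, `t ≥ 0`, coupled at `x = 0` to an
ordinary differential equation in `ℝⁿ`:
`u_t = -λᵘ(x) u_x + fᵘ(x,(u,v))`, `v_t = λᵛ(x) v_x + fᵛ(x,(u,v))`,
`Ẋ = f⁰(X, v(0,t), t)`, `u(0,t) = g⁰(X, v(0,t), t)`, with control input `v(1,t) = U(t)`.
Only values at `x ∈ [0,1]` and `t ≥ 0` matter. -/
structure HypSystem (n : ℕ) where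
  lamU : ℝ → ℝ
  lamV : ℝ → ℝ
  fU : ℝ → ℝ × ℝ → ℝ
  fV : ℝ → ℝ × ℝ → ℝ
  f0 : (Fin n → ℝ) → ℝ → ℝ → (Fin n → ℝ)
  g0 : (Fin n → ℝ) → ℝ → ℝ → ℝ

/-- The state of the coupled system: two profiles on `[0,1]` (taken up to null sets) and a vector. -/
abbrev HypState (n : ℕ) := (ℝ → ℝ) × (ℝ → ℝ) × (Fin n → ℝ)

/-- Lebesgue measure on `[0,1]`. -/
noncomputable def unitMeasure : Measure ℝ := volume.restrict (Icc 0 1)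

/-- The norm `max {‖u‖_∞, ‖v‖_∞, ‖X‖_∞}`, where the first two are essential suprema on `[0,1]`. -/
noncomputable def stateNorm {n : ℕ} (z : HypState n) : ℝ≥0∞ :=
  max (max (eLpNorm z.1 ⊤ unitMeasure) (eLpNorm z.2.1 ⊤ unitMeasure)) ‖z.2.2‖ₑ

/-- The origin is a globally asymptotically stable equilibrium of a (possibly time-varying) system
given by its solution relation: `IsSol t₀ z₀ z` says that `z` is a solution on `[t₀,∞)` with initial
state `z₀` at time `t₀`. -/
structure IsGloballyAsymptoticallyStable {S : Type} [Zero S] (size : S → ℝ≥0∞)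
    (IsSol : ℝ → S → (ℝ → S) → Prop) : Prop where
  equilibrium : ∀ t₀ : ℝ, 0 ≤ t₀ → IsSol t₀ 0 (fun _ => 0)
  stable : ∀ t₀ : ℝ, 0 ≤ t₀ → ∀ ε : ℝ≥0∞, 0 < ε → ∃ δ : ℝ≥0∞, 0 < δ ∧
    ∀ z₀ z, IsSol t₀ z₀ z → size z₀ < δ → ∀ t, t₀ ≤ t → size (z t) < ε
  attractive : ∀ t₀ : ℝ, 0 ≤ t₀ → ∀ z₀ z, IsSol t₀ z₀ z →
    Tendsto (fun t => size (z t)) atTop (𝓝 0)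

/-- Carathéodory solutions on `[t₀,∞)` of `Ẋ(t) = G(X(t),t)`, `X(t₀) = X₀`. -/
def IsODESolution {n : ℕ} (G : (Fin n → ℝ) → ℝ → (Fin n → ℝ)) (t₀ : ℝ) (X₀ : Fin n → ℝ)
    (X : ℝ → Fin n → ℝ) : Prop :=
  ContinuousOn X (Ici t₀) ∧ ∀ t, t₀ ≤ t → X t = X₀ + ∫ s in t₀..t, G (X s) s

/-- Standing assumptions on the plant and on the controller `K` of the ordinary differential
equation. -/
structure SemilinearAssumption {n : ℕ} (P : HypSystem n) (K : (Fin n → ℝ) → ℝ → ℝ) : Prop where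
  measurable_lamU : Measurable P.lamU
  measurable_lamV : Measurable P.lamV
  lamU_pos : ∀ x ∈ Icc (0 : ℝ) 1, 0 < P.lamU x
  lamV_pos : ∀ x ∈ Icc (0 : ℝ) 1, 0 < P.lamV x
  speed_lower_bound : ∃ l : ℝ, ∀ x ∈ Icc (0 : ℝ) 1, max (P.lamU x)⁻¹ (P.lamV x)⁻¹ ≤ l
  measurable_fU : ∀ w, Measurable fun x => P.fU x w
  measurable_fV : ∀ w, Measurable fun x => P.fV x w
  measurable_f0 : ∀ X v, Measurable fun t => P.f0 X v t
  measurable_g0 : ∀ X v, Measurable fun t => P.g0 X v t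
  measurable_K : ∀ X, Measurable fun t => K X t
  lipschitz_F : ∃ L : ℝ≥0, ∀ x ∈ Icc (0 : ℝ) 1, LipschitzWith L (P.fU x) ∧ LipschitzWith L (P.fV x)
  lipschitz_f0 : ∃ L : ℝ≥0, ∀ t, 0 ≤ t →
    LipschitzWith L fun p : (Fin n → ℝ) × ℝ => P.f0 p.1 p.2 t
  lipschitz_g0 : ∃ L : ℝ≥0, ∀ t, 0 ≤ t →
    LipschitzWith L fun p : (Fin n → ℝ) × ℝ => P.g0 p.1 p.2 t
  lipschitz_K : ∃ L : ℝ≥0, ∀ t, 0 ≤ t → LipschitzWith L fun X => K X t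
  F_zero : ∀ x ∈ Icc (0 : ℝ) 1, P.fU x 0 = 0 ∧ P.fV x 0 = 0
  f0_zero : ∀ t, 0 ≤ t → P.f0 0 0 t = 0
  g0_zero : ∀ t, 0 ≤ t → P.g0 0 0 t = 0
  K_zero : ∀ t, 0 ≤ t → K 0 t = 0
  ode_stable : IsGloballyAsymptoticallyStable (fun X : Fin n → ℝ => ‖X‖ₑ)
    (IsODESolution fun X t => P.f0 X (K X t) t)

namespace HypSystem

variable {n : ℕ} (P : HypSystem n)

/-- Time at `x` on the `u`-characteristic (rightgoing) through `(a,t)`. For `a = 0` this is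
`τᵘ(t;x)`. -/
noncomputable def charU (t a x : ℝ) : ℝ := t + ∫ ξ in a..x, (P.lamU ξ)⁻¹

/-- Time at `x` on the `v`-characteristic (leftgoing) through `(a,t)`. For `a = 1` this is
`τᵛ(t;x)`. -/
noncomputable def charV (t a x : ℝ) : ℝ := t + ∫ ξ in x..a, (P.lamV ξ)⁻¹

/-- `τᵛ(t;x)`: time at which the `v`-characteristic starting at `x = 1` at time `t` reaches `x`. -/
noncomputable def tauV (t x : ℝ) : ℝ := P.charV t 1 x

/-- The determinate set `𝒟(t)`. -/
def detSet (t : ℝ) : Set (ℝ × ℝ) := {p | p.1 ∈ Icc (0 : ℝ) 1 ∧ p.2 ∈ Icc t (P.tauV t p.1)}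

/-- The half-open determinate set `𝒟'(t)`. -/
def detSet' (t : ℝ) : Set (ℝ × ℝ) := {p | p.1 ∈ Icc (0 : ℝ) 1 ∧ p.2 ∈ Ico t (P.tauV t p.1)}

/-- Broad solutions of the Cauchy problem without boundary condition at `x = 1`, started at time
`t₀` from `(u₀, v₀, X₀)`, with `u` on the region `Du`, `v` on the region `Dv` and `X` on the time
interval `J`: locally bounded functions such that, on almost every characteristic line, the partial
differential equations integrated along that line hold at all points of the line that lie in the
region, and such that `X` solves its differential equation in the sense of Carathéodory. -/
structure IsBroadSolution (t₀ : ℝ) (Du Dv : Set (ℝ × ℝ)) (J : Set ℝ)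
    (z₀ : HypState n) (u v : ℝ → ℝ → ℝ) (X : ℝ → Fin n → ℝ) : Prop where
  measurable_u : Measurable (Function.uncurry u)
  measurable_v : Measurable (Function.uncurry v)
  bounded_u : ∀ T, ∃ M, ∀ x t, (x, t) ∈ Du → t ≤ T → |u x t| ≤ M
  bounded_v : ∀ T, ∃ M, ∀ x t, (x, t) ∈ Dv → t ≤ T → |v x t| ≤ M
  u_initial : ∀ᵐ a ∂unitMeasure, ∀ x ∈ Icc a 1, (x, P.charU t₀ a x) ∈ Du →
    u x (P.charU t₀ a x) = z₀.1 a + ∫ ξ in a..x,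
      P.fU ξ (u ξ (P.charU t₀ a ξ), v ξ (P.charU t₀ a ξ)) / P.lamU ξ
  u_boundary : ∀ᵐ s : ℝ, t₀ ≤ s → ∀ x ∈ Icc (0 : ℝ) 1, (x, P.charU s 0 x) ∈ Du →
    u x (P.charU s 0 x) = P.g0 (X s) (v 0 s) s + ∫ ξ in (0 : ℝ)..x,
      P.fU ξ (u ξ (P.charU s 0 ξ), v ξ (P.charU s 0 ξ)) / P.lamU ξ
  v_initial : ∀ᵐ a ∂unitMeasure, ∀ x ∈ Icc 0 a, (x, P.charV t₀ a x) ∈ Dv →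
    v x (P.charV t₀ a x) = z₀.2.1 a + ∫ ξ in x..a,
      P.fV ξ (u ξ (P.charV t₀ a ξ), v ξ (P.charV t₀ a ξ)) / P.lamV ξ
  continuous_X : ContinuousOn X J
  ode : ∀ t ∈ J, X t = z₀.2.2 + ∫ s in t₀..t, P.f0 (X s) (v 0 s) s

/-- `U` is an output of the control algorithm at time `t` for the measured state `z`:
1. predict `(ū, v̄, X̄)` from `z` over the determinate set of `t`;
2. set the virtual input to `K(X̄(τᵛ(t;0)), τᵛ(t;0))`;
3. solve the target dynamics for `vs x = v̄*(x, τᵛ(t;x))` from `x = 0` to `x = 1`, with the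
predicted `ū(x, τᵛ(t;x))`, and set `U = v̄*(1, τᵛ(t;1))`. -/
def IsAlgorithmOutput (K : (Fin n → ℝ) → ℝ → ℝ) (t : ℝ) (z : HypState n) (U : ℝ) : Prop :=
  ∃ (ub vb : ℝ → ℝ → ℝ) (Xb : ℝ → Fin n → ℝ) (vs : ℝ → ℝ),
    P.IsBroadSolution t (P.detSet t) (P.detSet' t) (Icc t (P.tauV t 0)) z ub vb Xb ∧
    ContinuousOn vs (Icc 0 1) ∧
    (∀ x ∈ Icc (0 : ℝ) 1, vs x = K (Xb (P.tauV t 0)) (P.tauV t 0) -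
      ∫ ξ in (0 : ℝ)..x, P.fV ξ (ub ξ (P.tauV t ξ), vs ξ) / P.lamV ξ) ∧
    U = vs 1

/-- The strip `[0,1] × [t₀,∞)`. -/
def strip (t₀ : ℝ) : Set (ℝ × ℝ) := Icc (0 : ℝ) 1 ×ˢ Ici t₀

/-- `z` with input `U` is a solution on `[t₀,∞)` of the closed loop of the plant and the control
algorithm, with `z t = (u(·,t), v(·,t), X(t))` and initial state `z₀` at time `t₀`. -/
structure IsClosedLoopSolution (K : (Fin n → ℝ) → ℝ → ℝ) (t₀ : ℝ) (z₀ : HypState n)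
    (z : ℝ → HypState n) (U : ℝ → ℝ) : Prop where
  plant : P.IsBroadSolution t₀ (strip t₀) (strip t₀) (Ici t₀) z₀
    (fun x t => (z t).1 x) (fun x t => (z t).2.1 x) (fun t => (z t).2.2)
  v_boundary : ∀ᵐ t : ℝ, t₀ ≤ t → ∀ x ∈ Icc (0 : ℝ) 1,
    (z (P.tauV t x)).2.1 x = U t + ∫ ξ in x..1,
      P.fV ξ ((z (P.tauV t ξ)).1 ξ, (z (P.tauV t ξ)).2.1 ξ) / P.lamV ξ
  feedback : ∀ t, t₀ ≤ t → P.IsAlgorithmOutput K t (z t) (U t)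

end HypSystem

/-! Let `A` and `B` be the primitives of 1/λᵘ and 1/λᵛ that vanish at 0, and `w = A + B`. The
coordinates p = t - A(x) and q = t + B(x) label the two characteristics through (x,t) by the times
at which they meet x = 0, and q = p + w(x). The v-line that starts at x = 1 at time t has label `top
t` = t + B(1).

The determinate set of t does not see inputs applied after t, so a closed-loop solution restarted
from its state at time t is its own prediction (`isPrediction_restart`, `isPrediction_unique`). The
last step of the algorithm integrates the v-equation along the line q = `top t` from x = 0 to x = 1;
the plant integrates the same scalar equation back from v(1,t) = U(t). Uniqueness for that scalar
equation identifies the two functions. Hence the closed loop is the plant in which almost every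
v-line with q ≥ `top t₀` carries the boundary value v(0,q) = K(X(q),q)
(`ae_upper_of_isClosedLoopSolution`; `isClosedLoopSolution_of_isLineSolution` is the converse
direction).

This reformulated problem is causal, though not in time: on the upper v-lines v is determined from x
= 0 towards x = 1, that is, backward in time. The quantity that increases in the direction of
dependence is `θ`, equal to t below the line q = `top t₀` and to q + x above it. In supremum norms
with weights exp(βθ), scaled by powers of c, the integrated equations form a contraction with factor
1/2 (`CloseOn.rhs`). This yields global existence (`exists_isLineSolution`) and, when the data
differ by δ, a weighted distance of at most 2δ between solutions (`IsLineSolution.closeOn`); δ = 0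
is uniqueness. Broad solutions satisfy the equations only on almost every line, so uniqueness also
uses that travel-time maps preserve null sets in both directions.

For stability, X obeys the nominal equation from `top t₀` on (`isODESolution_of_isLineSolution`). Up
to that line everything is bounded by a constant times the initial norm (`lower_bound`). Beyond it,
u and v are bounded by a constant times any positive antitone majorant m of L²‖X‖, evaluated at p,
provided m also dominates u on the line q = `top t₀` (`upper_bound`). A constant m gives stability,
a decreasing step function gives attractivity. -/

/-! ### Weighted contractions -/

/-- A property of a bound that improves from `M` to `δ + M / 2` holds along a sequence of bounds
converging to `2 δ`. -/
lemma exists_seq_bounds_tendsto {B : ℝ → Prop} {δ : ℝ} (hδ : 0 ≤ δ) (h0 : ∃ M, 0 ≤ M ∧ B M)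
    (h : ∀ M, 0 ≤ M → B M → B (δ + M / 2)) :
    ∃ M : ℕ → ℝ, Tendsto M atTop (𝓝 (2 * δ)) ∧ ∀ k, B (M k) := by
  obtain ⟨M₀, hM₀, hB⟩ := h0
  refine ⟨fun k => 2 * δ + (1 / 2) ^ k * (M₀ - 2 * δ), ?_, fun k => ?_⟩
  · have := (tendsto_pow_atTop_nhds_zero_of_lt_one (r := (1 / 2 : ℝ)) (by norm_num)
      (by norm_num)).mul_const (M₀ - 2 * δ)
    simpa using this.const_add (2 * δ)
  · have key : 0 ≤ 2 * δ + (1 / 2 : ℝ) ^ k * (M₀ - 2 * δ) ∧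
        B (2 * δ + (1 / 2) ^ k * (M₀ - 2 * δ)) := by
      induction k with
      | zero => simpa using ⟨hM₀, hB⟩
      | succ k ih =>
        have := h _ ih.1 ih.2
        have e : 2 * δ + (1 / 2 : ℝ) ^ (k + 1) * (M₀ - 2 * δ) =
            δ + (2 * δ + (1 / 2 : ℝ) ^ k * (M₀ - 2 * δ)) / 2 := by ring
        rw [e]
        exact ⟨by linarith [ih.1], this⟩
    exact key.2

/-- Banach's fixed point theorem for measurable functions with a weighted supremum norm. -/
lemma exists_measurable_fixedPoint {S : Type*} [MeasurableSpace S] {ω : S → ℝ} {Φ : (S → ℝ) → S → ℝ}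
    (hω : ∀ s, 0 < ω s)
    (hmeas : ∀ y, Measurable y → (∃ M, ∀ s, |y s| ≤ M * ω s) → Measurable (Φ y))
    (h0 : ∃ M, ∀ s, |Φ 0 s| ≤ M * ω s)
    (hc : ∀ y y', Measurable y → Measurable y' → (∃ M, ∀ s, |y s| ≤ M * ω s) →
      (∃ M, ∀ s, |y' s| ≤ M * ω s) → ∀ M, 0 ≤ M → (∀ s, |y s - y' s| ≤ M * ω s) →
        ∀ s, |Φ y s - Φ y' s| ≤ M / 2 * ω s) :
    ∃ y, Measurable y ∧ (∃ M, ∀ s, |y s| ≤ M * ω s) ∧ Φ y = y := by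
  classical
  obtain ⟨C, hC⟩ := h0
  rcases isEmpty_or_nonempty S with hS | ⟨⟨s₀⟩⟩
  · exact ⟨0, measurable_const, ⟨0, fun s => (hS.false s).elim⟩, funext fun s => (hS.false s).elim⟩
  have hC0 : 0 ≤ C := by
    have := (abs_nonneg _).trans (hC s₀)
    exact nonneg_of_mul_nonneg_left this (hω s₀)
  set Y : ℕ → S → ℝ := fun k => Φ^[k] 0 with hY
  have hsucc : ∀ k, Y (k + 1) = Φ (Y k) := fun k => Function.iterate_succ_apply' Φ k 0
  have main : ∀ k, (Measurable (Y k) ∧ (∃ M, ∀ s, |Y k s| ≤ M * ω s)) ∧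
      ∀ s, |Y k s - Y (k + 1) s| ≤ C / 2 ^ k * ω s := by
    intro k
    induction k with
    | zero =>
      refine ⟨⟨measurable_const, 0, fun s => by simp [hY]⟩, fun s => ?_⟩
      rw [hsucc]
      simpa [hY] using hC s
    | succ k ih =>
      obtain ⟨⟨hm, M, hM⟩, hd⟩ := ih
      have h1 : Measurable (Y (k + 1)) := by rw [hsucc]; exact hmeas _ hm ⟨M, hM⟩
      have h2 : ∀ s, |Y (k + 1) s| ≤ (M + C / 2 ^ k) * ω s := fun s => by
        have := hM s
        have := hd s
        have := abs_sub_abs_le_abs_sub (Y (k + 1) s) (Y k s)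
        rw [abs_sub_comm] at this
        linarith
      refine ⟨⟨h1, _, h2⟩, fun s => ?_⟩
      have := hc (Y k) (Y (k + 1)) hm h1 ⟨M, hM⟩ ⟨_, h2⟩ (C / 2 ^ k) (by positivity) hd s
      rw [← hsucc, ← hsucc] at this
      refine this.trans_eq ?_
      rw [pow_succ]; ring
  have hdist : ∀ s k, dist (Y k s) (Y (k + 1) s) ≤ (2 * C * ω s) / 2 / 2 ^ k := fun s k => by
    refine ((main k).2 s).trans_eq ?_
    ring
  -- Pointwise limits replace completeness of a function space: they are automatically measurable,
  -- and the geometric rate is uniform relative to `ω`, so the contraction estimate passes to the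
  -- limit.
  choose y hy using fun s => cauchySeq_tendsto_of_complete (cauchySeq_of_le_geometric_two (hdist s))
  have hYy : ∀ k s, |Y k s - y s| ≤ 2 * C / 2 ^ k * ω s := fun k s => by
    refine (dist_le_of_le_geometric_two_of_tendsto (hdist s) (hy s) k).trans_eq ?_
    ring
  have hym : Measurable y :=
    measurable_of_tendsto_metrizable (fun k => (main k).1.1) (tendsto_pi_nhds.2 hy)
  have hyb : ∀ s, |y s| ≤ (2 * C) * ω s := fun s => by
    have := hYy 0 s
    simpa [hY] using this
  refine ⟨y, hym, ⟨_, hyb⟩, funext fun s => ?_⟩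
  have h1 : ∀ k, |Y (k + 1) s - Φ y s| ≤ 2 * C / 2 ^ k / 2 * ω s := fun k => by
    rw [hsucc]
    exact hc _ _ (main k).1.1 hym (main k).1.2 ⟨_, hyb⟩ _ (by positivity) (hYy k) s
  have h2 : Tendsto (fun k => Y (k + 1) s) atTop (𝓝 (Φ y s)) := by
    rw [tendsto_iff_dist_tendsto_zero]
    refine squeeze_zero (fun _ => dist_nonneg) (fun k => h1 k) ?_
    have := (tendsto_pow_atTop_nhds_zero_of_lt_one (r := (1 / 2 : ℝ)) (by norm_num)
      (by norm_num)).mul_const (C * ω s)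
    rw [zero_mul] at this
    refine this.congr fun k => ?_
    rw [one_div, inv_pow]; field_simp
  exact tendsto_nhds_unique h2 ((tendsto_add_atTop_iff_nat 1).2 (hy s))

/-! ### Parametric interval integrals -/

/-- The moving endpoints are absorbed into the indicator of a measurable set of the product space,
which leaves an integral over a fixed domain. The two orientations of the interval integral are
treated separately and subtracted. -/
lemma measurable_intervalIntegral_param {α E : Type*} [MeasurableSpace α] [NormedAddCommGroup E]
    [NormedSpace ℝ E] [MeasurableSpace E] [BorelSpace E] [SecondCountableTopology E]
    {a b : α → ℝ} (ha : Measurable a)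
    (hb : Measurable b) {h : α → ℝ → E} (hh : Measurable (Function.uncurry h)) :
    Measurable fun s => ∫ ξ in a s..b s, h s ξ := by
  have key : ∀ {a b : α → ℝ}, Measurable a → Measurable b →
      Measurable fun s => ∫ ξ in Ioc (a s) (b s), h s ξ := by
    intro a b ha hb
    have hS : MeasurableSet {q : α × ℝ | a q.1 < q.2 ∧ q.2 ≤ b q.1} :=
      (measurableSet_lt (ha.comp measurable_fst) measurable_snd).inter
        (measurableSet_le measurable_snd (hb.comp measurable_fst))
    have e : (fun s => ∫ ξ in Ioc (a s) (b s), h s ξ) = fun s => ∫ ξ,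
        {q : α × ℝ | a q.1 < q.2 ∧ q.2 ≤ b q.1}.indicator (Function.uncurry h) (s, ξ) := by
      funext s
      rw [← integral_indicator measurableSet_Ioc]
      rfl
    rw [e]
    exact ((hh.indicator hS).stronglyMeasurable.integral_prod_right' (ν := volume)).measurable
  exact (key ha hb).sub (key hb ha)

/-! ### Travel times as homeomorphisms of the real line -/

/-- A positive bounded measurable function on `ℝ` that is at least one outside `[0,1]`. -/
structure IsDensity (r : ℝ → ℝ) (l : ℝ) : Prop where
  measurable : Measurable r
  pos : ∀ x, 0 < r x
  le : ∀ x, r x ≤ l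
  one_le : ∀ x, x ∉ Icc (0 : ℝ) 1 → 1 ≤ r x

namespace IsDensity

variable {r : ℝ → ℝ} {l : ℝ} (h : IsDensity r l)
include h

lemma intervalIntegrable (a b : ℝ) : IntervalIntegrable r volume a b := by
  refine (intervalIntegrable_const (c := l)).mono_fun h.measurable.aestronglyMeasurable ?_
  refine Eventually.of_forall fun x => ?_
  have := h.pos x
  have := h.le x
  change |r x| ≤ |l|
  rw [abs_of_pos (h.pos x), abs_of_pos (by linarith)]
  exact h.le x

lemma integral_sub (a b : ℝ) :
    (∫ ξ in (0 : ℝ)..b, r ξ) - ∫ ξ in (0 : ℝ)..a, r ξ = ∫ ξ in a..b, r ξ :=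
  intervalIntegral.integral_interval_sub_left (h.intervalIntegrable _ _) (h.intervalIntegrable _ _)

lemma strictMono_primitive : StrictMono fun x => ∫ ξ in (0 : ℝ)..x, r ξ := by
  intro a b hab
  have : 0 < ∫ ξ in a..b, r ξ :=
    intervalIntegral.intervalIntegral_pos_of_pos (h.intervalIntegrable _ _) h.pos hab
  rw [← h.integral_sub] at this
  exact sub_pos.1 this

lemma continuous_primitive : Continuous fun x => ∫ ξ in (0 : ℝ)..x, r ξ :=
  intervalIntegral.continuous_primitive (fun a b => h.intervalIntegrable a b) 0

/-- The density is at least one outside [0,1], so the primitive grows at least linearly at both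
ends. This is what makes travel time a homeomorphism of the whole line, with no endpoint cases. -/
lemma surjective_primitive : Function.Surjective fun x => ∫ ξ in (0 : ℝ)..x, r ξ := by
  refine h.continuous_primitive.surjective ?_ ?_
  · refine tendsto_atTop_mono' atTop (f₁ := fun x : ℝ => x - 1) ?_
      (tendsto_atTop_add_const_right _ _ tendsto_id)
    filter_upwards [eventually_gt_atTop 1] with x hx
    have h1 : (∫ ξ in (1 : ℝ)..x, (1 : ℝ)) ≤ ∫ ξ in (1 : ℝ)..x, r ξ := by
      rw [intervalIntegral.integral_of_le hx.le, intervalIntegral.integral_of_le hx.le]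
      exact setIntegral_mono_on (f := fun _ => (1 : ℝ)) (by simp)
        ((h.intervalIntegrable 1 x).1) measurableSet_Ioc
        fun y hy => h.one_le y fun hy' => absurd hy.1 (not_lt.2 hy'.2)
    have h2 := h.strictMono_primitive (zero_lt_one' ℝ)
    have h3 := h.integral_sub 1 x
    simp at h1 h2
    linarith
  · refine tendsto_atBot_mono' (f₂ := fun x => ∫ ξ in (0 : ℝ)..x, r ξ) (f₁ := fun x : ℝ => x)
      atBot ?_ tendsto_id
    filter_upwards [eventually_lt_atBot 0] with x hx
    have h1 : (∫ ξ in x..0, (1 : ℝ)) ≤ ∫ ξ in x..0, r ξ := by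
      rw [intervalIntegral.integral_of_le hx.le, intervalIntegral.integral_of_le hx.le,
        ← integral_Ico_eq_integral_Ioc, ← integral_Ico_eq_integral_Ioc]
      refine setIntegral_mono_on (by simp) ?_ measurableSet_Ico
        fun y hy => h.one_le y fun hy' => absurd hy.2 (not_lt.2 hy'.1)
      exact ((h.intervalIntegrable x 0).1).congr_set_ae Ico_ae_eq_Ioc
    rw [intervalIntegral.integral_symm x 0] at *
    simp at h1 ⊢
    linarith

/-- The primitive vanishing at `0` of a density, as an order isomorphism of `ℝ`. -/
noncomputable def iso : ℝ ≃o ℝ :=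
  h.strictMono_primitive.orderIsoOfSurjective _ h.surjective_primitive

lemma iso_apply (x : ℝ) : h.iso x = ∫ ξ in (0 : ℝ)..x, r ξ := rfl

@[simp] lemma iso_zero : h.iso 0 = 0 := by simp [iso_apply]

lemma iso_sub (a b : ℝ) : h.iso b - h.iso a = ∫ ξ in a..b, r ξ := h.integral_sub a b

/-- The preimage of (a,b) is an interval over which the density integrates to b - a, so both
measures agree on rational intervals. This is the change of variables for speeds that are only
measurable. -/
lemma map_iso :
    (volume.withDensity fun x => ENNReal.ofReal (r x)).map h.iso = volume := by
  symm
  refine Real.measure_ext_Ioo_rat fun a b => ?_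
  rw [Measure.map_apply h.iso.continuous.measurable measurableSet_Ioo, h.iso.preimage_Ioo,
    withDensity_apply _ measurableSet_Ioo, Real.volume_Ioo]
  rcases le_total b a with hab | hab
  · have hab' : (b : ℝ) ≤ a := by exact_mod_cast hab
    rw [Ioo_eq_empty (not_lt.2 (h.iso.symm.monotone hab')), ENNReal.ofReal_of_nonpos (by linarith)]
    simp
  · have hab' : (a : ℝ) ≤ b := by exact_mod_cast hab
    have hle := h.iso.symm.monotone hab'
    rw [restrict_Ioo_eq_restrict_Ioc, ← ofReal_integral_eq_lintegral_ofReal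
      (h.intervalIntegrable _ _).1 (Eventually.of_forall fun x => (h.pos x).le),
      ← intervalIntegral.integral_of_le hle, ← h.iso_sub]
    simp

/-- Positivity of the density makes Lebesgue measure absolutely continuous with respect to the
weighted one; the inverse map needs only the opposite, automatic relation. Together they translate
"almost every position" into "almost every characteristic" and back. -/
lemma quasiMeasurePreserving_iso : Measure.QuasiMeasurePreserving h.iso volume volume := by
  refine ⟨h.iso.continuous.measurable, ?_⟩
  have h1 : (volume : Measure ℝ) ≪ volume.withDensity fun x => ENNReal.ofReal (r x) :=
    withDensity_absolutelyContinuous' h.measurable.ennreal_ofReal.aemeasurable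
      (Eventually.of_forall fun x => by simpa using h.pos x)
  have := h1.map h.iso.continuous.measurable
  rwa [h.map_iso] at this

lemma quasiMeasurePreserving_symm : Measure.QuasiMeasurePreserving h.iso.symm volume volume := by
  refine ⟨h.iso.symm.continuous.measurable, ?_⟩
  have h1 : (volume.withDensity fun x => ENNReal.ofReal (r x)) ≪ (volume : Measure ℝ) :=
    withDensity_absolutelyContinuous _ _
  conv_lhs => rw [← h.map_iso]
  rw [Measure.map_map h.iso.symm.continuous.measurable h.iso.continuous.measurable]
  simpa [Function.comp_def] using h1

lemma integral_comp_iso {a b : ℝ} (hab : a ≤ b) (φ : ℝ → ℝ) :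
    ∫ ξ in a..b, r ξ * φ (h.iso ξ) = ∫ s in h.iso a..h.iso b, φ s := by
  rw [intervalIntegral.integral_of_le hab, intervalIntegral.integral_of_le (h.iso.monotone hab)]
  conv_rhs => rw [← h.map_iso]
  have hme : MeasurableEmbedding h.iso := h.iso.toHomeomorph.measurableEmbedding
  rw [hme.setIntegral_map]
  have e : h.iso ⁻¹' Ioc (h.iso a) (h.iso b) = Ioc a b := by ext; simp
  rw [e, setIntegral_withDensity_eq_setIntegral_toReal_smul h.measurable.ennreal_ofReal
    (Eventually.of_forall fun _ => by simp) _ measurableSet_Ioc]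
  refine integral_congr_ae (Eventually.of_forall fun x => ?_)
  simp [ENNReal.toReal_ofReal (h.pos x).le]

/-- In the travel-time variable the density disappears and the exponential has an explicit
antiderivative; the contribution of the other endpoint has a favourable sign. The factor 1/β is the
source of all smallness in the contraction. -/
lemma integral_mul_exp_iso_le {a b : ℝ} (hab : a ≤ b) {β : ℝ} (hβ : 0 < β) (p : ℝ) :
    ∫ ξ in a..b, r ξ * Real.exp (β * (p + h.iso ξ)) ≤ Real.exp (β * (p + h.iso b)) / β := by
  rw [h.integral_comp_iso hab fun s => Real.exp (β * (p + s))]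
  have : ∀ s ∈ uIcc (h.iso a) (h.iso b),
      HasDerivAt (fun s => Real.exp (β * (p + s)) / β) (Real.exp (β * (p + s))) s := fun s _ => by
    have h1 : HasDerivAt (fun s => β * (p + s)) β s := by
      simpa using ((hasDerivAt_id s).const_add p).const_mul β
    exact (h1.exp.div_const β).congr_deriv (by field_simp)
  rw [intervalIntegral.integral_eq_sub_of_hasDerivAt this
    (Continuous.intervalIntegrable (by fun_prop) _ _)]
  have : 0 ≤ Real.exp (β * (p + h.iso a)) / β := by positivity
  linarith

lemma integral_mul_exp_neg_iso_le {a b : ℝ} (hab : a ≤ b) {β : ℝ} (hβ : 0 < β) (q : ℝ) :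
    ∫ ξ in a..b, r ξ * Real.exp (β * (q - h.iso ξ)) ≤ Real.exp (β * (q - h.iso a)) / β := by
  rw [h.integral_comp_iso hab fun s => Real.exp (β * (q - s))]
  have : ∀ s ∈ uIcc (h.iso a) (h.iso b),
      HasDerivAt (fun s => -(Real.exp (β * (q - s)) / β)) (Real.exp (β * (q - s))) s := fun s _ => by
    have h1 : HasDerivAt (fun s => β * (q - s)) (-β) s := by
      simpa using ((hasDerivAt_id s).const_sub q).const_mul β
    exact (h1.exp.div_const β).neg.congr_deriv (by field_simp)
  rw [intervalIntegral.integral_eq_sub_of_hasDerivAt this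
    (Continuous.intervalIntegrable (by fun_prop) _ _)]
  have : 0 ≤ Real.exp (β * (q - h.iso b)) / β := by positivity
  linarith

end IsDensity

lemma isDensity_one : IsDensity (fun _ => 1) 1 :=
  ⟨measurable_const, fun _ => one_pos, fun _ => le_rfl, fun _ _ => le_rfl⟩

lemma isDensity_one_iso (x : ℝ) : isDensity_one.iso x = x := by
  simp [IsDensity.iso_apply]

lemma integral_exp_add_le {a b : ℝ} (hab : a ≤ b) {β : ℝ} (hβ : 0 < β) (p : ℝ) :
    ∫ ξ in a..b, Real.exp (β * (p + ξ)) ≤ Real.exp (β * (p + b)) / β := by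
  simpa [isDensity_one_iso] using isDensity_one.integral_mul_exp_iso_le hab hβ p

/-! ### Semilinear systems in characteristic coordinates -/

/-- Normalized data of a semilinear hyperbolic system with boundary dynamics: travel time densities
`rU`, `rV`, source terms `F`, `G` per unit length, boundary dynamics `f`, boundary coupling `g` and
feedback law `k`, all globally Lipschitz and vanishing at the origin. -/
structure CharSystem (n : ℕ) where
  rU : ℝ → ℝ
  rV : ℝ → ℝ
  F : ℝ → ℝ × ℝ → ℝ
  G : ℝ → ℝ × ℝ → ℝ
  f : ℝ → (Fin n → ℝ) × ℝ → Fin n → ℝ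
  g : ℝ → (Fin n → ℝ) × ℝ → ℝ
  k : ℝ → (Fin n → ℝ) → ℝ
  L : ℝ
  l : ℝ
  one_le_L : 1 ≤ L
  one_le_l : 1 ≤ l
  densU : IsDensity rU l
  densV : IsDensity rV l
  measurable_F : Measurable (Function.uncurry F)
  measurable_G : Measurable (Function.uncurry G)
  measurable_f : Measurable (Function.uncurry f)
  measurable_g : Measurable (Function.uncurry g)
  measurable_k : Measurable (Function.uncurry k)
  lip_F : ∀ ξ w w', |F ξ w - F ξ w'| ≤ L * rU ξ * ‖w - w'‖
  lip_G : ∀ ξ w w', |G ξ w - G ξ w'| ≤ L * rV ξ * ‖w - w'‖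
  lip_f : ∀ s w w', ‖f s w - f s w'‖ ≤ L * ‖w - w'‖
  lip_g : ∀ s w w', |g s w - g s w'| ≤ L * ‖w - w'‖
  lip_k : ∀ s w w', |k s w - k s w'| ≤ L * ‖w - w'‖
  zero_F : ∀ ξ, F ξ 0 = 0
  zero_G : ∀ ξ, G ξ 0 = 0
  zero_f : ∀ s, f s 0 = 0
  zero_g : ∀ s, g s 0 = 0
  zero_k : ∀ s, k s 0 = 0

lemma norm_prod_sub_le {E F : Type*} [NormedAddCommGroup E] [NormedAddCommGroup F]
    {a a' : E} {b b' : F} {C : ℝ} (ha : ‖a - a'‖ ≤ C) (hb : ‖b - b'‖ ≤ C) :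
    ‖(a, b) - (a', b')‖ ≤ C := by
  rw [Prod.mk_sub_mk]
  exact max_le ha hb

lemma norm_integral_sub_le {E : Type*} [NormedAddCommGroup E] [NormedSpace ℝ E] {a b : ℝ}
    (hab : a ≤ b) {φ ψ : ℝ → E} {h : ℝ → ℝ}
    (hφ : IntervalIntegrable φ volume a b) (hψ : IntervalIntegrable ψ volume a b)
    (hh : IntervalIntegrable h volume a b) (hle : ∀ᵐ ξ, ξ ∈ Ioc a b → ‖φ ξ - ψ ξ‖ ≤ h ξ) :
    ‖(∫ ξ in a..b, φ ξ) - ∫ ξ in a..b, ψ ξ‖ ≤ ∫ ξ in a..b, h ξ := by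
  rw [← intervalIntegral.integral_sub hφ hψ]
  exact intervalIntegral.norm_integral_le_of_norm_le hab hle hh

lemma intervalIntegrable_of_bound {E : Type*} [NormedAddCommGroup E] [MeasurableSpace E]
    [BorelSpace E] [SecondCountableTopology E]
    {a b : ℝ} (hab : a ≤ b) {φ : ℝ → E} (hφ : Measurable φ) {C : ℝ}
    (hC : ∀ ξ ∈ Ioo a b, ‖φ ξ‖ ≤ C) : IntervalIntegrable φ volume a b := by
  rw [intervalIntegrable_iff_integrableOn_Ioo_of_le hab]
  exact Measure.integrableOn_of_bounded (M := C) (by simp) hφ.aestronglyMeasurable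
    ((ae_restrict_iff' measurableSet_Ioo).2 (Eventually.of_forall hC))

/-! ### Characteristic coordinates, weights and source-term estimates -/

namespace CharSystem

variable {n : ℕ} (S : CharSystem n)

/-- Travel time of the right-going characteristics from `0`. -/
noncomputable def A : ℝ ≃o ℝ := S.densU.iso
/-- Travel time of the left-going characteristics to `0`. -/
noncomputable def B : ℝ ≃o ℝ := S.densV.iso
/-- The difference of the two characteristic coordinates at a point. -/
noncomputable def w (x : ℝ) : ℝ := S.A x + S.B x

lemma densW : IsDensity (fun x => S.rU x + S.rV x) (S.l + S.l) where
  measurable := S.densU.measurable.add S.densV.measurable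
  pos x := add_pos (S.densU.pos x) (S.densV.pos x)
  le x := add_le_add (S.densU.le x) (S.densV.le x)
  one_le x hx := by
    have := S.densU.one_le x hx
    have := S.densV.pos x
    linarith

lemma w_eq : S.w = S.densW.iso := by
  funext x
  rw [IsDensity.iso_apply, intervalIntegral.integral_add (S.densU.intervalIntegrable _ _)
    (S.densV.intervalIntegrable _ _)]
  rfl

@[simp] lemma A_zero : S.A 0 = 0 := S.densU.iso_zero
@[simp] lemma B_zero : S.B 0 = 0 := S.densV.iso_zero
@[simp] lemma w_zero : S.w 0 = 0 := by simp [w]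

lemma continuous_A : Continuous S.A := S.A.continuous
lemma continuous_B : Continuous S.B := S.B.continuous
lemma continuous_w : Continuous S.w := S.continuous_A.add S.continuous_B
lemma measurable_A : Measurable S.A := S.continuous_A.measurable
lemma measurable_B : Measurable S.B := S.continuous_B.measurable
lemma measurable_w : Measurable S.w := S.continuous_w.measurable

lemma A_nonneg {x : ℝ} (hx : 0 ≤ x) : 0 ≤ S.A x := by simpa using S.A.monotone hx
lemma B_nonneg {x : ℝ} (hx : 0 ≤ x) : 0 ≤ S.B x := by simpa using S.B.monotone hx
lemma w_nonneg {x : ℝ} (hx : 0 ≤ x) : 0 ≤ S.w x := add_nonneg (S.A_nonneg hx) (S.B_nonneg hx)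
lemma w_mono : Monotone S.w := S.A.monotone.add S.B.monotone

/-- At position ξ the u-line p crosses the v-line p + w(ξ). Since w is itself the primitive of a
density, a null set of v-lines is met only at a null set of positions. The lemma `ae_sub_w` is the
same with the roles exchanged. -/
lemma ae_add_w {q : ℝ → Prop} (h : ∀ᵐ s, q s) (p : ℝ) : ∀ᵐ ξ, q (p + S.w ξ) := by
  have h1 : Measure.QuasiMeasurePreserving S.w volume volume := by
    rw [w_eq]; exact S.densW.quasiMeasurePreserving_iso
  exact ((measurePreserving_add_left volume p).quasiMeasurePreserving.comp h1).ae h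

lemma ae_sub_w {q : ℝ → Prop} (h : ∀ᵐ s, q s) (p : ℝ) : ∀ᵐ ξ, q (p - S.w ξ) := by
  have h1 : Measure.QuasiMeasurePreserving S.w volume volume := by
    rw [w_eq]; exact S.densW.quasiMeasurePreserving_iso
  exact ((Measure.measurePreserving_sub_left volume p).quasiMeasurePreserving.comp h1).ae h

lemma L_pos : 0 < S.L := by linarith [S.one_le_L]
lemma l_pos : 0 < S.l := by linarith [S.one_le_l]

/-- Ratio of the weights of the components. -/
noncomputable def c : ℝ := 4 * S.L
/-- Growth rate of the weights. -/
noncomputable def β : ℝ := 16 * S.L ^ 2 * S.l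

lemma one_le_c : 1 ≤ S.c := by unfold c; linarith [S.one_le_L]
lemma c_pos : 0 < S.c := by linarith [S.one_le_c]
lemma β_pos : 0 < S.β := by
  unfold β
  have := S.L_pos
  have := S.l_pos
  positivity

lemma c_le_sq : S.c ≤ S.c ^ 2 := by nlinarith [S.one_le_c]

/-- The constants are tuned for this identity. A source term costs L times the density bound l, the
u-weight exceeds the v-weight by c, and integrating the exponential gains 1/β, so each source
contributes at most a quarter of the distance. Pointwise boundary couplings cost L = c/4 and
contribute another quarter. -/
lemma L_mul_c_div_β : S.L * S.l * S.c / S.β = 1 / 4 := by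
  have := S.L_pos.ne'
  have := S.l_pos.ne'
  unfold c β
  field_simp
  norm_num

/-- The last time of the determinate set of `t₀`. -/
noncomputable def top (t₀ : ℝ) : ℝ := t₀ + S.B 1

/-- Evolution parameter on the `v`-characteristic with coordinate `q`: time below the characteristic
that starts at `x = 1` at time `t₀`, and `q + x` above it. -/
noncomputable def θ (t₀ x q : ℝ) : ℝ := if q < S.top t₀ then q - S.B x else q + x

/-- Position at which the `u`-characteristic with coordinate `p` starts. -/
noncomputable def footU (t₀ p : ℝ) : ℝ := max 0 (S.A.symm (t₀ - p))

/-- Position at which the `v`-characteristic with coordinate `q` starts at time `t₀`. -/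
noncomputable def footV (t₀ q : ℝ) : ℝ := S.B.symm (q - t₀)

lemma footU_nonneg (t₀ p : ℝ) : 0 ≤ S.footU t₀ p := le_max_left _ _

lemma footU_le_iff {t₀ p x : ℝ} : S.footU t₀ p ≤ x ↔ 0 ≤ x ∧ t₀ ≤ p + S.A x := by
  rw [footU, max_le_iff, OrderIso.symm_apply_le, sub_le_iff_le_add']

lemma footU_of_le {t₀ p : ℝ} (h : t₀ ≤ p) : S.footU t₀ p = 0 :=
  le_antisymm (S.footU_le_iff.2 ⟨le_rfl, by simpa using h⟩) (S.footU_nonneg _ _)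

lemma footU_of_lt {t₀ p : ℝ} (h : p < t₀) : S.footU t₀ p = S.A.symm (t₀ - p) := by
  refine max_eq_right ?_
  rw [OrderIso.le_symm_apply]
  simpa using h.le

lemma le_footV_iff {t₀ q x : ℝ} : x ≤ S.footV t₀ q ↔ t₀ ≤ q - S.B x := by
  rw [footV, OrderIso.le_symm_apply]
  constructor <;> intro h <;> linarith

lemma footV_lt_one {t₀ q : ℝ} (h : q < S.top t₀) : S.footV t₀ q < 1 := by
  rw [footV, OrderIso.symm_apply_lt]
  unfold top at h
  linarith

lemma le_θ {t₀ x q : ℝ} (hx : 0 ≤ x) (h : t₀ ≤ q - S.B x) : t₀ ≤ S.θ t₀ x q := by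
  have := S.B_nonneg hx
  unfold θ
  split_ifs <;> linarith

lemma le_top {t₀ : ℝ} : t₀ ≤ S.top t₀ := by
  have := S.B_nonneg zero_le_one
  unfold top
  linarith

lemma θ_le {t₀ x q : ℝ} (hx : 0 ≤ x) : S.θ t₀ x q ≤ q + x := by
  have := S.B_nonneg hx
  unfold θ
  split_ifs <;> linarith

lemma θ_zero (t₀ q : ℝ) : S.θ t₀ 0 q = q := by
  unfold θ
  split_ifs <;> simp

lemma measurable_footU (t₀ : ℝ) : Measurable (S.footU t₀) :=
  measurable_const.max (S.A.symm.continuous.measurable.comp (measurable_const.sub measurable_id))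

lemma measurable_footV (t₀ : ℝ) : Measurable (S.footV t₀) :=
  S.B.symm.continuous.measurable.comp (measurable_id.sub_const _)

/-- Boundary or initial value on the `u`-characteristic with coordinate `p`. -/
noncomputable def dataU (t₀ : ℝ) (U₀ : ℝ → ℝ) (v : ℝ → ℝ → ℝ) (X : ℝ → Fin n → ℝ) (p : ℝ) : ℝ :=
  if p < t₀ then U₀ (S.A.symm (t₀ - p)) else S.g p (X p, v 0 p)

/-- Right-hand side of the integrated equation for `u` in the coordinates `(x,p)`. -/
noncomputable def rhsU (t₀ : ℝ) (U₀ : ℝ → ℝ) (u v : ℝ → ℝ → ℝ) (X : ℝ → Fin n → ℝ) (x p : ℝ) : ℝ :=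
  S.dataU t₀ U₀ v X p + ∫ ξ in S.footU t₀ p..x, S.F ξ (u ξ p, v ξ (p + S.w ξ))

/-- Right-hand side of the integrated equation for `v` in the coordinates `(x,q)`, with the feedback
law as boundary value at `x = 0` on the lines that leave the domain after the time `top t₀`. -/
noncomputable def rhsV (t₀ : ℝ) (V₀ : ℝ → ℝ) (u v : ℝ → ℝ → ℝ) (X : ℝ → Fin n → ℝ) (x q : ℝ) : ℝ :=
  if q < S.top t₀ then
    V₀ (S.footV t₀ q) + ∫ ξ in x..S.footV t₀ q, S.G ξ (u ξ (q - S.w ξ), v ξ q)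
  else S.k q (X q) - ∫ ξ in (0 : ℝ)..x, S.G ξ (u ξ (q - S.w ξ), v ξ q)

/-- Right-hand side of the integrated ordinary differential equation. -/
noncomputable def rhsX (t₀ : ℝ) (X₀ : Fin n → ℝ) (v : ℝ → ℝ → ℝ) (X : ℝ → Fin n → ℝ) (t : ℝ) :
    Fin n → ℝ :=
  X₀ + ∫ s in t₀..t, S.f s (X s, v 0 s)

lemma norm_F_le (ξ : ℝ) (z : ℝ × ℝ) : |S.F ξ z| ≤ S.L * S.rU ξ * ‖z‖ := by
  simpa [S.zero_F] using S.lip_F ξ z 0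
lemma norm_G_le (ξ : ℝ) (z : ℝ × ℝ) : |S.G ξ z| ≤ S.L * S.rV ξ * ‖z‖ := by
  simpa [S.zero_G] using S.lip_G ξ z 0
lemma norm_f_le (s : ℝ) (z : (Fin n → ℝ) × ℝ) : ‖S.f s z‖ ≤ S.L * ‖z‖ := by
  simpa [S.zero_f] using S.lip_f s z 0
lemma norm_g_le (s : ℝ) (z : (Fin n → ℝ) × ℝ) : |S.g s z| ≤ S.L * ‖z‖ := by
  simpa [S.zero_g] using S.lip_g s z 0
lemma norm_k_le (s : ℝ) (z : Fin n → ℝ) : |S.k s z| ≤ S.L * ‖z‖ := by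
  simpa [S.zero_k] using S.lip_k s z 0

lemma intervalIntegrable_F {a b : ℝ} (hab : a ≤ b) {φ ψ : ℝ → ℝ} (hφ : Measurable φ)
    (hψ : Measurable ψ) (hC : ∃ C, ∀ ξ ∈ Ioo a b, |φ ξ| ≤ C ∧ |ψ ξ| ≤ C) :
    IntervalIntegrable (fun ξ => S.F ξ (φ ξ, ψ ξ)) volume a b := by
  obtain ⟨C, hC⟩ := hC
  refine intervalIntegrable_of_bound hab
    (S.measurable_F.comp (measurable_id.prodMk (hφ.prodMk hψ))) (C := S.L * S.l * C) fun ξ hξ => ?_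
  refine (S.norm_F_le _ _).trans ?_
  have h1 : ‖(φ ξ, ψ ξ)‖ ≤ C := max_le (hC ξ hξ).1 (hC ξ hξ).2
  have := S.L_pos.le
  exact mul_le_mul (mul_le_mul_of_nonneg_left (S.densU.le ξ) this) h1 (norm_nonneg _)
    (mul_nonneg this S.l_pos.le)

lemma intervalIntegrable_G {a b : ℝ} (hab : a ≤ b) {φ ψ : ℝ → ℝ} (hφ : Measurable φ)
    (hψ : Measurable ψ) (hC : ∃ C, ∀ ξ ∈ Ioo a b, |φ ξ| ≤ C ∧ |ψ ξ| ≤ C) :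
    IntervalIntegrable (fun ξ => S.G ξ (φ ξ, ψ ξ)) volume a b := by
  obtain ⟨C, hC⟩ := hC
  refine intervalIntegrable_of_bound hab
    (S.measurable_G.comp (measurable_id.prodMk (hφ.prodMk hψ))) (C := S.L * S.l * C) fun ξ hξ => ?_
  refine (S.norm_G_le _ _).trans ?_
  have h1 : ‖(φ ξ, ψ ξ)‖ ≤ C := max_le (hC ξ hξ).1 (hC ξ hξ).2
  have := S.L_pos.le
  exact mul_le_mul (mul_le_mul_of_nonneg_left (S.densV.le ξ) this) h1 (norm_nonneg _)
    (mul_nonneg this S.l_pos.le)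

lemma intervalIntegrable_f {a b : ℝ} (hab : a ≤ b) {φ : ℝ → Fin n → ℝ} {ψ : ℝ → ℝ}
    (hφ : Measurable φ) (hψ : Measurable ψ) (hC : ∃ C, ∀ s ∈ Ioo a b, ‖φ s‖ ≤ C ∧ |ψ s| ≤ C) :
    IntervalIntegrable (fun s => S.f s (φ s, ψ s)) volume a b := by
  obtain ⟨C, hC⟩ := hC
  refine intervalIntegrable_of_bound hab
    (S.measurable_f.comp (measurable_id.prodMk (hφ.prodMk hψ))) (C := S.L * C) fun s hs => ?_
  exact (S.norm_f_le _ _).trans (mul_le_mul_of_nonneg_left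
    (max_le (hC s hs).1 (hC s hs).2) S.L_pos.le)

/-- Along a u-line q increases with position. If the endpoint is below the line q = `top t₀`, then
`θ` is the time p + A(ξ) on the whole segment, and the density is absorbed by substitution.
Otherwise the segment may lie in both regimes; there the density is bounded by l, and `θ` by p +
w(x) + ξ with w frozen at the endpoint, which holds in either regime and is sharp at ξ = x. -/
lemma abs_integral_F_sub_le {t₀ p x M : ℝ} (hM : 0 ≤ M)
    (hx : S.footU t₀ p ≤ x) {u u' v v' : ℝ → ℝ}
    (hi : IntervalIntegrable (fun ξ => S.F ξ (u ξ, v ξ)) volume (S.footU t₀ p) x)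
    (hi' : IntervalIntegrable (fun ξ => S.F ξ (u' ξ, v' ξ)) volume (S.footU t₀ p) x)
    (hae : ∀ᵐ ξ, ξ ∈ Ioc (S.footU t₀ p) x →
      |u ξ - u' ξ| ≤ M * (S.c ^ 2 * Real.exp (S.β * S.θ t₀ ξ (p + S.w ξ))) ∧
      |v ξ - v' ξ| ≤ M * (S.c * Real.exp (S.β * S.θ t₀ ξ (p + S.w ξ)))) :
    |(∫ ξ in S.footU t₀ p..x, S.F ξ (u ξ, v ξ)) - ∫ ξ in S.footU t₀ p..x, S.F ξ (u' ξ, v' ξ)| ≤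
      M / 4 * (S.c ^ 2 * Real.exp (S.β * S.θ t₀ x (p + S.w x))) := by
  have hx0 := (S.footU_nonneg t₀ p).trans hx
  have hL := S.L_pos
  have hl := S.l_pos
  have hβ := S.β_pos
  have hcc := S.c_pos
  have hF : ∀ᵐ ξ, ξ ∈ Ioc (S.footU t₀ p) x → ‖S.F ξ (u ξ, v ξ) - S.F ξ (u' ξ, v' ξ)‖ ≤
      S.L * S.rU ξ * (M * (S.c ^ 2 * Real.exp (S.β * S.θ t₀ ξ (p + S.w ξ)))) := by
    filter_upwards [hae] with ξ h hξ
    obtain ⟨h1, h2⟩ := h hξ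
    refine (S.lip_F _ _ _).trans (mul_le_mul_of_nonneg_left (norm_prod_sub_le h1 (h2.trans ?_))
      (mul_nonneg hL.le (S.densU.pos ξ).le))
    gcongr
    exact S.c_le_sq
  have hconst : S.L * S.l / S.β ≤ 1 / 4 := by
    rw [← S.L_mul_c_div_β]
    exact div_le_div_of_nonneg_right (le_mul_of_one_le_right (by positivity) S.one_le_c) hβ.le
  by_cases hq : p + S.w x < S.top t₀
  · have hθ : S.θ t₀ x (p + S.w x) = p + S.A x := by
      rw [θ, if_pos hq, w]; ring
    have hint : IntervalIntegrable (fun ξ => (S.L * (M * S.c ^ 2)) *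
        (S.rU ξ * Real.exp (S.β * (p + S.densU.iso ξ)))) volume (S.footU t₀ p) x := by
      refine ((S.densU.intervalIntegrable _ _).mul_continuousOn ?_).const_mul _
      have := S.densU.iso.continuous
      fun_prop
    refine (norm_integral_sub_le hx hi hi' hint ?_).trans ?_
    · filter_upwards [hF] with ξ h hξ
      refine (h hξ).trans_eq ?_
      rw [θ, if_pos ((add_le_add_right (S.w_mono hξ.2) p).trans_lt hq), w,
        show p + (S.A ξ + S.B ξ) - S.B ξ = p + S.A ξ by ring]
      change _ = _ * (_ * Real.exp (S.β * (p + S.A ξ)))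
      ring
    · rw [intervalIntegral.integral_const_mul, hθ]
      refine (mul_le_mul_of_nonneg_left (S.densU.integral_mul_exp_iso_le hx hβ p)
        (by positivity)).trans ?_
      have h1 : S.L / S.β ≤ 1 / 4 := le_trans (by gcongr; nlinarith [S.one_le_l]) hconst
      calc S.L * (M * S.c ^ 2) * (Real.exp (S.β * (p + S.A x)) / S.β)
          = S.L / S.β * (M * S.c ^ 2 * Real.exp (S.β * (p + S.A x))) := by ring
        _ ≤ 1 / 4 * (M * S.c ^ 2 * Real.exp (S.β * (p + S.A x))) := by gcongr
        _ = _ := by ring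
  · have hθ : S.θ t₀ x (p + S.w x) = p + S.w x + x := by rw [θ, if_neg hq]
    have hint : IntervalIntegrable (fun ξ => (S.L * S.l * (M * S.c ^ 2)) *
        (Real.exp (S.β * (p + S.w x + ξ)))) volume (S.footU t₀ p) x :=
      Continuous.intervalIntegrable (by fun_prop) _ _
    refine (norm_integral_sub_le hx hi hi' hint ?_).trans ?_
    · filter_upwards [hF] with ξ h hξ
      have hξ0 : 0 ≤ ξ := (S.footU_nonneg t₀ p).trans hξ.1.le
      have h1 : S.θ t₀ ξ (p + S.w ξ) ≤ p + S.w x + ξ :=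
        (S.θ_le hξ0).trans (by linarith [S.w_mono hξ.2])
      have h2 := S.densU.le ξ
      calc _ ≤ _ := h hξ
        _ ≤ S.L * S.l * (M * (S.c ^ 2 * Real.exp (S.β * (p + S.w x + ξ)))) := by gcongr
        _ = _ := by ring
    · rw [intervalIntegral.integral_const_mul, hθ]
      refine (mul_le_mul_of_nonneg_left (integral_exp_add_le hx hβ _) (by positivity)).trans ?_
      calc S.L * S.l * (M * S.c ^ 2) * (Real.exp (S.β * (p + S.w x + x)) / S.β)
          = S.L * S.l / S.β * (M * S.c ^ 2 * Real.exp (S.β * (p + S.w x + x))) := by ring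
        _ ≤ 1 / 4 * (M * S.c ^ 2 * Real.exp (S.β * (p + S.w x + x))) := by gcongr
        _ = _ := by ring

lemma norm_G_sub_le {t₀ q ξ M : ℝ} (hM : 0 ≤ M) {a a' b b' : ℝ}
    (h1 : |a - a'| ≤ M * (S.c ^ 2 * Real.exp (S.β * S.θ t₀ ξ q)))
    (h2 : |b - b'| ≤ M * (S.c * Real.exp (S.β * S.θ t₀ ξ q))) :
    ‖S.G ξ (a, b) - S.G ξ (a', b')‖ ≤
      S.L * S.rV ξ * (M * (S.c ^ 2 * Real.exp (S.β * S.θ t₀ ξ q))) := by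
  refine (S.lip_G _ _ _).trans (mul_le_mul_of_nonneg_left (norm_prod_sub_le h1 (h2.trans ?_))
    (mul_nonneg S.L_pos.le (S.densV.pos ξ).le))
  gcongr
  exact S.c_le_sq

/-- Below the line q = `top t₀` the value at x comes from larger positions, hence earlier times; the
weight exp(β(q - B(ξ))) is largest at ξ = x, and that endpoint survives the integration. The extra
factor c comes from u entering the v-equation. -/
lemma abs_integral_G_sub_le_lower {t₀ q x M : ℝ} (hM : 0 ≤ M) (hx : x ≤ S.footV t₀ q)
    (hq : q < S.top t₀) {u u' v v' : ℝ → ℝ}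
    (hi : IntervalIntegrable (fun ξ => S.G ξ (u ξ, v ξ)) volume x (S.footV t₀ q))
    (hi' : IntervalIntegrable (fun ξ => S.G ξ (u' ξ, v' ξ)) volume x (S.footV t₀ q))
    (hae : ∀ᵐ ξ, ξ ∈ Ioc x (S.footV t₀ q) →
      |u ξ - u' ξ| ≤ M * (S.c ^ 2 * Real.exp (S.β * S.θ t₀ ξ q)) ∧
      |v ξ - v' ξ| ≤ M * (S.c * Real.exp (S.β * S.θ t₀ ξ q))) :
    |(∫ ξ in x..S.footV t₀ q, S.G ξ (u ξ, v ξ)) - ∫ ξ in x..S.footV t₀ q, S.G ξ (u' ξ, v' ξ)| ≤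
      M / 4 * (S.c * Real.exp (S.β * S.θ t₀ x q)) := by
  have hL := S.L_pos
  have hβ := S.β_pos
  have hcc := S.c_pos
  have hint : IntervalIntegrable (fun ξ => (S.L * (M * S.c ^ 2)) *
      (S.rV ξ * Real.exp (S.β * (q - S.densV.iso ξ)))) volume x (S.footV t₀ q) := by
    refine ((S.densV.intervalIntegrable _ _).mul_continuousOn ?_).const_mul _
    have := S.densV.iso.continuous
    fun_prop
  refine (norm_integral_sub_le hx hi hi' hint ?_).trans ?_
  · filter_upwards [hae] with ξ h hξ
    obtain ⟨h1, h2⟩ := h hξ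
    refine (S.norm_G_sub_le hM h1 h2).trans_eq ?_
    rw [θ, if_pos hq]
    change _ = _ * (_ * Real.exp (S.β * (q - S.B ξ)))
    ring
  · rw [intervalIntegral.integral_const_mul, θ, if_pos hq]
    refine (mul_le_mul_of_nonneg_left (S.densV.integral_mul_exp_neg_iso_le hx hβ q)
      (by positivity)).trans ?_
    have h1 : S.L * S.c / S.β ≤ 1 / 4 := by
      rw [← S.L_mul_c_div_β]
      gcongr
      exact le_mul_of_one_le_right hL.le S.one_le_l
    calc S.L * (M * S.c ^ 2) * (Real.exp (S.β * (q - S.B x)) / S.β)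
        = S.L * S.c / S.β * (M * S.c * Real.exp (S.β * (q - S.B x))) := by ring
      _ ≤ 1 / 4 * (M * S.c * Real.exp (S.β * (q - S.B x))) := by gcongr
      _ = _ := by ring

/-- On upper lines integration starts from the feedback value at x = 0 and runs against the
propagation of v. Time decreases in that direction, so a weight in t would be useless; q + ξ
increases. The resulting factor is exactly 1/4 by `L_mul_c_div_β`. -/
lemma abs_integral_G_sub_le_upper {t₀ q x M : ℝ} (hM : 0 ≤ M) (hx : 0 ≤ x)
    (hq : ¬ q < S.top t₀) {u u' v v' : ℝ → ℝ}
    (hi : IntervalIntegrable (fun ξ => S.G ξ (u ξ, v ξ)) volume 0 x)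
    (hi' : IntervalIntegrable (fun ξ => S.G ξ (u' ξ, v' ξ)) volume 0 x)
    (hae : ∀ᵐ ξ, ξ ∈ Ioc 0 x →
      |u ξ - u' ξ| ≤ M * (S.c ^ 2 * Real.exp (S.β * S.θ t₀ ξ q)) ∧
      |v ξ - v' ξ| ≤ M * (S.c * Real.exp (S.β * S.θ t₀ ξ q))) :
    |(∫ ξ in (0 : ℝ)..x, S.G ξ (u ξ, v ξ)) - ∫ ξ in (0 : ℝ)..x, S.G ξ (u' ξ, v' ξ)| ≤
      M / 4 * (S.c * Real.exp (S.β * S.θ t₀ x q)) := by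
  have hL := S.L_pos
  have hl := S.l_pos
  have hβ := S.β_pos
  have hcc := S.c_pos
  have hint : IntervalIntegrable (fun ξ => (S.L * S.l * (M * S.c ^ 2)) *
      (Real.exp (S.β * (q + ξ)))) volume 0 x :=
    Continuous.intervalIntegrable (by fun_prop) _ _
  refine (norm_integral_sub_le hx hi hi' hint ?_).trans ?_
  · filter_upwards [hae] with ξ h hξ
    obtain ⟨h1, h2⟩ := h hξ
    have h3 := S.densV.le ξ
    calc _ ≤ _ := S.norm_G_sub_le hM h1 h2
      _ ≤ S.L * S.l * (M * (S.c ^ 2 * Real.exp (S.β * S.θ t₀ ξ q))) := by gcongr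
      _ = _ := by rw [θ, if_neg hq]; ring
  · rw [intervalIntegral.integral_const_mul, θ, if_neg hq]
    refine (mul_le_mul_of_nonneg_left (integral_exp_add_le hx hβ q) (by positivity)).trans_eq ?_
    calc S.L * S.l * (M * S.c ^ 2) * (Real.exp (S.β * (q + x)) / S.β)
        = S.L * S.l * S.c / S.β * (M * S.c * Real.exp (S.β * (q + x))) := by ring
      _ = _ := by rw [S.L_mul_c_div_β]; ring

end CharSystem

/-! ### Admissible region, good lines and the contraction estimate -/

namespace CharSystem

variable {n : ℕ} (S : CharSystem n)

/-- The points of the strip after the time `t₀`, in the coordinates `(x,q)`. -/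
def Adm (t₀ : ℝ) : Set (ℝ × ℝ) := {z | 0 ≤ z.1 ∧ z.1 ≤ 1 ∧ t₀ ≤ z.2 - S.B z.1}

lemma add_w_sub_B (p x : ℝ) : p + S.w x - S.B x = p + S.A x := by
  unfold w; ring

lemma sub_w_add_w (q x : ℝ) : q - S.w x + S.w x = q := by ring

lemma mem_Adm_u {t₀ p x : ℝ} : (x, p + S.w x) ∈ S.Adm t₀ ↔ S.footU t₀ p ≤ x ∧ x ≤ 1 := by
  rw [footU_le_iff, Adm, mem_ofPred_eq, add_w_sub_B]
  tauto

lemma mem_Adm_v {t₀ q x : ℝ} : (x, q) ∈ S.Adm t₀ ↔ 0 ≤ x ∧ x ≤ 1 ∧ x ≤ S.footV t₀ q := by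
  rw [le_footV_iff]; rfl

lemma le_of_mem_Adm {t₀ q x : ℝ} (h : (x, q) ∈ S.Adm t₀) : t₀ ≤ q := by
  have := S.B_nonneg h.1
  have := h.2.2
  simp only at *
  linarith

lemma zero_mem_Adm {t₀ q : ℝ} (h : t₀ ≤ q) : ((0 : ℝ), q) ∈ S.Adm t₀ :=
  ⟨le_rfl, zero_le_one, by simpa using h⟩

lemma mem_Adm_upper {t₀ q x : ℝ} (hx : 0 ≤ x) (hx1 : x ≤ 1) (hq : S.top t₀ ≤ q) :
    (x, q) ∈ S.Adm t₀ := by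
  refine ⟨hx, hx1, ?_⟩
  have := S.B.monotone hx1
  unfold top at hq
  simp only
  linarith

lemma measurableSet_Adm (t₀ : ℝ) : MeasurableSet (S.Adm t₀) :=
  (measurableSet_le measurable_const measurable_fst).inter
    ((measurableSet_le measurable_fst measurable_const).inter
      (measurableSet_le measurable_const
        (measurable_snd.sub (S.measurable_B.comp measurable_fst))))

/-- Weight of the component `u`. -/
noncomputable def ωU (t₀ x p : ℝ) : ℝ := S.c ^ 2 * Real.exp (S.β * S.θ t₀ x (p + S.w x))
/-- Weight of the component `v`. -/
noncomputable def ωV (t₀ x q : ℝ) : ℝ := S.c * Real.exp (S.β * S.θ t₀ x q)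
/-- Weight of the component `X`. -/
noncomputable def ωX (t : ℝ) : ℝ := Real.exp (S.β * t)

lemma one_le_ωX {t : ℝ} (ht : 0 ≤ t) : 1 ≤ S.ωX t :=
  Real.one_le_exp (mul_nonneg S.β_pos.le ht)

lemma ωX_pos (t : ℝ) : 0 < S.ωX t := Real.exp_pos _

lemma ωV_pos (t₀ x q : ℝ) : 0 < S.ωV t₀ x q := mul_pos S.c_pos (Real.exp_pos _)
lemma ωU_pos (t₀ x p : ℝ) : 0 < S.ωU t₀ x p := mul_pos (pow_pos S.c_pos 2) (Real.exp_pos _)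

lemma one_le_ωV {t₀ x q : ℝ} (ht : 0 ≤ t₀) (h : (x, q) ∈ S.Adm t₀) : 1 ≤ S.ωV t₀ x q :=
  one_le_mul_of_one_le_of_one_le S.one_le_c
    (S.one_le_ωX (ht.trans (S.le_θ h.1 h.2.2)))

lemma one_le_ωU {t₀ x p : ℝ} (ht : 0 ≤ t₀) (h : (x, p + S.w x) ∈ S.Adm t₀) : 1 ≤ S.ωU t₀ x p :=
  one_le_mul_of_one_le_of_one_le (one_le_pow₀ S.one_le_c)
    (S.one_le_ωX (ht.trans (S.le_θ h.1 h.2.2)))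

lemma ωV_zero (t₀ q : ℝ) : S.ωV t₀ 0 q = S.c * S.ωX q := by rw [ωV, θ_zero, ωX]

lemma ωU_sub_w (t₀ x q : ℝ) : S.ωU t₀ x (q - S.w x) = S.c * S.ωV t₀ x q := by
  rw [ωU, ωV, sub_w_add_w]; ring

/-- Measurability of a triple and boundedness on the part `q ≤ T` of the strip. -/
structure Regular (t₀ T : ℝ) (u v : ℝ → ℝ → ℝ) (X : ℝ → Fin n → ℝ) : Prop where
  measurable_u : Measurable (Function.uncurry u)
  measurable_v : Measurable (Function.uncurry v)
  measurable_X : Measurable X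
  bounded : ∃ M, (∀ p x, (x, p + S.w x) ∈ S.Adm t₀ → p + S.w x ≤ T → |u x p| ≤ M) ∧
    (∀ q x, (x, q) ∈ S.Adm t₀ → q ≤ T → |v x q| ≤ M) ∧ ∀ t, t₀ ≤ t → t ≤ T → ‖X t‖ ≤ M

/-- Weighted distance of two triples on good characteristics in the part `q ≤ T` of the strip. -/
structure CloseOn (t₀ T : ℝ) (Gu Gv : Set ℝ) (u v : ℝ → ℝ → ℝ) (X : ℝ → Fin n → ℝ)
    (u' v' : ℝ → ℝ → ℝ) (X' : ℝ → Fin n → ℝ) (M : ℝ) : Prop where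
  u : ∀ p ∈ Gu, ∀ x, (x, p + S.w x) ∈ S.Adm t₀ → p + S.w x ≤ T →
    |u x p - u' x p| ≤ M * S.ωU t₀ x p
  v : ∀ q ∈ Gv, ∀ x, (x, q) ∈ S.Adm t₀ → q ≤ T → |v x q - v' x q| ≤ M * S.ωV t₀ x q
  X : ∀ t, t₀ ≤ t → t ≤ T → ‖X t - X' t‖ ≤ M * S.ωX t

/-- Almost every characteristic is good. -/
structure GoodLines (T : ℝ) (Gu Gv : Set ℝ) : Prop where
  ae_u : ∀ᵐ p : ℝ, p ∈ Gu
  ae_v : ∀ᵐ q : ℝ, q ≤ T → q ∈ Gv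
  sub : ∀ p ∈ Gu, p ≤ T → p ∈ Gv

lemma GoodLines.inter {T : ℝ} {Gu Gv Gu' Gv' : Set ℝ} (h : GoodLines T Gu Gv)
    (h' : GoodLines T Gu' Gv') : GoodLines T (Gu ∩ Gu') (Gv ∩ Gv') where
  ae_u := h.ae_u.and h'.ae_u
  ae_v := by filter_upwards [h.ae_v, h'.ae_v] with q h1 h2 hq using ⟨h1 hq, h2 hq⟩
  sub p hp hT := ⟨h.sub p hp.1 hT, h'.sub p hp.2 hT⟩

variable {S}

lemma Regular.measurable_u_line {t₀ T : ℝ} {u v : ℝ → ℝ → ℝ} {X : ℝ → Fin n → ℝ}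
    (h : S.Regular t₀ T u v X) {φ : ℝ → ℝ} (hφ : Measurable φ) : Measurable fun ξ => u ξ (φ ξ) :=
  h.measurable_u.comp (measurable_id.prodMk hφ)

lemma Regular.measurable_v_line {t₀ T : ℝ} {u v : ℝ → ℝ → ℝ} {X : ℝ → Fin n → ℝ}
    (h : S.Regular t₀ T u v X) {φ : ℝ → ℝ} (hφ : Measurable φ) : Measurable fun ξ => v ξ (φ ξ) :=
  h.measurable_v.comp (measurable_id.prodMk hφ)

lemma Regular.integrable_u {t₀ T : ℝ} {u v : ℝ → ℝ → ℝ} {X : ℝ → Fin n → ℝ}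
    (h : S.Regular t₀ T u v X) {p x y : ℝ} (hx : S.footU t₀ p ≤ x) (hxy : x ≤ y) (hy : y ≤ 1)
    (hT : p + S.w y ≤ T) :
    IntervalIntegrable (fun ξ => S.F ξ (u ξ p, v ξ (p + S.w ξ))) volume x y := by
  obtain ⟨M, h1, h2, -⟩ := h.bounded
  refine S.intervalIntegrable_F hxy (h.measurable_u_line measurable_const)
    (h.measurable_v_line (measurable_const.add S.measurable_w)) ⟨M, fun ξ hξ => ?_⟩
  have h3 : (ξ, p + S.w ξ) ∈ S.Adm t₀ := S.mem_Adm_u.2 ⟨hx.trans hξ.1.le, hξ.2.le.trans hy⟩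
  have h4 : p + S.w ξ ≤ T := (add_le_add_right (S.w_mono hξ.2.le) p).trans hT
  exact ⟨h1 _ _ h3 h4, h2 _ _ h3 h4⟩

lemma Regular.integrable_v {t₀ T : ℝ} {u v : ℝ → ℝ → ℝ} {X : ℝ → Fin n → ℝ}
    (h : S.Regular t₀ T u v X) {q x y : ℝ} (hx : 0 ≤ x) (hxy : x ≤ y)
    (hy : (y, q) ∈ S.Adm t₀) (hT : q ≤ T) :
    IntervalIntegrable (fun ξ => S.G ξ (u ξ (q - S.w ξ), v ξ q)) volume x y := by
  obtain ⟨M, h1, h2, -⟩ := h.bounded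
  refine S.intervalIntegrable_G hxy (h.measurable_u_line (measurable_const.sub S.measurable_w))
    (h.measurable_v_line measurable_const) ⟨M, fun ξ hξ => ?_⟩
  have h3 : (ξ, q) ∈ S.Adm t₀ := by
    rw [mem_Adm_v] at hy ⊢
    exact ⟨hx.trans hξ.1.le, hξ.2.le.trans hy.2.1, hξ.2.le.trans hy.2.2⟩
  refine ⟨h1 _ _ ?_ ?_, h2 _ _ h3 hT⟩ <;> rwa [sub_w_add_w]

lemma Regular.integrable_f {t₀ T : ℝ} {u v : ℝ → ℝ → ℝ} {X : ℝ → Fin n → ℝ}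
    (h : S.Regular t₀ T u v X) {s t : ℝ} (hs : t₀ ≤ s) (hst : s ≤ t) (ht : t ≤ T) :
    IntervalIntegrable (fun s => S.f s (X s, v 0 s)) volume s t := by
  obtain ⟨M, -, h2, h3⟩ := h.bounded
  refine S.intervalIntegrable_f hst h.measurable_X
    (h.measurable_v.comp (measurable_const.prodMk measurable_id)) ⟨M, fun ξ hξ => ?_⟩
  have h4 := hs.trans hξ.1.le
  have h5 := hξ.2.le.trans ht
  exact ⟨h3 _ h4 h5, h2 _ _ (S.zero_mem_Adm h4) h5⟩

/-- The pointwise couplings form a chain X → v → u: the feedback feeds X into v and `g` feeds X and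
v into u. The weights 1, c, c² at x = 0 follow this chain, so each Lipschitz factor L ≤ c/4 leaves
M/4. The integrals leave another M/4. Since t₀ ≥ 0, all weights are at least one in the region and δ
is absorbed as δ times the weight. -/
lemma CloseOn.rhs {t₀ T δ M : ℝ} {Gu Gv : Set ℝ} {u v u' v' : ℝ → ℝ → ℝ} {X X' : ℝ → Fin n → ℝ}
    {U₀ V₀ U₀' V₀' : ℝ → ℝ} {X₀ X₀' : Fin n → ℝ} (ht₀ : 0 ≤ t₀) (hM : 0 ≤ M)
    (hG : GoodLines T Gu Gv) (hr : S.Regular t₀ T u v X) (hr' : S.Regular t₀ T u' v' X')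
    (hδ : 0 ≤ δ)
    (hU : ∀ a, |U₀ a - U₀' a| ≤ δ) (hV : ∀ a, |V₀ a - V₀' a| ≤ δ) (hX : ‖X₀ - X₀'‖ ≤ δ)
    (h : S.CloseOn t₀ T Gu Gv u v X u' v' X' M) :
    S.CloseOn t₀ T Gu Gv (S.rhsU t₀ U₀ u v X) (S.rhsV t₀ V₀ u v X) (S.rhsX t₀ X₀ v X)
      (S.rhsU t₀ U₀' u' v' X') (S.rhsV t₀ V₀' u' v' X') (S.rhsX t₀ X₀' v' X') (δ + M / 2) := by
  have hc := S.one_le_c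
  have hcL : S.L ≤ S.c / 4 := by unfold c; linarith
  have hL := S.L_pos
  refine ⟨fun p hp x hA hT => ?_, fun q hq x hA hT => ?_, fun t ht hT => ?_⟩
  · obtain ⟨hx, hx1⟩ := S.mem_Adm_u.1 hA
    have hae : ∀ᵐ ξ, ξ ∈ Ioc (S.footU t₀ p) x →
        |u ξ p - u' ξ p| ≤ M * S.ωU t₀ ξ p ∧
        |v ξ (p + S.w ξ) - v' ξ (p + S.w ξ)| ≤ M * S.ωV t₀ ξ (p + S.w ξ) := by
      filter_upwards [S.ae_add_w hG.ae_v p] with ξ hξ hξx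
      have h3 : (ξ, p + S.w ξ) ∈ S.Adm t₀ := S.mem_Adm_u.2 ⟨hξx.1.le, hξx.2.trans hx1⟩
      have h4 : p + S.w ξ ≤ T := (add_le_add_right (S.w_mono hξx.2) p).trans hT
      exact ⟨h.u p hp ξ h3 h4, h.v _ (hξ h4) ξ h3 h4⟩
    have key := S.abs_integral_F_sub_le hM hx (hr.integrable_u le_rfl hx hx1 hT)
      (hr'.integrable_u le_rfl hx hx1 hT) hae
    change _ ≤ M / 4 * S.ωU t₀ x p at key
    have hdata : |S.dataU t₀ U₀ v X p - S.dataU t₀ U₀' v' X' p| ≤ (δ + M / 4) * S.ωU t₀ x p := by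
      have h1 := S.one_le_ωU ht₀ hA
      unfold dataU
      split_ifs with hpt
      · refine (hU _).trans ?_
        have : 0 ≤ M / 4 * S.ωU t₀ x p := mul_nonneg (by linarith) (by linarith)
        nlinarith
      · have hpt := not_lt.1 hpt
        have hpT : p ≤ T := le_trans (by linarith [S.w_nonneg hA.1]) hT
        -- The boundary value uses v at one single point, so an almost-everywhere statement does not
        -- help: the u-line p must start on a good v-line, which is the purpose of the field `sub`
        -- of `GoodLines`.
        have hv := h.v p (hG.sub p hp hpT) 0 (S.zero_mem_Adm hpt) hpT
        have hXp := h.X p hpt hpT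
        rw [ωV_zero] at hv
        have hωle : S.c ^ 2 * S.ωX p ≤ S.ωU t₀ x p := by
          refine mul_le_mul_of_nonneg_left (Real.exp_le_exp.2
            (mul_le_mul_of_nonneg_left ?_ S.β_pos.le)) (by positivity)
          have h5 := S.w_nonneg hA.1
          have h6 := S.A_nonneg hA.1
          have h7 : (0 : ℝ) ≤ x := hA.1
          unfold θ
          split_ifs
          · rw [add_w_sub_B]; linarith
          · linarith
        have hωX := S.ωX_pos p
        have h8 : ‖(X p, v 0 p) - (X' p, v' 0 p)‖ ≤ M * (S.c * S.ωX p) :=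
          norm_prod_sub_le (hXp.trans (mul_le_mul_of_nonneg_left
            (le_mul_of_one_le_left hωX.le hc) hM)) hv
        calc _ ≤ S.L * ‖(X p, v 0 p) - (X' p, v' 0 p)‖ := S.lip_g _ _ _
          _ ≤ S.c / 4 * (M * (S.c * S.ωX p)) := by gcongr
          _ = M / 4 * (S.c ^ 2 * S.ωX p) := by ring
          _ ≤ M / 4 * S.ωU t₀ x p := by gcongr
          _ ≤ _ := mul_le_mul_of_nonneg_right (by linarith) (by linarith)
    unfold rhsU
    rw [add_sub_add_comm]
    refine (abs_add_le _ _).trans ((add_le_add hdata key).trans_eq (by ring))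
  · have hadm := S.mem_Adm_v.1 hA
    have hω := S.one_le_ωV ht₀ hA
    have hae : ∀ᵐ ξ, (ξ, q) ∈ S.Adm t₀ →
        |u ξ (q - S.w ξ) - u' ξ (q - S.w ξ)| ≤
          M * (S.c ^ 2 * Real.exp (S.β * S.θ t₀ ξ q)) ∧
        |v ξ q - v' ξ q| ≤ M * (S.c * Real.exp (S.β * S.θ t₀ ξ q)) := by
      filter_upwards [S.ae_sub_w hG.ae_u q] with ξ hξ hξA
      refine ⟨?_, h.v _ hq ξ hξA hT⟩
      have := h.u _ hξ ξ (by rwa [sub_w_add_w]) (by rwa [sub_w_add_w])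
      rwa [ωU, sub_w_add_w] at this
    unfold rhsV
    split_ifs with hqt
    · have hf1 := S.footV_lt_one hqt
      have hfA : (S.footV t₀ q, q) ∈ S.Adm t₀ :=
        S.mem_Adm_v.2 ⟨hadm.1.trans hadm.2.2, hf1.le, le_rfl⟩
      have key := S.abs_integral_G_sub_le_lower hM hadm.2.2 hqt
        (hr.integrable_v hadm.1 hadm.2.2 hfA hT) (hr'.integrable_v hadm.1 hadm.2.2 hfA hT) (by
          filter_upwards [hae] with ξ hξ hξx
          exact hξ (S.mem_Adm_v.2 ⟨hadm.1.trans hξx.1.le, hξx.2.trans hf1.le, hξx.2⟩))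
      rw [add_sub_add_comm]
      refine (abs_add_le _ _).trans ((add_le_add (hV _) key).trans ?_)
      change δ + M / 4 * S.ωV t₀ x q ≤ _
      nlinarith
    · have hle := not_lt.1 hqt
      have key := S.abs_integral_G_sub_le_upper hM hadm.1 hqt
        (hr.integrable_v le_rfl hadm.1 hA hT) (hr'.integrable_v le_rfl hadm.1 hA hT) (by
          filter_upwards [hae] with ξ hξ hξx
          exact hξ (S.mem_Adm_upper hξx.1.le (hξx.2.trans hadm.2.1) hle))
      change _ ≤ M / 4 * S.ωV t₀ x q at key
      have hXq := h.X q (S.le_of_mem_Adm hA) hT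
      have hωle : S.c * S.ωX q ≤ S.ωV t₀ x q := by
        refine mul_le_mul_of_nonneg_left (Real.exp_le_exp.2
          (mul_le_mul_of_nonneg_left ?_ S.β_pos.le)) (by positivity)
        rw [θ, if_neg hqt]
        linarith [hadm.1]
      have hk : |S.k q (X q) - S.k q (X' q)| ≤ M / 4 * S.ωV t₀ x q := by
        have hωX := S.ωX_pos q
        calc _ ≤ S.L * ‖X q - X' q‖ := S.lip_k _ _ _
          _ ≤ S.c / 4 * (M * S.ωX q) := by gcongr
          _ = M / 4 * (S.c * S.ωX q) := by ring
          _ ≤ _ := by gcongr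
      rw [sub_sub_sub_comm]
      refine (abs_sub _ _).trans ((add_le_add hk key).trans ?_)
      nlinarith
  · have hint : IntervalIntegrable (fun s => (S.L * (M * S.c)) *
        Real.exp (S.β * (0 + s))) volume t₀ t :=
      Continuous.intervalIntegrable (by fun_prop) _ _
    have key := norm_integral_sub_le ht (hr.integrable_f le_rfl ht hT)
      (hr'.integrable_f le_rfl ht hT) hint (by
        filter_upwards [hG.ae_v] with s hs hst
        have h1 := h.X s hst.1.le (hst.2.trans hT)
        have h2 := h.v s (hs (hst.2.trans hT)) 0 (S.zero_mem_Adm hst.1.le) (hst.2.trans hT)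
        rw [ωV_zero] at h2
        have hωX := S.ωX_pos s
        have h8 : ‖(X s, v 0 s) - (X' s, v' 0 s)‖ ≤ M * (S.c * S.ωX s) :=
          norm_prod_sub_le (h1.trans (mul_le_mul_of_nonneg_left
            (le_mul_of_one_le_left hωX.le hc) hM)) h2
        calc _ ≤ S.L * ‖(X s, v 0 s) - (X' s, v' 0 s)‖ := S.lip_f _ _ _
          _ ≤ S.L * (M * (S.c * S.ωX s)) := by gcongr
          _ = _ := by rw [zero_add]; unfold ωX; ring)
    have h1 : S.L * S.c / S.β ≤ 1 / 4 := by
      rw [← S.L_mul_c_div_β]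
      have := S.β_pos
      gcongr
      exact le_mul_of_one_le_right hL.le S.one_le_l
    have hωX := S.one_le_ωX (ht₀.trans ht)
    have h2 : (∫ s in t₀..t, (S.L * (M * S.c)) * Real.exp (S.β * (0 + s))) ≤ M / 4 * S.ωX t := by
      rw [intervalIntegral.integral_const_mul]
      refine (mul_le_mul_of_nonneg_left (integral_exp_add_le ht S.β_pos 0)
        (by positivity)).trans ?_
      calc S.L * (M * S.c) * (Real.exp (S.β * (0 + t)) / S.β)
          = S.L * S.c / S.β * (M * S.ωX t) := by unfold ωX; rw [zero_add]; ring
        _ ≤ 1 / 4 * (M * S.ωX t) := by gcongr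
        _ = _ := by ring
    unfold rhsX
    rw [add_sub_add_comm]
    refine (norm_add_le _ _).trans ((add_le_add hX (key.trans h2)).trans ?_)
    nlinarith

/-- Solutions of the integrated equations on almost all characteristics in the part `q ≤ T` of the
strip after the time `t₀`. -/
structure IsLineSolution (S : CharSystem n) (t₀ : ℝ) (U₀ V₀ : ℝ → ℝ) (X₀ : Fin n → ℝ) (T : ℝ)
    (Gu Gv : Set ℝ) (u v : ℝ → ℝ → ℝ) (X : ℝ → Fin n → ℝ) : Prop where
  regular : S.Regular t₀ T u v X
  u_eq : ∀ p ∈ Gu, ∀ x, (x, p + S.w x) ∈ S.Adm t₀ → p + S.w x ≤ T →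
    u x p = S.rhsU t₀ U₀ u v X x p
  v_eq : ∀ q ∈ Gv, ∀ x, (x, q) ∈ S.Adm t₀ → q ≤ T → v x q = S.rhsV t₀ V₀ u v X x q
  X_eq : ∀ t, t₀ ≤ t → t ≤ T → X t = S.rhsX t₀ X₀ v X t

lemma IsLineSolution.mono {t₀ T : ℝ} {U₀ V₀ : ℝ → ℝ} {X₀ : Fin n → ℝ} {Gu Gv Gu' Gv' : Set ℝ}
    {u v : ℝ → ℝ → ℝ} {X : ℝ → Fin n → ℝ} (h : S.IsLineSolution t₀ U₀ V₀ X₀ T Gu Gv u v X)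
    (hu : Gu' ⊆ Gu) (hv : Gv' ⊆ Gv) : S.IsLineSolution t₀ U₀ V₀ X₀ T Gu' Gv' u v X :=
  ⟨h.regular, fun p hp => h.u_eq p (hu hp), fun q hq => h.v_eq q (hv hq), h.X_eq⟩

/-- Continuous dependence on the data. -/
lemma IsLineSolution.closeOn {t₀ T δ : ℝ} {Gu Gv : Set ℝ} {u v u' v' : ℝ → ℝ → ℝ}
    {X X' : ℝ → Fin n → ℝ} {U₀ V₀ U₀' V₀' : ℝ → ℝ} {X₀ X₀' : Fin n → ℝ} (ht₀ : 0 ≤ t₀)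
    (hG : GoodLines T Gu Gv) (h : S.IsLineSolution t₀ U₀ V₀ X₀ T Gu Gv u v X)
    (h' : S.IsLineSolution t₀ U₀' V₀' X₀' T Gu Gv u' v' X') (hδ : 0 ≤ δ)
    (hU : ∀ a, |U₀ a - U₀' a| ≤ δ) (hV : ∀ a, |V₀ a - V₀' a| ≤ δ) (hX : ‖X₀ - X₀'‖ ≤ δ) :
    S.CloseOn t₀ T Gu Gv u v X u' v' X' (2 * δ) := by
  -- Some finite weighted distance exists because both solutions are bounded for q ≤ T and the
  -- weights are at least one.
  have hex : ∃ M, 0 ≤ M ∧ S.CloseOn t₀ T Gu Gv u v X u' v' X' M := by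
    obtain ⟨M, h1, h2, h3⟩ := h.regular.bounded
    obtain ⟨M', h1', h2', h3'⟩ := h'.regular.bounded
    have aux : ∀ {y b : ℝ}, y ≤ M + M' → 1 ≤ b → y ≤ max 0 (M + M') * b := fun hy hb =>
      (hy.trans (le_max_right 0 _)).trans (le_mul_of_one_le_right (le_max_left _ _) hb)
    refine ⟨max 0 (M + M'), le_max_left _ _, fun p _ x hA hT => ?_, fun q _ x hA hT => ?_,
      fun t ht hT => ?_⟩
    · exact aux ((abs_sub _ _).trans (add_le_add (h1 _ _ hA hT) (h1' _ _ hA hT)))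
        (S.one_le_ωU ht₀ hA)
    · exact aux ((abs_sub _ _).trans (add_le_add (h2 _ _ hA hT) (h2' _ _ hA hT)))
        (S.one_le_ωV ht₀ hA)
    · exact aux ((norm_sub_le _ _).trans (add_le_add (h3 _ ht hT) (h3' _ ht hT)))
        (S.one_le_ωX (ht₀.trans ht))
  -- Both triples reproduce themselves under the right-hand sides, so any bound M improves to δ +
  -- M/2; iterating gives 2δ.
  obtain ⟨M, hM, hB⟩ := exists_seq_bounds_tendsto hδ hex fun M hM hc => by
    have := hc.rhs ht₀ hM hG h.regular h'.regular hδ hU hV hX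
    refine ⟨fun p hp x hA hT => ?_, fun q hq x hA hT => ?_, fun t ht hT => ?_⟩
    · rw [h.u_eq p hp x hA hT, h'.u_eq p hp x hA hT]
      exact this.u p hp x hA hT
    · rw [h.v_eq q hq x hA hT, h'.v_eq q hq x hA hT]
      exact this.v q hq x hA hT
    · rw [h.X_eq t ht hT, h'.X_eq t ht hT]
      exact this.X t ht hT
  exact ⟨fun p hp x hA hT => ge_of_tendsto' (hM.mul_const _) fun k => (hB k).u p hp x hA hT,
    fun q hq x hA hT => ge_of_tendsto' (hM.mul_const _) fun k => (hB k).v q hq x hA hT,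
    fun t ht hT => ge_of_tendsto' (hM.mul_const _) fun k => (hB k).X t ht hT⟩

end CharSystem

/-! ### Global existence by a weighted fixed point -/

namespace CharSystem

variable {n : ℕ} (S : CharSystem n)

lemma rhsU_zero (t₀ x p : ℝ) :
    S.rhsU t₀ (fun _ => 0) (fun _ _ => 0) (fun _ _ => 0) (fun _ => 0) x p = 0 := by
  have h1 : ∀ ξ, S.F ξ (0, 0) = 0 := S.zero_F
  have h2 : ∀ s, S.g s (0, 0) = 0 := S.zero_g
  simp [rhsU, dataU, h1, h2]

lemma rhsV_zero (t₀ x q : ℝ) :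
    S.rhsV t₀ (fun _ => 0) (fun _ _ => 0) (fun _ _ => 0) (fun _ => 0) x q = 0 := by
  have h1 : ∀ ξ, S.G ξ (0, 0) = 0 := S.zero_G
  have h2 : ∀ s, S.k s 0 = 0 := S.zero_k
  simp [rhsV, h1, h2]

lemma rhsX_zero (t₀ t : ℝ) :
    S.rhsX t₀ 0 (fun _ _ => 0) (fun _ => 0) t = 0 := by
  have h1 : ∀ ξ, S.f ξ (0, 0) = 0 := S.zero_f
  simp [rhsX, h1]

lemma regular_zero (t₀ T : ℝ) : S.Regular t₀ T (fun _ _ => 0) (fun _ _ => 0) (fun _ => 0) :=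
  ⟨measurable_const, measurable_const, measurable_const, 0, by simp, by simp, by simp⟩

lemma isLineSolution_zero (t₀ T : ℝ) (Gu Gv : Set ℝ) :
    S.IsLineSolution t₀ (fun _ => 0) (fun _ => 0) 0 T Gu Gv (fun _ _ => 0) (fun _ _ => 0)
      (fun _ => 0) :=
  ⟨S.regular_zero t₀ T, fun _ _ _ _ _ => (S.rhsU_zero _ _ _).symm,
    fun _ _ _ _ _ => (S.rhsV_zero _ _ _).symm, fun _ _ _ => (S.rhsX_zero _ _).symm⟩

lemma goodLines_univ (T : ℝ) : GoodLines T univ univ :=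
  ⟨by simp, by simp, fun _ _ _ => mem_univ _⟩

lemma measurable_rhsU (t₀ : ℝ) {U₀ : ℝ → ℝ} (hU : Measurable U₀) {u v : ℝ → ℝ → ℝ}
    {X : ℝ → Fin n → ℝ} (hu : Measurable (Function.uncurry u)) (hv : Measurable (Function.uncurry v))
    (hX : Measurable X) : Measurable fun z : ℝ × ℝ => S.rhsU t₀ U₀ u v X z.1 z.2 := by
  refine Measurable.add ?_ ?_
  · refine Measurable.ite (measurableSet_lt measurable_snd measurable_const) ?_ ?_
    · exact hU.comp (S.A.symm.continuous.measurable.comp (measurable_const.sub measurable_snd))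
    · exact S.measurable_g.comp (measurable_snd.prodMk ((hX.comp measurable_snd).prodMk
        (hv.comp (measurable_const.prodMk measurable_snd))))
  · refine measurable_intervalIntegral_param ((S.measurable_footU t₀).comp measurable_snd)
      measurable_fst (h := fun z ξ => S.F ξ (u ξ z.2, v ξ (z.2 + S.w ξ))) ?_
    exact S.measurable_F.comp (measurable_snd.prodMk
      ((hu.comp (measurable_snd.prodMk measurable_fst.snd)).prodMk
        (hv.comp (measurable_snd.prodMk
          (measurable_fst.snd.add (S.measurable_w.comp measurable_snd))))))

lemma measurable_rhsV (t₀ : ℝ) {V₀ : ℝ → ℝ} (hV : Measurable V₀) {u v : ℝ → ℝ → ℝ}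
    {X : ℝ → Fin n → ℝ} (hu : Measurable (Function.uncurry u)) (hv : Measurable (Function.uncurry v))
    (hX : Measurable X) : Measurable fun z : ℝ × ℝ => S.rhsV t₀ V₀ u v X z.1 z.2 := by
  have hG : Measurable (Function.uncurry fun (z : ℝ × ℝ) ξ =>
      S.G ξ (u ξ (z.2 - S.w ξ), v ξ z.2)) :=
    S.measurable_G.comp (measurable_snd.prodMk
      ((hu.comp (measurable_snd.prodMk
        (measurable_fst.snd.sub (S.measurable_w.comp measurable_snd)))).prodMk
        (hv.comp (measurable_snd.prodMk measurable_fst.snd))))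
  refine Measurable.ite (measurableSet_lt measurable_snd measurable_const)
    (Measurable.add ?_ ?_) (Measurable.sub ?_ ?_)
  · exact hV.comp ((S.measurable_footV t₀).comp measurable_snd)
  · exact measurable_intervalIntegral_param measurable_fst
      ((S.measurable_footV t₀).comp measurable_snd) hG
  · exact S.measurable_k.comp (measurable_snd.prodMk (hX.comp measurable_snd))
  · exact measurable_intervalIntegral_param measurable_const measurable_fst hG

lemma measurable_rhsX (t₀ : ℝ) (X₀ : Fin n → ℝ) {v : ℝ → ℝ → ℝ}
    {X : ℝ → Fin n → ℝ} (hv : Measurable (Function.uncurry v))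
    (hX : Measurable X) : Measurable (S.rhsX t₀ X₀ v X) := by
  refine measurable_const.add (measurable_intervalIntegral_param measurable_const measurable_id
    (h := fun _ s => S.f s (X s, v 0 s)) ?_)
  exact S.measurable_f.comp (measurable_snd.prodMk ((hX.comp measurable_snd).prodMk
    (hv.comp (measurable_const.prodMk measurable_snd))))

/-- Index space of the triples `(u,v,X)` regarded as scalar functions. -/
abbrev Index (n : ℕ) := (ℝ × ℝ) ⊕ (ℝ × ℝ) ⊕ (ℝ × Fin n)

/-- The common weight of the three components. -/
noncomputable def weight (t₀ : ℝ) : Index n → ℝ :=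
  Sum.elim (fun z => S.ωU t₀ z.1 z.2) (Sum.elim (fun z => S.ωV t₀ z.1 z.2) fun z => S.ωX z.1)

/-- First component of a scalar function on the index space. -/
def compU (y : Index n → ℝ) (x p : ℝ) : ℝ := y (Sum.inl (x, p))
/-- Second component of a scalar function on the index space. -/
def compV (y : Index n → ℝ) (x q : ℝ) : ℝ := y (Sum.inr (Sum.inl (x, q)))
/-- Third component of a scalar function on the index space. -/
def compX (y : Index n → ℝ) (t : ℝ) (i : Fin n) : ℝ := y (Sum.inr (Sum.inr (t, i)))

open Classical in
/-- The fixed point operator of the integrated equations. -/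
noncomputable def picard (t₀ : ℝ) (U₀ V₀ : ℝ → ℝ) (X₀ : Fin n → ℝ) (y : Index n → ℝ) : Index n → ℝ :=
  Sum.elim
    (fun z => if (z.1, z.2 + S.w z.1) ∈ S.Adm t₀ then
      S.rhsU t₀ U₀ (compU y) (compV y) (compX y) z.1 z.2 else 0)
    (Sum.elim
      (fun z => if z ∈ S.Adm t₀ then S.rhsV t₀ V₀ (compU y) (compV y) (compX y) z.1 z.2 else 0)
      (fun z => if t₀ ≤ z.1 then S.rhsX t₀ X₀ (compV y) (compX y) z.1 z.2 else 0))

variable {S}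

/-- For q ≤ T and x ≤ 1 the evolution parameter is at most T + 1, so a weighted bound on the whole
region is an ordinary bound on each part q ≤ T. -/
lemma regular_of_weight {t₀ M : ℝ} {y : Index n → ℝ} (hy : Measurable y)
    (hM : ∀ s, |y s| ≤ M * S.weight t₀ s) (T : ℝ) :
    S.Regular t₀ T (compU y) (compV y) (compX y) := by
  have hc := S.one_le_c
  have hexp : ∀ {s}, s ≤ T + 1 → Real.exp (S.β * s) ≤ Real.exp (S.β * (T + 1)) := fun hs =>
    Real.exp_le_exp.2 (mul_le_mul_of_nonneg_left hs S.β_pos.le)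
  have hθ : ∀ {x q}, (x, q) ∈ S.Adm t₀ → q ≤ T → S.θ t₀ x q ≤ T + 1 := fun hA hT =>
    (S.θ_le hA.1).trans (add_le_add hT hA.2.1)
  have aux : ∀ {s b}, S.weight t₀ s ≤ b → |y s| ≤ |M| * b := fun {s b} hs =>
    (hM s).trans ((mul_le_mul_of_nonneg_right (le_abs_self M) (by
      rcases s with z | z | z
      · exact (S.ωU_pos _ _ _).le
      · exact (S.ωV_pos _ _ _).le
      · exact (S.ωX_pos _).le)).trans (mul_le_mul_of_nonneg_left hs (abs_nonneg M)))
  refine ⟨hy.comp measurable_inl, hy.comp (measurable_inr.comp measurable_inl),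
    measurable_pi_lambda _ fun i => hy.comp (measurable_inr.comp (measurable_inr.comp
      (measurable_id.prodMk measurable_const))),
    |M| * (S.c ^ 2 * Real.exp (S.β * (T + 1))), fun p x hA hT => ?_, fun q x hA hT => ?_,
      fun t ht hT => ?_⟩
  · exact aux (mul_le_mul_of_nonneg_left (hexp (hθ hA hT)) (by positivity))
  · exact aux (mul_le_mul S.c_le_sq (hexp (hθ hA hT)) (Real.exp_pos _).le (by positivity))
  · refine (pi_norm_le_iff_of_nonneg (by positivity)).2 fun i => aux ?_
    exact (hexp (by linarith)).trans (le_mul_of_one_le_left (Real.exp_pos _).le (one_le_pow₀ hc))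

/-- This is `CloseOn.rhs` with every line good. The horizon T is chosen separately at each point, as
its own q or t, so no global unweighted bound is needed; outside the region both images are zero. -/
lemma abs_picard_sub_le {t₀ δ M : ℝ} {y y' : Index n → ℝ} {U₀ V₀ U₀' V₀' : ℝ → ℝ}
    {X₀ X₀' : Fin n → ℝ} (ht₀ : 0 ≤ t₀) (hM : 0 ≤ M) (hδ : 0 ≤ δ) (hy : Measurable y)
    (hy' : Measurable y') (hb : ∃ C, ∀ s, |y s| ≤ C * S.weight t₀ s)
    (hb' : ∃ C, ∀ s, |y' s| ≤ C * S.weight t₀ s)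
    (hU : ∀ a, |U₀ a - U₀' a| ≤ δ) (hV : ∀ a, |V₀ a - V₀' a| ≤ δ) (hX : ‖X₀ - X₀'‖ ≤ δ)
    (h : ∀ s, |y s - y' s| ≤ M * S.weight t₀ s) (s : Index n) :
    |S.picard t₀ U₀ V₀ X₀ y s - S.picard t₀ U₀' V₀' X₀' y' s| ≤
      (δ + M / 2) * S.weight t₀ s := by
  obtain ⟨C, hC⟩ := hb
  obtain ⟨C', hC'⟩ := hb'
  have hD : 0 ≤ δ + M / 2 := by linarith
  have key : ∀ T, S.CloseOn t₀ T univ univ _ _ _ _ _ _ (δ + M / 2) := fun T =>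
    CloseOn.rhs ht₀ hM (goodLines_univ T) (regular_of_weight hy hC T)
      (regular_of_weight hy' hC' T) hδ hU hV hX
      ⟨fun p _ x _ _ => h _, fun q _ x _ _ => h _, fun t _ _ =>
        (pi_norm_le_iff_of_nonneg (mul_nonneg hM (S.ωX_pos t).le)).2 fun i => h _⟩
  rcases s with z | z | z
  · simp only [picard, Sum.elim_inl]
    split_ifs with hA
    · exact (key _).u _ (mem_univ _) _ hA le_rfl
    · rw [sub_zero, abs_zero]
      exact mul_nonneg hD (S.ωU_pos _ _ _).le
  · simp only [picard, Sum.elim_inl, Sum.elim_inr]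
    split_ifs with hA
    · exact (key _).v _ (mem_univ _) _ hA le_rfl
    · rw [sub_zero, abs_zero]
      exact mul_nonneg hD (S.ωV_pos _ _ _).le
  · simp only [picard, Sum.elim_inr]
    split_ifs with hA
    · exact (norm_le_pi_norm _ z.2).trans ((key _).X _ hA le_rfl)
    · rw [sub_zero, abs_zero]
      exact mul_nonneg hD (S.ωX_pos _).le

lemma measurable_picard {t₀ M : ℝ} {y : Index n → ℝ} {U₀ V₀ : ℝ → ℝ} (hU : Measurable U₀)
    (hV : Measurable V₀) (X₀ : Fin n → ℝ) (hy : Measurable y)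
    (hM : ∀ s, |y s| ≤ M * S.weight t₀ s) : Measurable (S.picard t₀ U₀ V₀ X₀ y) := by
  have hr := regular_of_weight hy hM 0
  refine Measurable.sumElim ?_ (Measurable.sumElim ?_ ?_)
  · refine Measurable.ite ?_
      (S.measurable_rhsU t₀ hU hr.measurable_u hr.measurable_v hr.measurable_X) measurable_const
    exact (S.measurableSet_Adm t₀).preimage (measurable_fst.prodMk
      (measurable_snd.add (S.measurable_w.comp measurable_fst)))
  · exact Measurable.ite (S.measurableSet_Adm t₀)
      (S.measurable_rhsV t₀ hV hr.measurable_u hr.measurable_v hr.measurable_X) measurable_const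
  · refine Measurable.ite (measurableSet_le measurable_const measurable_fst) ?_ measurable_const
    refine measurable_from_prod_countable_left fun i => ?_
    exact (measurable_pi_apply i).comp (S.measurable_rhsX t₀ X₀ hr.measurable_v hr.measurable_X)

/-- Global existence for the integrated equations. -/
lemma exists_isLineSolution {t₀ : ℝ} (ht₀ : 0 ≤ t₀) {U₀ V₀ : ℝ → ℝ} (hU : Measurable U₀)
    (hV : Measurable V₀) {C : ℝ} (hUC : ∀ a, |U₀ a| ≤ C) (hVC : ∀ a, |V₀ a| ≤ C)
    (X₀ : Fin n → ℝ) :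
    ∃ (u v : ℝ → ℝ → ℝ) (X : ℝ → Fin n → ℝ), ∀ T,
      S.IsLineSolution t₀ U₀ V₀ X₀ T univ univ u v X := by
  have hω : ∀ s : Index n, 0 < S.weight t₀ s := by
    rintro (z | z | z)
    · exact S.ωU_pos _ _ _
    · exact S.ωV_pos _ _ _
    · exact S.ωX_pos _
  have hC : 0 ≤ C := (abs_nonneg _).trans (hUC 0)
  -- The image of 0 is compared with its image under the operator with zero data, which is 0; only
  -- the difference of the data remains.
  have hzero : ∃ M, ∀ s, |S.picard t₀ U₀ V₀ X₀ 0 s| ≤ M * S.weight t₀ s := by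
    refine ⟨max C ‖X₀‖, fun s => ?_⟩
    have h0 : ∃ C, ∀ s : Index n, |(0 : Index n → ℝ) s| ≤ C * S.weight t₀ s := ⟨0, by simp⟩
    have key := abs_picard_sub_le (S := S) (U₀ := U₀) (V₀ := V₀) (X₀ := X₀) (U₀' := fun _ => 0)
      (V₀' := fun _ => 0) (X₀' := 0) (δ := max C ‖X₀‖) ht₀ le_rfl (hC.trans (le_max_left _ _))
      measurable_zero measurable_zero h0 h0
      (fun a => by simpa using Or.inl (hUC a)) (fun a => by simpa using Or.inl (hVC a))
      (by simp) (by simp) s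
    have hz : S.picard t₀ (fun _ => 0) (fun _ => 0) 0 (0 : Index n → ℝ) s = 0 := by
      rcases s with z | z | z
      · simp only [picard, Sum.elim_inl, ite_eq_right_iff]
        exact fun _ => S.rhsU_zero _ _ _
      · simp only [picard, Sum.elim_inl, Sum.elim_inr, ite_eq_right_iff]
        exact fun _ => S.rhsV_zero _ _ _
      · simp only [picard, Sum.elim_inr, ite_eq_right_iff]
        exact fun _ => congrFun (S.rhsX_zero _ _) _
    simpa [hz] using key
  obtain ⟨y, hy, ⟨M, hM⟩, hfix⟩ := exists_measurable_fixedPoint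
      (Φ := S.picard t₀ U₀ V₀ X₀) (ω := S.weight t₀) hω
      (fun y hy ⟨M, hM⟩ => measurable_picard hU hV X₀ hy hM) hzero <| by
    intro y y' hy hy' hb hb' M hM hle s
    have := abs_picard_sub_le (S := S) (U₀ := U₀) (V₀ := V₀) (X₀ := X₀) (U₀' := U₀) (V₀' := V₀)
      (X₀' := X₀) ht₀ hM le_rfl hy hy' hb hb' (by simp) (by simp) (by simp) hle s
    simpa using this
  refine ⟨compU y, compV y, compX y, fun T => ⟨regular_of_weight hy hM T, fun p _ x hA _ => ?_,
    fun q _ x hA _ => ?_, fun t ht _ => funext fun i => ?_⟩⟩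
  · have := congrFun hfix (Sum.inl (x, p))
    simp only [picard, Sum.elim_inl, if_pos hA] at this
    exact this.symm
  · have := congrFun hfix (Sum.inr (Sum.inl (x, q)))
    simp only [picard, Sum.elim_inl, Sum.elim_inr, if_pos hA] at this
    exact this.symm
  · have := congrFun hfix (Sum.inr (Sum.inr (t, i)))
    simp only [picard, Sum.elim_inr, if_pos ht] at this
    exact this.symm

end CharSystem

/-! ### The normalized system of a hyperbolic system -/

/-- The normalized system `S` agrees with the plant `P` and the controller `K` on the domain. -/
structure IsNormalForm {n : ℕ} (P : HypSystem n) (K : (Fin n → ℝ) → ℝ → ℝ) (S : CharSystem n) :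
    Prop where
  rU : ∀ x ∈ Icc (0 : ℝ) 1, S.rU x = (P.lamU x)⁻¹
  rV : ∀ x ∈ Icc (0 : ℝ) 1, S.rV x = (P.lamV x)⁻¹
  F : ∀ x ∈ Icc (0 : ℝ) 1, ∀ z, S.F x z = P.fU x z / P.lamU x
  G : ∀ x ∈ Icc (0 : ℝ) 1, ∀ z, S.G x z = P.fV x z / P.lamV x
  f : ∀ s, 0 ≤ s → ∀ X v, S.f s (X, v) = P.f0 X v s
  g : ∀ s, 0 ≤ s → ∀ X v, S.g s (X, v) = P.g0 X v s
  k : ∀ s, 0 ≤ s → ∀ X, S.k s X = K X s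

/-- A Carathéodory function, measurable in s and continuous in the state, is jointly measurable. The
constant may depend on s because the sources per unit length inherit the factor 1/λ. -/
lemma measurable_uncurry_of_lipschitz {E F : Type*} [NormedAddCommGroup E]
    [MeasurableSpace E] [BorelSpace E] [SecondCountableTopology E]
    [NormedAddCommGroup F] [MeasurableSpace F] [BorelSpace F] {φ : ℝ → E → F} {C : ℝ → ℝ}
    (hm : ∀ z, Measurable fun s => φ s z) (hl : ∀ s z z', ‖φ s z - φ s z'‖ ≤ C s * ‖z - z'‖) :
    Measurable (Function.uncurry φ) := by
  have hc : ∀ s, Continuous fun z => φ s z := fun s => by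
    refine (LipschitzWith.of_dist_le_mul (K := (C s).toNNReal) fun z z' => ?_).continuous
    rw [dist_eq_norm, dist_eq_norm]
    exact (hl s z z').trans (mul_le_mul_of_nonneg_right (Real.le_coe_toNNReal _) (norm_nonneg _))
  have := measurable_uncurry_of_continuous_of_measurable (u := fun z s => φ s z) hc hm
  exact this.comp measurable_swap

-- The plant is controlled only on [0,1] and for nonnegative times. Extending the densities by 1 and
-- everything else by 0 makes the bounds hold on all of ℝ, including the Lipschitz bounds of `F` and
-- `G` proportional to the densities.
open Classical in
lemma exists_isNormalForm {n : ℕ} {P : HypSystem n} {K : (Fin n → ℝ) → ℝ → ℝ}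
    (hP : SemilinearAssumption P K) : ∃ S : CharSystem n, IsNormalForm P K S := by
  obtain ⟨l, hl⟩ := hP.speed_lower_bound
  obtain ⟨L₁, hL₁⟩ := hP.lipschitz_F
  obtain ⟨L₂, hL₂⟩ := hP.lipschitz_f0
  obtain ⟨L₃, hL₃⟩ := hP.lipschitz_g0
  obtain ⟨L₄, hL₄⟩ := hP.lipschitz_K
  set L : ℝ≥0 := max 1 (max (max L₁ L₂) (max L₃ L₄)) with hL
  have h1 : L₁ ≤ L := ((le_max_left _ _).trans (le_max_left _ _)).trans (le_max_right _ _)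
  have h2 : L₂ ≤ L := ((le_max_right _ _).trans (le_max_left _ _)).trans (le_max_right _ _)
  have h3 : L₃ ≤ L := ((le_max_left _ _).trans (le_max_right _ _)).trans (le_max_right _ _)
  have h4 : L₄ ≤ L := ((le_max_right _ _).trans (le_max_right _ _)).trans (le_max_right _ _)
  have dens : ∀ {lam : ℝ → ℝ}, Measurable lam → (∀ x ∈ Icc (0 : ℝ) 1, 0 < lam x) →
      (∀ x ∈ Icc (0 : ℝ) 1, (lam x)⁻¹ ≤ l) →
      IsDensity (fun x => if x ∈ Icc (0 : ℝ) 1 then (lam x)⁻¹ else 1) (max 1 l) := by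
    intro lam hm hp hle
    refine ⟨Measurable.ite measurableSet_Icc hm.inv measurable_const, fun x => ?_, fun x => ?_,
      fun x hx => ?_⟩
    · split_ifs with hx
      · exact inv_pos.2 (hp x hx)
      · exact one_pos
    · split_ifs with hx
      · exact (hle x hx).trans (le_max_right _ _)
      · exact le_max_left _ _
    · simp only [if_neg hx, le_refl]
  have src : ∀ {φ : ℝ → ℝ × ℝ → ℝ} {lam : ℝ → ℝ}, (∀ x ∈ Icc (0 : ℝ) 1, 0 < lam x) →
      (∀ x ∈ Icc (0 : ℝ) 1, LipschitzWith L₁ (φ x)) → ∀ ξ z z',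
      |(if ξ ∈ Icc (0 : ℝ) 1 then φ ξ z / lam ξ else 0) -
        (if ξ ∈ Icc (0 : ℝ) 1 then φ ξ z' / lam ξ else 0)| ≤
        L * (if ξ ∈ Icc (0 : ℝ) 1 then (lam ξ)⁻¹ else 1) * ‖z - z'‖ := by
    intro φ lam hp hlip ξ z z'
    split_ifs with hξ
    · have := (hlip ξ hξ).weaken h1 |>.dist_le_mul z z'
      rw [Real.dist_eq, dist_eq_norm] at this
      have hi := inv_pos.2 (hp ξ hξ)
      rw [← sub_div, div_eq_mul_inv, abs_mul, abs_of_pos hi]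
      calc _ ≤ L * ‖z - z'‖ * (lam ξ)⁻¹ := by gcongr
        _ = _ := by ring
    · rw [sub_zero, abs_zero]; positivity
  have bdy : ∀ {E F : Type} [NormedAddCommGroup E] [NormedAddCommGroup F] {φ : ℝ → E → F},
      (∀ s, 0 ≤ s → LipschitzWith L (φ s)) → ∀ s z z',
      ‖(if 0 ≤ s then φ s z else 0) - (if 0 ≤ s then φ s z' else 0)‖ ≤ L * ‖z - z'‖ := by
    intro E F _ _ φ hlip s z z'
    split_ifs with hs
    · have := (hlip s hs).dist_le_mul z z'
      rwa [dist_eq_norm, dist_eq_norm] at this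
    · rw [sub_zero, norm_zero]; positivity
  have lF := src (φ := P.fU) hP.lamU_pos fun x hx => (hL₁ x hx).1
  have lG := src (φ := P.fV) hP.lamV_pos fun x hx => (hL₁ x hx).2
  have lf := bdy (φ := fun s (z : (Fin n → ℝ) × ℝ) => P.f0 z.1 z.2 s)
    fun s hs => (hL₂ s hs).weaken h2
  have lg := bdy (φ := fun s (z : (Fin n → ℝ) × ℝ) => P.g0 z.1 z.2 s)
    fun s hs => (hL₃ s hs).weaken h3
  have lk := bdy (φ := fun s (z : Fin n → ℝ) => K z s) fun s hs => (hL₄ s hs).weaken h4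
  refine ⟨{
    rU := fun x => if x ∈ Icc (0 : ℝ) 1 then (P.lamU x)⁻¹ else 1
    rV := fun x => if x ∈ Icc (0 : ℝ) 1 then (P.lamV x)⁻¹ else 1
    F := fun x z => if x ∈ Icc (0 : ℝ) 1 then P.fU x z / P.lamU x else 0
    G := fun x z => if x ∈ Icc (0 : ℝ) 1 then P.fV x z / P.lamV x else 0
    f := fun s z => if 0 ≤ s then P.f0 z.1 z.2 s else 0
    g := fun s z => if 0 ≤ s then P.g0 z.1 z.2 s else 0
    k := fun s z => if 0 ≤ s then K z s else 0
    L := L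
    l := max 1 l
    one_le_L := by exact_mod_cast le_max_left _ _
    one_le_l := le_max_left _ _
    densU := dens hP.measurable_lamU hP.lamU_pos fun x hx => (le_max_left _ _).trans (hl x hx)
    densV := dens hP.measurable_lamV hP.lamV_pos fun x hx => (le_max_right _ _).trans (hl x hx)
    measurable_F := measurable_uncurry_of_lipschitz (fun z => Measurable.ite measurableSet_Icc
      ((hP.measurable_fU z).div hP.measurable_lamU) measurable_const) lF
    measurable_G := measurable_uncurry_of_lipschitz (fun z => Measurable.ite measurableSet_Icc
      ((hP.measurable_fV z).div hP.measurable_lamV) measurable_const) lG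
    measurable_f := measurable_uncurry_of_lipschitz (fun z => Measurable.ite measurableSet_Ici
      (hP.measurable_f0 z.1 z.2) measurable_const) lf
    measurable_g := measurable_uncurry_of_lipschitz (fun z => Measurable.ite measurableSet_Ici
      (hP.measurable_g0 z.1 z.2) measurable_const) lg
    measurable_k := measurable_uncurry_of_lipschitz (fun z => Measurable.ite measurableSet_Ici
      (hP.measurable_K z) measurable_const) lk
    lip_F := lF
    lip_G := lG
    lip_f := lf
    lip_g := lg
    lip_k := lk
    zero_F := fun ξ => by
      split_ifs with h
      · rw [(hP.F_zero ξ h).1, zero_div]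
      · rfl
    zero_G := fun ξ => by
      split_ifs with h
      · rw [(hP.F_zero ξ h).2, zero_div]
      · rfl
    zero_f := fun s => by
      split_ifs with h
      · exact hP.f0_zero s h
      · rfl
    zero_g := fun s => by
      split_ifs with h
      · exact hP.g0_zero s h
      · rfl
    zero_k := fun s => by
      split_ifs with h
      · exact hP.K_zero s h
      · rfl }, ?_⟩
  exact ⟨fun x hx => if_pos hx, fun x hx => if_pos hx, fun x hx z => if_pos hx,
    fun x hx z => if_pos hx, fun s hs X v => if_pos hs, fun s hs X v => if_pos hs,
    fun s hs X => if_pos hs⟩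

namespace IsNormalForm

variable {n : ℕ} {P : HypSystem n} {K : (Fin n → ℝ) → ℝ → ℝ} {S : CharSystem n}
  (hS : IsNormalForm P K S)
include hS

lemma charU_eq (t : ℝ) {a x : ℝ} (ha : a ∈ Icc (0 : ℝ) 1) (hx : x ∈ Icc (0 : ℝ) 1) :
    P.charU t a x = t - S.A a + S.A x := by
  have h1 : S.A x - S.A a = _ := S.densU.iso_sub a x
  have h2 : ∫ ξ in a..x, (P.lamU ξ)⁻¹ = ∫ ξ in a..x, S.rU ξ :=
    intervalIntegral.integral_congr fun ξ hξ => (hS.rU ξ (ordConnected_Icc.uIcc_subset ha hx hξ)).symm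
  rw [HypSystem.charU, h2, ← h1]
  ring

lemma charV_eq (t : ℝ) {a x : ℝ} (ha : a ∈ Icc (0 : ℝ) 1) (hx : x ∈ Icc (0 : ℝ) 1) :
    P.charV t a x = t + S.B a - S.B x := by
  have h1 : S.B a - S.B x = _ := S.densV.iso_sub x a
  have h2 : ∫ ξ in x..a, (P.lamV ξ)⁻¹ = ∫ ξ in x..a, S.rV ξ :=
    intervalIntegral.integral_congr fun ξ hξ => (hS.rV ξ (ordConnected_Icc.uIcc_subset hx ha hξ)).symm
  rw [HypSystem.charV, h2, ← h1]
  ring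

lemma tauV_eq (t : ℝ) {x : ℝ} (hx : x ∈ Icc (0 : ℝ) 1) :
    P.tauV t x = S.top t - S.B x :=
  hS.charV_eq t (right_mem_Icc.2 zero_le_one) hx

lemma tauV_zero (t : ℝ) : P.tauV t 0 = S.top t := by
  rw [hS.tauV_eq t (left_mem_Icc.2 zero_le_one), S.B_zero, sub_zero]

lemma integral_F {a b : ℝ} (ha : a ∈ Icc (0 : ℝ) 1) (hb : b ∈ Icc (0 : ℝ) 1) (φ : ℝ → ℝ × ℝ) :
    ∫ ξ in a..b, P.fU ξ (φ ξ) / P.lamU ξ = ∫ ξ in a..b, S.F ξ (φ ξ) :=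
  intervalIntegral.integral_congr fun ξ hξ =>
    (hS.F ξ (ordConnected_Icc.uIcc_subset ha hb hξ) _).symm

lemma integral_G {a b : ℝ} (ha : a ∈ Icc (0 : ℝ) 1) (hb : b ∈ Icc (0 : ℝ) 1) (φ : ℝ → ℝ × ℝ) :
    ∫ ξ in a..b, P.fV ξ (φ ξ) / P.lamV ξ = ∫ ξ in a..b, S.G ξ (φ ξ) :=
  intervalIntegral.integral_congr fun ξ hξ =>
    (hS.G ξ (ordConnected_Icc.uIcc_subset ha hb hξ) _).symm

lemma mem_detSet {t x s : ℝ} :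
    (x, s) ∈ P.detSet t ↔ x ∈ Icc (0 : ℝ) 1 ∧ t ≤ s ∧ s + S.B x ≤ S.top t := by
  refine and_congr_right fun hx => ?_
  simp only at hx
  rw [mem_Icc, hS.tauV_eq t hx, le_sub_iff_add_le]

lemma mem_detSet' {t x s : ℝ} :
    (x, s) ∈ P.detSet' t ↔ x ∈ Icc (0 : ℝ) 1 ∧ t ≤ s ∧ s + S.B x < S.top t := by
  refine and_congr_right fun hx => ?_
  simp only at hx
  rw [mem_Ico, hS.tauV_eq t hx, lt_sub_iff_add_lt]

end IsNormalForm

lemma ae_unitMeasure_iff {q : ℝ → Prop} :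
    (∀ᵐ a ∂unitMeasure, q a) ↔ ∀ᵐ a : ℝ, a ∈ Icc (0 : ℝ) 1 → q a :=
  ae_restrict_iff' measurableSet_Icc

/-! ### Broad solutions in characteristic coordinates -/

namespace CharSystem

variable {n : ℕ} (S : CharSystem n)

/-- A function of `(x,t)` in the coordinates `(x,p)` of the `u`-characteristics. -/
noncomputable def lineU (u : ℝ → ℝ → ℝ) (x p : ℝ) : ℝ := u x (p + S.A x)
/-- A function of `(x,t)` in the coordinates `(x,q)` of the `v`-characteristics. -/
noncomputable def lineV (v : ℝ → ℝ → ℝ) (x q : ℝ) : ℝ := v x (q - S.B x)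

lemma lineU_sub_w (u : ℝ → ℝ → ℝ) (x q : ℝ) : S.lineU u x (q - S.w x) = u x (q - S.B x) := by
  rw [lineU, w]; congr 1; ring

lemma lineV_zero (v : ℝ → ℝ → ℝ) (q : ℝ) : S.lineV v 0 q = v 0 q := by
  rw [lineV, B_zero, sub_zero]

lemma measurable_lineU {u : ℝ → ℝ → ℝ} (hu : Measurable (Function.uncurry u)) :
    Measurable (Function.uncurry (S.lineU u)) :=
  hu.comp (measurable_fst.prodMk (measurable_snd.add (S.measurable_A.comp measurable_fst)))

lemma measurable_lineV {v : ℝ → ℝ → ℝ} (hv : Measurable (Function.uncurry v)) :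
    Measurable (Function.uncurry (S.lineV v)) :=
  hv.comp (measurable_fst.prodMk (measurable_snd.sub (S.measurable_B.comp measurable_fst)))

lemma ae_comp_A_symm {q : ℝ → Prop} (h : ∀ᵐ a, q a) (t : ℝ) : ∀ᵐ p, q (S.A.symm (t - p)) :=
  (S.densU.quasiMeasurePreserving_symm.comp
    (Measure.measurePreserving_sub_left volume t).quasiMeasurePreserving).ae h

lemma ae_comp_B_symm {q : ℝ → Prop} (h : ∀ᵐ a, q a) (t : ℝ) : ∀ᵐ p, q (S.B.symm (p - t)) :=
  (S.densV.quasiMeasurePreserving_symm.comp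
    (measurePreserving_sub_right volume t).quasiMeasurePreserving).ae h

lemma ae_sub_A {q : ℝ → Prop} (h : ∀ᵐ s, q s) (t : ℝ) : ∀ᵐ x, q (t - S.A x) :=
  ((Measure.measurePreserving_sub_left volume t).quasiMeasurePreserving.comp
    S.densU.quasiMeasurePreserving_iso).ae h

lemma ae_add_B {q : ℝ → Prop} (h : ∀ᵐ s, q s) (t : ℝ) : ∀ᵐ x, q (t + S.B x) :=
  ((measurePreserving_add_left volume t).quasiMeasurePreserving.comp
    S.densV.quasiMeasurePreserving_iso).ae h

/-- A prediction does not determine v on its last line q = `top t₀`, so v is set to 0 there; a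
single line is negligible. Since X is controlled only on `J`, its indicator extension supplies
measurability. -/
lemma regular_of_isBroadSolution {P : HypSystem n} {t₀ T : ℝ} {Du Dv : Set (ℝ × ℝ)} {J : Set ℝ}
    {z₀ : HypState n} {u v : ℝ → ℝ → ℝ} {X : ℝ → Fin n → ℝ} (hb : P.IsBroadSolution t₀ Du Dv J z₀ u v X)
    (hDu : ∀ x q, (x, q) ∈ S.Adm t₀ → q ≤ T → (x, q - S.B x) ∈ Du)
    (hDv : ∀ x q, (x, q) ∈ S.Adm t₀ → q ≤ T → q ≠ S.top t₀ → (x, q - S.B x) ∈ Dv)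
    (hJ : Icc t₀ T ⊆ J) (hJm : MeasurableSet J) :
    S.Regular t₀ T (S.lineU u) (fun x q => if q = S.top t₀ then 0 else S.lineV v x q)
      (J.indicator X) := by
  classical
  obtain ⟨M₁, h1⟩ := hb.bounded_u T
  obtain ⟨M₂, h2⟩ := hb.bounded_v T
  obtain ⟨M₃, h3⟩ := isCompact_Icc.exists_bound_of_continuousOn (hb.continuous_X.mono hJ)
  have ht : ∀ {x q : ℝ}, (x, q) ∈ S.Adm t₀ → q ≤ T → q - S.B x ≤ T := fun hA hT =>
    (sub_le_self _ (S.B_nonneg hA.1)).trans hT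
  refine ⟨S.measurable_lineU hb.measurable_u, ?_, ?_, max 0 (max M₁ (max M₂ M₃)),
    fun p x hA hT => ?_, fun q x hA hT => ?_, fun t h0 hT => ?_⟩
  · exact Measurable.ite (measurable_snd (measurableSet_singleton _)) measurable_const
      (S.measurable_lineV hb.measurable_v)
  · have := hb.continuous_X.measurable_piecewise (g := 0)
      (continuous_zero.continuousOn) hJm
    rwa [Set.piecewise_eq_indicator] at this
  · have hD := hDu _ _ hA hT
    have := ht hA hT
    rw [S.add_w_sub_B] at hD this
    exact ((h1 _ _ hD this).trans (le_max_left _ _)).trans (le_max_right _ _)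
  · split_ifs with hq
    · rw [abs_zero]; exact le_max_left _ _
    · exact (((h2 _ _ (hDv _ _ hA hT hq) (ht hA hT)).trans (le_max_left _ _)).trans
        (le_max_right _ _)).trans (le_max_right _ _)
  · rw [indicator_of_mem (hJ ⟨h0, hT⟩)]
    exact (((h3 _ ⟨h0, hT⟩).trans (le_max_right _ _)).trans (le_max_right _ _)).trans
      (le_max_right _ _)

end CharSystem

lemma ae_add_right {q : ℝ → Prop} (h : ∀ᵐ s, q s) (a : ℝ) : ∀ᵐ t : ℝ, q (t + a) :=
  (measurePreserving_add_right volume a).quasiMeasurePreserving.ae h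

namespace IsNormalForm

variable {n : ℕ} {P : HypSystem n} {K : (Fin n → ℝ) → ℝ → ℝ} {S : CharSystem n}
  (hS : IsNormalForm P K S) {t₀ : ℝ} {Du Dv : Set (ℝ × ℝ)} {J : Set ℝ} {z₀ : HypState n}
  {u v : ℝ → ℝ → ℝ} {X : ℝ → Fin n → ℝ}
include hS

/-- Lines with p < t₀ start at the position A⁻¹(t₀ - p) and the others at x = 0 at time p. Both
parametrizations pull null sets back to null sets, so the two almost-everywhere conditions combine
into one over p. -/
lemma ae_u_line (ht₀ : 0 ≤ t₀) (hb : P.IsBroadSolution t₀ Du Dv J z₀ u v X) :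
    ∀ᵐ p, ∀ x, (x, p + S.w x) ∈ S.Adm t₀ → (x, p + S.A x) ∈ Du →
      u x (p + S.A x) = S.dataU t₀ z₀.1 v X p +
        ∫ ξ in S.footU t₀ p..x, S.F ξ (u ξ (p + S.A ξ), v ξ (p + S.A ξ)) := by
  filter_upwards [S.ae_comp_A_symm (ae_unitMeasure_iff.1 hb.u_initial) t₀, hb.u_boundary]
    with p h1 h2 x hA hD
  obtain ⟨hfx, hx1⟩ := S.mem_Adm_u.1 hA
  have hx : x ∈ Icc (0 : ℝ) 1 := ⟨hA.1, hx1⟩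
  rw [CharSystem.dataU]
  split_ifs with hp
  · have hf := S.footU_of_lt hp
    rw [← hf] at h1 ⊢
    have hf01 : S.footU t₀ p ∈ Icc (0 : ℝ) 1 := ⟨S.footU_nonneg _ _, hfx.trans hx1⟩
    have hchar : ∀ y ∈ Icc (0 : ℝ) 1, P.charU t₀ (S.footU t₀ p) y = p + S.A y := fun y hy => by
      rw [hS.charU_eq t₀ hf01 hy, hf, OrderIso.apply_symm_apply]; ring
    have := h1 hf01 x ⟨hfx, hx1⟩ (by rwa [hchar x hx])
    rw [hchar x hx] at this
    rw [this, hS.integral_F hf01 hx]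
    congr 1
    refine intervalIntegral.integral_congr fun ξ hξ => ?_
    simp only [hchar ξ (ordConnected_Icc.uIcc_subset hf01 hx hξ)]
  · have hp := not_lt.1 hp
    have h0 : (0 : ℝ) ∈ Icc (0 : ℝ) 1 := left_mem_Icc.2 zero_le_one
    have hchar : ∀ y ∈ Icc (0 : ℝ) 1, P.charU p 0 y = p + S.A y := fun y hy => by
      rw [hS.charU_eq p h0 hy, S.A_zero, sub_zero]
    have := h2 hp x hx (by rwa [hchar x hx])
    rw [hchar x hx] at this
    rw [this, hS.integral_F h0 hx, S.footU_of_le hp, hS.g p (ht₀.trans hp)]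
    congr 1
    refine intervalIntegral.integral_congr fun ξ hξ => ?_
    simp only [hchar ξ (ordConnected_Icc.uIcc_subset h0 hx hξ)]

lemma ae_v_line (hb : P.IsBroadSolution t₀ Du Dv J z₀ u v X) :
    ∀ᵐ q, q < S.top t₀ → ∀ x, (x, q) ∈ S.Adm t₀ → (x, q - S.B x) ∈ Dv →
      v x (q - S.B x) = z₀.2.1 (S.footV t₀ q) +
        ∫ ξ in x..S.footV t₀ q, S.G ξ (u ξ (q - S.B ξ), v ξ (q - S.B ξ)) := by
  filter_upwards [S.ae_comp_B_symm (ae_unitMeasure_iff.1 hb.v_initial) t₀] with q h1 hq x hA hD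
  obtain ⟨hx0, hx1, hfx⟩ := S.mem_Adm_v.1 hA
  have hx : x ∈ Icc (0 : ℝ) 1 := ⟨hx0, hx1⟩
  change S.footV t₀ q ∈ _ → _ at h1
  have hf01 : S.footV t₀ q ∈ Icc (0 : ℝ) 1 := ⟨hx0.trans hfx, (S.footV_lt_one hq).le⟩
  have hchar : ∀ y ∈ Icc (0 : ℝ) 1, P.charV t₀ (S.footV t₀ q) y = q - S.B y := fun y hy => by
    rw [hS.charV_eq t₀ hf01 hy, CharSystem.footV, OrderIso.apply_symm_apply]; ring
  have := h1 hf01 x ⟨hx0, hfx⟩ (by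
    change (x, P.charV t₀ (S.footV t₀ q) x) ∈ Dv
    rwa [hchar x hx])
  change v x (P.charV t₀ (S.footV t₀ q) x) = z₀.2.1 (S.footV t₀ q) + ∫ ξ in x..S.footV t₀ q,
    P.fV ξ (u ξ (P.charV t₀ (S.footV t₀ q) ξ), v ξ (P.charV t₀ (S.footV t₀ q) ξ)) / P.lamV ξ at this
  rw [hchar x hx] at this
  rw [this, hS.integral_G hx hf01]
  congr 1
  refine intervalIntegral.integral_congr fun ξ hξ => ?_
  simp only [hchar ξ (ordConnected_Icc.uIcc_subset hx hf01 hξ)]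

/-- A broad solution, with the feedback law as boundary value on the upper `v`-characteristics, is
a solution of the integrated equations on almost every characteristic. -/
lemma exists_isLineSolution_of_isBroadSolution {T : ℝ} (ht₀ : 0 ≤ t₀)
    (hb : P.IsBroadSolution t₀ Du Dv J z₀ u v X)
    (hDu : ∀ x q, (x, q) ∈ S.Adm t₀ → q ≤ T → (x, q - S.B x) ∈ Du)
    (hDv : ∀ x q, (x, q) ∈ S.Adm t₀ → q ≤ T → q ≠ S.top t₀ → (x, q - S.B x) ∈ Dv)
    (hJ : Icc t₀ T ⊆ J) (hJm : MeasurableSet J)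
    (hup : ∀ᵐ q, S.top t₀ < q → q ≤ T → ∀ x ∈ Icc (0 : ℝ) 1,
      v x (q - S.B x) = K (X q) q - ∫ ξ in (0 : ℝ)..x, S.G ξ (u ξ (q - S.B ξ), v ξ (q - S.B ξ)))
    {U₀ V₀ : ℝ → ℝ} (hU : z₀.1 =ᵐ[unitMeasure] U₀) (hV : z₀.2.1 =ᵐ[unitMeasure] V₀) :
    ∃ Gu Gv, CharSystem.GoodLines T Gu Gv ∧ S.IsLineSolution t₀ U₀ V₀ z₀.2.2 T Gu Gv (S.lineU u)
      (fun x q => if q = S.top t₀ then 0 else S.lineV v x q) (J.indicator X) := by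
  have hreg := S.regular_of_isBroadSolution hb hDu hDv hJ hJm
  set v' : ℝ → ℝ → ℝ := fun x q => if q = S.top t₀ then 0 else S.lineV v x q with hv'
  have hne : ∀ᵐ q : ℝ, q ≠ S.top t₀ := by simp [ae_iff, measure_singleton]
  have hv'eq : ∀ {q}, q ≠ S.top t₀ → ∀ x, v' x q = v x (q - S.B x) := fun hq x => if_neg hq
  have hXJ : ∀ {s}, t₀ ≤ s → s ≤ T → J.indicator X s = X s := fun h1 h2 =>
    indicator_of_mem (hJ ⟨h1, h2⟩) _
  set Gv : Set ℝ := {q | q ≠ S.top t₀ ∧ ∀ x, (x, q) ∈ S.Adm t₀ → q ≤ T →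
    v' x q = S.rhsV t₀ V₀ (S.lineU u) v' (J.indicator X) x q} with hGv
  -- Membership in `Gv` is built in to obtain the field `sub` of `GoodLines`. It also excludes p =
  -- `top t₀`, where the modified v would give a wrong boundary value for u.
  set Gu : Set ℝ := {p | (∀ x, (x, p + S.w x) ∈ S.Adm t₀ → p + S.w x ≤ T →
    S.lineU u x p = S.rhsU t₀ U₀ (S.lineU u) v' (J.indicator X) x p) ∧ (p ≤ T → p ∈ Gv)} with hGu
  have haeV : ∀ᵐ q, q ∈ Gv := by
    filter_upwards [hne, hS.ae_v_line hb, hup, S.ae_comp_B_symm (ae_unitMeasure_iff.1 hV) t₀]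
      with q hq h1 h2 h3
    refine ⟨hq, fun x hA hT => ?_⟩
    obtain ⟨hx0, hx1, hxf⟩ := S.mem_Adm_v.1 hA
    have hint : ∀ a b : ℝ, ∫ ξ in a..b, S.G ξ (S.lineU u ξ (q - S.w ξ), v' ξ q) =
        ∫ ξ in a..b, S.G ξ (u ξ (q - S.B ξ), v ξ (q - S.B ξ)) := fun a b =>
      intervalIntegral.integral_congr fun ξ _ => by simp only [hv'eq hq, S.lineU_sub_w]
    rw [CharSystem.rhsV, hv'eq hq, hint, hint]
    split_ifs with hqt
    · rw [h1 hqt x hA (hDv _ _ hA hT hq)]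
      congr 1
      exact h3 ⟨hx0.trans hxf, (S.footV_lt_one hqt).le⟩
    · have ht₀q := S.le_of_mem_Adm hA
      rw [h2 (lt_of_le_of_ne (not_lt.1 hqt) (Ne.symm hq)) hT x ⟨hx0, hx1⟩,
        hXJ ht₀q hT, hS.k _ (ht₀.trans ht₀q)]
  have haeU : ∀ᵐ p, p ∈ Gu := by
    filter_upwards [haeV, hS.ae_u_line ht₀ hb, S.ae_comp_A_symm (ae_unitMeasure_iff.1 hU) t₀]
      with p hp h1 h2
    refine ⟨fun x hA hT => ?_, fun _ => hp⟩
    obtain ⟨hfx, hx1⟩ := S.mem_Adm_u.1 hA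
    have hD := hDu _ _ hA hT
    rw [S.add_w_sub_B] at hD
    rw [CharSystem.lineU, h1 x hA hD, CharSystem.rhsU]
    congr 1
    · unfold CharSystem.dataU
      split_ifs with hpt
      · refine h2 ?_
        rw [← S.footU_of_lt hpt]
        exact ⟨S.footU_nonneg _ _, hfx.trans hx1⟩
      · rw [hXJ (not_lt.1 hpt) (le_trans (by linarith [S.w_nonneg hA.1]) hT), hv'eq hp.1,
          S.B_zero, sub_zero]
    · refine intervalIntegral.integral_congr_ae ?_
      filter_upwards [S.ae_add_w hne p] with ξ hξ _
      rw [hv'eq hξ, S.add_w_sub_B, CharSystem.lineU]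
  refine ⟨Gu, Gv, ⟨haeU, haeV.mono fun q h _ => h, fun p hp => hp.2⟩, hreg,
    fun p hp => hp.1, fun q hq => hq.2, fun t h0 hT => ?_⟩
  rw [hXJ h0 hT, hb.ode t (hJ ⟨h0, hT⟩), CharSystem.rhsX]
  congr 1
  refine intervalIntegral.integral_congr_ae ?_
  filter_upwards [hne] with s hs hst
  rw [uIoc_of_le h0] at hst
  rw [hXJ hst.1.le (hst.2.trans hT), hv'eq hs, S.B_zero, sub_zero, hS.f _ (ht₀.trans hst.1.le)]

end IsNormalForm

/-! ### Bounded representatives and a scalar uniqueness lemma -/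

/-- The fixed point is constructed on every line, so it needs data that are measurable and bounded
everywhere; truncating a measurable representative at ±C changes nothing almost everywhere. -/
lemma exists_bounded_representative {φ : ℝ → ℝ} {C : ℝ} (hφ : AEStronglyMeasurable φ unitMeasure)
    (hC₀ : 0 ≤ C) (hC : ∀ᵐ a ∂unitMeasure, |φ a| ≤ C) :
    ∃ φ' : ℝ → ℝ, Measurable φ' ∧ (∀ a, |φ' a| ≤ C) ∧ φ =ᵐ[unitMeasure] φ' := by
  refine ⟨fun a => max (-C) (min C (hφ.mk φ a)), ?_, fun a => ?_, ?_⟩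
  · exact measurable_const.max (measurable_const.min hφ.stronglyMeasurable_mk.measurable)
  · rw [abs_le]
    exact ⟨le_max_left _ _, max_le (by linarith) (min_le_left _ _)⟩
  · filter_upwards [hφ.ae_eq_mk, hC] with a h1 h2
    rw [← h1, min_eq_right (abs_le.1 h2).2, max_eq_right (abs_le.1 h2).1]

lemma ae_abs_le_of_eLpNorm_le {φ : ℝ → ℝ} {C : ℝ} (hC : 0 ≤ C)
    (h : eLpNorm φ ⊤ unitMeasure ≤ ENNReal.ofReal C) : ∀ᵐ a ∂unitMeasure, |φ a| ≤ C := by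
  rw [eLpNorm_exponent_top] at h
  filter_upwards [enorm_ae_le_eLpNormEssSup φ unitMeasure] with a ha
  have := ha.trans h
  rwa [← ofReal_norm, ENNReal.ofReal_le_ofReal_iff hC] at this

lemma exists_ae_abs_le_of_memLp {φ : ℝ → ℝ} (h : MemLp φ ⊤ unitMeasure) :
    ∃ C, 0 ≤ C ∧ ∀ᵐ a ∂unitMeasure, |φ a| ≤ C :=
  ⟨_, ENNReal.toReal_nonneg, ae_abs_le_of_eLpNorm_le ENNReal.toReal_nonneg
    (ENNReal.ofReal_toReal h.2.ne).ge⟩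

/-- Uniqueness for scalar Carathéodory equations on `[0,1]`. -/
lemma eqOn_of_integral_eq {H : ℝ → ℝ → ℝ} {C c : ℝ} {y₁ y₂ : ℝ → ℝ} (hC : 0 ≤ C)
    (hH : ∀ ξ a b, |H ξ a - H ξ b| ≤ C * |a - b|)
    (hb : ∃ M, ∀ x ∈ Icc (0 : ℝ) 1, |y₁ x - y₂ x| ≤ M)
    (hi₁ : IntervalIntegrable (fun ξ => H ξ (y₁ ξ)) volume 0 1)
    (hi₂ : IntervalIntegrable (fun ξ => H ξ (y₂ ξ)) volume 0 1)
    (h₁ : ∀ x ∈ Icc (0 : ℝ) 1, y₁ x = c + ∫ ξ in (0 : ℝ)..x, H ξ (y₁ ξ))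
    (h₂ : ∀ x ∈ Icc (0 : ℝ) 1, y₂ x = c + ∫ ξ in (0 : ℝ)..x, H ξ (y₂ ξ)) : EqOn y₁ y₂ (Icc 0 1) := by
  -- The rate gives C/b ≤ 1/2; the summand 1 keeps it positive when C = 0.
  set b : ℝ := 2 * C + 1 with hb'
  have hb0 : 0 < b := by linarith
  obtain ⟨M, hM, hB⟩ := exists_seq_bounds_tendsto (δ := 0)
      (B := fun M => ∀ x ∈ Icc (0 : ℝ) 1, |y₁ x - y₂ x| ≤ M * Real.exp (b * (0 + x))) le_rfl (by
    obtain ⟨M, hM⟩ := hb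
    have hM0 : 0 ≤ M := (abs_nonneg _).trans (hM 0 (left_mem_Icc.2 zero_le_one))
    refine ⟨M, hM0, fun x hx => (hM x hx).trans (le_mul_of_one_le_right hM0 (Real.one_le_exp ?_))⟩
    rw [zero_add]
    exact mul_nonneg hb0.le hx.1) <| by
    intro M hM hB x hx
    have hsub : uIcc 0 x ⊆ uIcc (0 : ℝ) 1 := by
      rw [uIcc_of_le hx.1, uIcc_of_le zero_le_one]
      exact Icc_subset_Icc_right hx.2
    have hint : IntervalIntegrable (fun ξ => (C * M) * Real.exp (b * (0 + ξ))) volume 0 x :=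
      Continuous.intervalIntegrable (by fun_prop) _ _
    have key := norm_integral_sub_le hx.1 (hi₁.mono_set hsub) (hi₂.mono_set hsub) hint
      (Eventually.of_forall fun ξ hξ => (hH ξ _ _).trans
        ((mul_le_mul_of_nonneg_left (hB ξ ⟨hξ.1.le, hξ.2.trans hx.2⟩) hC).trans_eq (by ring)))
    rw [h₁ x hx, h₂ x hx, add_sub_add_left_eq_sub]
    refine key.trans ?_
    rw [intervalIntegral.integral_const_mul]
    refine (mul_le_mul_of_nonneg_left (integral_exp_add_le hx.1 hb0 0) (by positivity)).trans ?_
    have : C / b ≤ 1 / 2 := by rw [div_le_div_iff₀ hb0 two_pos]; linarith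
    calc C * M * (Real.exp (b * (0 + x)) / b) = C / b * (M * Real.exp (b * (0 + x))) := by ring
      _ ≤ 1 / 2 * (M * Real.exp (b * (0 + x))) := by gcongr
      _ = _ := by ring
  intro x hx
  have := ge_of_tendsto' (hM.mul_const (Real.exp (b * (0 + x)))) fun k => hB k x hx
  rw [mul_zero, zero_mul] at this
  exact sub_eq_zero.1 (abs_nonpos_iff.1 this)

lemma CharSystem.lip_v_line {n : ℕ} (S : CharSystem n) (u : ℝ → ℝ → ℝ) (q ξ a b : ℝ) :
    |S.G ξ (u ξ (q - S.B ξ), a) - S.G ξ (u ξ (q - S.B ξ), b)| ≤ S.L * S.l * |a - b| := by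
  refine (S.lip_G _ _ _).trans ?_
  have h1 : ‖(u ξ (q - S.B ξ), a) - (u ξ (q - S.B ξ), b)‖ ≤ |a - b| :=
    norm_prod_sub_le (by simp) le_rfl
  have := S.L_pos
  have := S.densV.le ξ
  have := S.l_pos
  gcongr

/-! ### Predictions and the output of the algorithm -/

namespace HypSystem

variable {n : ℕ} {P : HypSystem n}

lemma IsBroadSolution.congr_state {t₀ : ℝ} {Du Dv : Set (ℝ × ℝ)} {J : Set ℝ} {z z' : HypState n}
    {u v : ℝ → ℝ → ℝ} {X : ℝ → Fin n → ℝ} (h : P.IsBroadSolution t₀ Du Dv J z u v X)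
    (hu : z.1 =ᵐ[unitMeasure] z'.1) (hv : z.2.1 =ᵐ[unitMeasure] z'.2.1) (hX : z.2.2 = z'.2.2) :
    P.IsBroadSolution t₀ Du Dv J z' u v X where
  measurable_u := h.measurable_u
  measurable_v := h.measurable_v
  bounded_u := h.bounded_u
  bounded_v := h.bounded_v
  u_initial := by filter_upwards [h.u_initial, hu] with a h1 h2; rwa [← h2]
  u_boundary := h.u_boundary
  v_initial := by filter_upwards [h.v_initial, hv] with a h1 h2; rwa [← h2]
  continuous_X := h.continuous_X
  ode := by rw [← hX]; exact h.ode

lemma IsAlgorithmOutput.congr_state {K : (Fin n → ℝ) → ℝ → ℝ} {t U : ℝ} {z z' : HypState n}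
    (h : P.IsAlgorithmOutput K t z U)
    (hu : z.1 =ᵐ[unitMeasure] z'.1) (hv : z.2.1 =ᵐ[unitMeasure] z'.2.1) (hX : z.2.2 = z'.2.2) :
    P.IsAlgorithmOutput K t z' U := by
  obtain ⟨ub, vb, Xb, vs, h1, h2⟩ := h
  exact ⟨ub, vb, Xb, vs, h1.congr_state hu hv hX, h2⟩

/-- A broad solution on the determinate set of `t`, started from `z` at time `t`. -/
def IsPrediction (P : HypSystem n) (t : ℝ) (z : HypState n) (u v : ℝ → ℝ → ℝ) (X : ℝ → Fin n → ℝ) :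
    Prop :=
  P.IsBroadSolution t (P.detSet t) (P.detSet' t) (Icc t (P.tauV t 0)) z u v X

end HypSystem

namespace IsNormalForm

variable {n : ℕ} {P : HypSystem n} {K : (Fin n → ℝ) → ℝ → ℝ} {S : CharSystem n}
  (hS : IsNormalForm P K S)
include hS

lemma mem_detSet_of_mem_Adm {t x q : ℝ} (hA : (x, q) ∈ S.Adm t) (hq : q ≤ S.top t) :
    (x, q - S.B x) ∈ P.detSet t :=
  hS.mem_detSet.2 ⟨⟨hA.1, hA.2.1⟩, hA.2.2, by simpa using hq⟩

lemma mem_detSet'_of_mem_Adm {t x q : ℝ} (hA : (x, q) ∈ S.Adm t) (hq : q < S.top t) :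
    (x, q - S.B x) ∈ P.detSet' t :=
  hS.mem_detSet'.2 ⟨⟨hA.1, hA.2.1⟩, hA.2.2, by simpa using hq⟩

/-- With horizon T = `top t` there are no lines with `top t` < q ≤ T, so the condition involving the
feedback law is vacuous: predictions fall under the general theory without reference to `K`. -/
lemma exists_isLineSolution_of_isPrediction {t : ℝ} (ht : 0 ≤ t) {z : HypState n}
    {u v : ℝ → ℝ → ℝ} {X : ℝ → Fin n → ℝ} (hb : P.IsPrediction t z u v X) {U₀ V₀ : ℝ → ℝ}
    (hU : z.1 =ᵐ[unitMeasure] U₀) (hV : z.2.1 =ᵐ[unitMeasure] V₀) :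
    ∃ Gu Gv, CharSystem.GoodLines (S.top t) Gu Gv ∧
      S.IsLineSolution t U₀ V₀ z.2.2 (S.top t) Gu Gv (S.lineU u)
      (fun x q => if q = S.top t then 0 else S.lineV v x q) ((Icc t (S.top t)).indicator X) := by
  unfold HypSystem.IsPrediction at hb
  rw [hS.tauV_zero] at hb
  exact hS.exists_isLineSolution_of_isBroadSolution ht hb
    (fun x q hA hq => hS.mem_detSet_of_mem_Adm hA hq)
    (fun x q hA hq hne => hS.mem_detSet'_of_mem_Adm hA (lt_of_le_of_ne hq hne)) subset_rfl
    measurableSet_Icc (Eventually.of_forall fun q h1 h2 => absurd h1 (not_lt.2 h2)) hU hV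

/-- Uniqueness of the prediction. -/
lemma isPrediction_unique {t : ℝ} (ht : 0 ≤ t) {z z' : HypState n} {u v u' v' : ℝ → ℝ → ℝ}
    {X X' : ℝ → Fin n → ℝ} (hb : P.IsPrediction t z u v X) (hb' : P.IsPrediction t z' u' v' X')
    (hU : z'.1 =ᵐ[unitMeasure] z.1) (hV : z'.2.1 =ᵐ[unitMeasure] z.2.1) (hX : z'.2.2 = z.2.2) :
    (∀ᵐ p, ∀ x, (x, p + S.w x) ∈ S.Adm t → p + S.w x ≤ S.top t →
      u x (p + S.A x) = u' x (p + S.A x)) ∧ ∀ s ∈ Icc t (S.top t), X s = X' s := by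
  obtain ⟨Gu, Gv, hG, hl⟩ := hS.exists_isLineSolution_of_isPrediction ht hb
    (EventuallyEq.refl _ _) (EventuallyEq.refl _ _)
  obtain ⟨Gu', Gv', hG', hl'⟩ := hS.exists_isLineSolution_of_isPrediction ht hb' hU hV
  have key := (hl.mono inter_subset_left inter_subset_left).closeOn (δ := 0) ht
    (hG.inter hG') (hl'.mono inter_subset_right inter_subset_right) le_rfl (by simp) (by simp)
    (by simp [hX])
  refine ⟨?_, fun s hs => ?_⟩
  · filter_upwards [hG.ae_u, hG'.ae_u] with p h1 h2 x hA hq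
    have := key.u p ⟨h1, h2⟩ x hA hq
    rw [mul_zero, zero_mul] at this
    exact sub_eq_zero.1 (abs_nonpos_iff.1 this)
  · have := key.X s hs.1 hs.2
    rw [mul_zero, zero_mul, indicator_of_mem hs, indicator_of_mem hs] at this
    exact sub_eq_zero.1 (norm_le_zero_iff.1 this)

/-- The algorithm can be evaluated with any prediction. -/
lemma isAlgorithmOutput_iff {t : ℝ} (ht : 0 ≤ t) {z : HypState n} {u v : ℝ → ℝ → ℝ}
    {X : ℝ → Fin n → ℝ} (hb : P.IsPrediction t z u v X) {U : ℝ} :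
    P.IsAlgorithmOutput K t z U ↔ ∃ vs : ℝ → ℝ, ContinuousOn vs (Icc 0 1) ∧
      (∀ x ∈ Icc (0 : ℝ) 1, vs x = K (X (S.top t)) (S.top t) -
        ∫ ξ in (0 : ℝ)..x, S.G ξ (u ξ (S.top t - S.B ξ), vs ξ)) ∧ U = vs 1 := by
  have h01 : (0 : ℝ) ∈ Icc (0 : ℝ) 1 := left_mem_Icc.2 zero_le_one
  have conv : ∀ (u : ℝ → ℝ → ℝ) (vs : ℝ → ℝ) x, x ∈ Icc (0 : ℝ) 1 →
      ∫ ξ in (0 : ℝ)..x, P.fV ξ (u ξ (P.tauV t ξ), vs ξ) / P.lamV ξ =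
        ∫ ξ in (0 : ℝ)..x, S.G ξ (u ξ (S.top t - S.B ξ), vs ξ) := by
    intro u vs x hx
    rw [hS.integral_G h01 hx]
    refine intervalIntegral.integral_congr fun ξ hξ => ?_
    simp only [hS.tauV_eq t (ordConnected_Icc.uIcc_subset h01 hx hξ)]
  constructor
  · rintro ⟨ub, vb, Xb, vs, hb', hc, heq, hU⟩
    obtain ⟨h1, h2⟩ := hS.isPrediction_unique ht hb hb' (EventuallyEq.refl _ _)
      (EventuallyEq.refl _ _) rfl
    refine ⟨vs, hc, fun x hx => ?_, hU⟩
    rw [heq x hx, conv ub vs x hx, hS.tauV_zero, h2 _ ⟨S.le_top, le_rfl⟩]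
    congr 1
    refine intervalIntegral.integral_congr_ae ?_
    -- Two predictions of u agree only on almost every u-line. The line q = `top t` crosses these
    -- transversally, so they agree at almost every ξ along it, which suffices under the integral.
    filter_upwards [S.ae_sub_w h1 (S.top t)] with ξ hξ hξx
    rw [uIoc_of_le hx.1] at hξx
    have := hξ ξ (by
      rw [CharSystem.sub_w_add_w]
      exact S.mem_Adm_upper hξx.1.le (hξx.2.trans hx.2) le_rfl) (by rw [CharSystem.sub_w_add_w])
    rw [show S.top t - S.w ξ + S.A ξ = S.top t - S.B ξ by unfold CharSystem.w; ring] at this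
    rw [this]
  · rintro ⟨vs, hc, heq, hU⟩
    refine ⟨u, v, X, vs, hb, hc, fun x hx => ?_, hU⟩
    rw [conv u vs x hx, hS.tauV_zero]
    exact heq x hx

lemma integrable_last_line {t : ℝ} {z : HypState n} {u v : ℝ → ℝ → ℝ}
    {X : ℝ → Fin n → ℝ} (hb : P.IsPrediction t z u v X) {vs : ℝ → ℝ}
    (hc : ContinuousOn vs (Icc 0 1)) :
    IntervalIntegrable (fun ξ => S.G ξ (u ξ (S.top t - S.B ξ), vs ξ)) volume 0 1 := by
  obtain ⟨M₁, h1⟩ := hb.bounded_u (S.top t)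
  obtain ⟨M₂, h2⟩ := isCompact_Icc.exists_bound_of_continuousOn hc
  have hm := hc.measurable_piecewise (g := 0) continuous_zero.continuousOn measurableSet_Icc
  have := S.intervalIntegrable_G zero_le_one (φ := fun ξ => u ξ (S.top t - S.B ξ))
    (hb.measurable_u.comp (measurable_id.prodMk (measurable_const.sub S.measurable_B))) hm
    ⟨max M₁ M₂, fun ξ hξ => ⟨?_, ?_⟩⟩
  · refine this.congr fun ξ hξ => ?_
    rw [uIoc_of_le zero_le_one] at hξ
    simp only [piecewise_eq_of_mem (Icc (0 : ℝ) 1) _ _ ⟨hξ.1.le, hξ.2⟩]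
  · refine (h1 _ _ (hS.mem_detSet_of_mem_Adm (S.mem_Adm_upper hξ.1.le hξ.2.le le_rfl) le_rfl)
      ?_).trans (le_max_left _ _)
    exact sub_le_self _ (S.B_nonneg hξ.1.le)
  · rw [piecewise_eq_of_mem (Icc (0 : ℝ) 1) _ _ ⟨hξ.1.le, hξ.2.le⟩]
    exact (h2 _ ⟨hξ.1.le, hξ.2.le⟩).trans (le_max_right _ _)

/-- Both outputs can be computed from one common prediction; what remains is the scalar target
equation, Lipschitz with constant L l. -/
lemma isAlgorithmOutput_unique {t : ℝ} (ht : 0 ≤ t) {z : HypState n} {U U' : ℝ}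
    (h : P.IsAlgorithmOutput K t z U) (h' : P.IsAlgorithmOutput K t z U') : U = U' := by
  obtain ⟨u, v, X, -, hb, -⟩ := id h
  obtain ⟨vs, hc, heq, hU⟩ := (hS.isAlgorithmOutput_iff ht hb).1 h
  obtain ⟨vs', hc', heq', hU'⟩ := (hS.isAlgorithmOutput_iff ht hb).1 h'
  rw [hU, hU']
  obtain ⟨M, hM⟩ := isCompact_Icc.exists_bound_of_continuousOn (hc.sub hc')
  refine eqOn_of_integral_eq (H := fun ξ a => -S.G ξ (u ξ (S.top t - S.B ξ), a))
    (C := S.L * S.l) (mul_nonneg S.L_pos.le S.l_pos.le) (fun ξ a b => ?_) ⟨M, hM⟩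
    (hS.integrable_last_line hb hc).neg (hS.integrable_last_line hb hc').neg
    (c := K (X (S.top t)) (S.top t)) (fun x hx => ?_) (fun x hx => ?_) (right_mem_Icc.2 zero_le_one)
  · rw [← abs_neg, neg_sub_neg, neg_sub]
    exact S.lip_v_line u _ ξ a b
  · rw [intervalIntegral.integral_neg, ← sub_eq_add_neg]; exact heq x hx
  · rw [intervalIntegral.integral_neg, ← sub_eq_add_neg]; exact heq' x hx

end IsNormalForm

/-! ### Restarting solutions, and solving the closed loop -/

namespace IsNormalForm

variable {n : ℕ} {P : HypSystem n} {K : (Fin n → ℝ) → ℝ → ℝ} {S : CharSystem n}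
  (hS : IsNormalForm P K S)

lemma mem_strip_of_mem_Adm {t₀ x q : ℝ} (hA : (x, q) ∈ S.Adm t₀) :
    (x, q - S.B x) ∈ HypSystem.strip t₀ :=
  ⟨⟨hA.1, hA.2.1⟩, hA.2.2⟩

lemma integrable_u_line {t₀ : ℝ} {J : Set ℝ} {z₀ : HypState n} {u v : ℝ → ℝ → ℝ}
    {X : ℝ → Fin n → ℝ}
    (hb : P.IsBroadSolution t₀ (HypSystem.strip t₀) (HypSystem.strip t₀) J z₀ u v X) {p x y : ℝ}
    (hx : S.footU t₀ p ≤ x) (hxy : x ≤ y) (hy : y ≤ 1) :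
    IntervalIntegrable (fun ξ => S.F ξ (u ξ (p + S.A ξ), v ξ (p + S.A ξ))) volume x y := by
  obtain ⟨M₁, h1⟩ := hb.bounded_u (p + S.A y)
  obtain ⟨M₂, h2⟩ := hb.bounded_v (p + S.A y)
  have hm : Measurable fun ξ => p + S.A ξ := measurable_const.add S.measurable_A
  refine S.intervalIntegrable_F hxy (hb.measurable_u.comp (measurable_id.prodMk hm))
    (hb.measurable_v.comp (measurable_id.prodMk hm)) ⟨max M₁ M₂, fun ξ hξ => ?_⟩
  have hs := mem_strip_of_mem_Adm (S.mem_Adm_u.2 ⟨hx.trans hξ.1.le, hξ.2.le.trans hy⟩)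
  rw [S.add_w_sub_B] at hs
  have hle : p + S.A ξ ≤ p + S.A y := add_le_add_right (S.A.monotone hξ.2.le) p
  exact ⟨(h1 _ _ hs hle).trans (le_max_left _ _), (h2 _ _ hs hle).trans (le_max_right _ _)⟩

lemma integrable_v_line {t₀ : ℝ} {J : Set ℝ} {z₀ : HypState n} {u v : ℝ → ℝ → ℝ}
    {X : ℝ → Fin n → ℝ}
    (hb : P.IsBroadSolution t₀ (HypSystem.strip t₀) (HypSystem.strip t₀) J z₀ u v X) {q x y : ℝ}
    (hx : 0 ≤ x) (hxy : x ≤ y) (hy : (y, q) ∈ S.Adm t₀) :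
    IntervalIntegrable (fun ξ => S.G ξ (u ξ (q - S.B ξ), v ξ (q - S.B ξ))) volume x y := by
  obtain ⟨M₁, h1⟩ := hb.bounded_u q
  obtain ⟨M₂, h2⟩ := hb.bounded_v q
  have hm : Measurable fun ξ => q - S.B ξ := measurable_const.sub S.measurable_B
  refine S.intervalIntegrable_G hxy (hb.measurable_u.comp (measurable_id.prodMk hm))
    (hb.measurable_v.comp (measurable_id.prodMk hm)) ⟨max M₁ M₂, fun ξ hξ => ?_⟩
  rw [S.mem_Adm_v] at hy
  have hξ0 := hx.trans hξ.1.le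
  have hs := mem_strip_of_mem_Adm
    (S.mem_Adm_v.2 ⟨hξ0, hξ.2.le.trans hy.2.1, hξ.2.le.trans hy.2.2⟩)
  have hle : q - S.B ξ ≤ q := sub_le_self _ (S.B_nonneg hξ0)
  exact ⟨(h1 _ _ hs hle).trans (le_max_left _ _), (h2 _ _ hs hle).trans (le_max_right _ _)⟩

include hS

lemma integrable_f0 {t₀ : ℝ} (ht₀ : 0 ≤ t₀) {z₀ : HypState n} {u v : ℝ → ℝ → ℝ}
    {X : ℝ → Fin n → ℝ}
    (hb : P.IsBroadSolution t₀ (HypSystem.strip t₀) (HypSystem.strip t₀) (Ici t₀) z₀ u v X)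
    {s t : ℝ} (hs : t₀ ≤ s) (hst : s ≤ t) :
    IntervalIntegrable (fun s => P.f0 (X s) (v 0 s) s) volume s t := by
  have hreg := S.regular_of_isBroadSolution hb (T := t)
    (fun x q hA _ => mem_strip_of_mem_Adm hA) (fun x q hA _ _ => mem_strip_of_mem_Adm hA)
    Icc_subset_Ici_self measurableSet_Ici
  refine (hreg.integrable_f hs hst le_rfl).congr_ae ?_
  have hne : ∀ᵐ q : ℝ, q ≠ S.top t₀ := by simp [ae_iff, measure_singleton]
  refine (ae_restrict_iff' measurableSet_uIoc).2 ?_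
  filter_upwards [hne] with r hr hrt
  rw [uIoc_of_le hst] at hrt
  have h0 := hs.trans hrt.1.le
  simp only [if_neg hr, S.lineV_zero]
  rw [indicator_of_mem (mem_Ici.2 h0), hS.f r (ht₀.trans h0)]

/-- A solution on the strip, restarted from its state at a later time, is the prediction. -/
lemma isPrediction_restart {t₀ t : ℝ} (ht₀ : 0 ≤ t₀) (ht : t₀ ≤ t) {z₀ : HypState n}
    {u v : ℝ → ℝ → ℝ} {X : ℝ → Fin n → ℝ}
    (hb : P.IsBroadSolution t₀ (HypSystem.strip t₀) (HypSystem.strip t₀) (Ici t₀) z₀ u v X)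
    (hup : ∀ᵐ q, S.top t₀ ≤ q → ∃ c, ∀ x ∈ Icc (0 : ℝ) 1, v x (q - S.B x) =
      c + ∫ ξ in x..1, S.G ξ (u ξ (q - S.B ξ), v ξ (q - S.B ξ))) :
    P.IsPrediction t (fun x => u x t, fun x => v x t, X t) u v X := by
  have h01 : (1 : ℝ) ∈ Icc (0 : ℝ) 1 := right_mem_Icc.2 zero_le_one
  have hsub : ∀ {x s}, (x, s) ∈ P.detSet t → (x, s) ∈ HypSystem.strip t₀ := fun h =>
    ⟨h.1, ht.trans h.2.1⟩
  have hsub' : ∀ {x s}, (x, s) ∈ P.detSet' t → (x, s) ∈ HypSystem.strip t₀ := fun h =>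
    ⟨h.1, ht.trans h.2.1⟩
  refine ⟨hb.measurable_u, hb.measurable_v, fun T => ?_, fun T => ?_, ?_, ?_, ?_,
    hb.continuous_X.mono fun s hs => ht.trans hs.1, fun s hs => ?_⟩
  · obtain ⟨M, hM⟩ := hb.bounded_u T
    exact ⟨M, fun x s hD => hM x s (hsub hD)⟩
  · obtain ⟨M, hM⟩ := hb.bounded_v T
    exact ⟨M, fun x s hD => hM x s (hsub' hD)⟩
  · rw [ae_unitMeasure_iff]
    -- For almost every a, the u-line through (a,t) is good. Its integrated equation at x and at a,
    -- subtracted, is the equation restarted at time t.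
    filter_upwards [S.ae_sub_A (hS.ae_u_line ht₀ hb) t] with a hp ha x hx _
    have hx01 : x ∈ Icc (0 : ℝ) 1 := ⟨ha.1.trans hx.1, hx.2⟩
    have hcoord : ∀ ξ, P.charU t a ξ = t - S.A a + S.A ξ ∨ ξ ∉ Icc (0 : ℝ) 1 := fun ξ => by
      by_cases hξ : ξ ∈ Icc (0 : ℝ) 1
      · exact Or.inl (hS.charU_eq t ha hξ)
      · exact Or.inr hξ
    have hfa : S.footU t₀ (t - S.A a) ≤ a := S.footU_le_iff.2 ⟨ha.1, by simpa using ht⟩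
    have hA1 : (a, t - S.A a + S.w a) ∈ S.Adm t₀ := S.mem_Adm_u.2 ⟨hfa, ha.2⟩
    have hA2 : (x, t - S.A a + S.w x) ∈ S.Adm t₀ := S.mem_Adm_u.2 ⟨hfa.trans hx.1, hx.2⟩
    have hs1 := mem_strip_of_mem_Adm hA1
    have hs2 := mem_strip_of_mem_Adm hA2
    rw [S.add_w_sub_B] at hs1 hs2
    have e1 := hp a hA1 hs1
    have e2 := hp x hA2 hs2
    have hi := intervalIntegral.integral_add_adjacent_intervals
      (integrable_u_line hb le_rfl hfa ha.2) (integrable_u_line hb hfa hx.1 hx.2)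
    rw [sub_add_cancel] at e1
    rw [hS.charU_eq t ha hx01, e2, ← hi, ← add_assoc, ← e1, hS.integral_F ha hx01]
    congr 1
    refine intervalIntegral.integral_congr fun ξ hξ => ?_
    simp only [hS.charU_eq t ha (ordConnected_Icc.uIcc_subset ha hx01 hξ)]
  · filter_upwards [hb.u_boundary] with s hs hts x hx hD
    exact hs (ht.trans hts) x hx (hsub hD)
  · rw [ae_unitMeasure_iff]
    filter_upwards [S.ae_add_B (hS.ae_v_line hb) t, S.ae_add_B hup t] with a h1 h2 ha x hx _
    have hx01 : x ∈ Icc (0 : ℝ) 1 := ⟨hx.1, hx.2.trans ha.2⟩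
    have hA1 : (a, t + S.B a) ∈ S.Adm t₀ := ⟨ha.1, ha.2, by simpa using ht⟩
    have hA2 : (x, t + S.B a) ∈ S.Adm t₀ := by
      rw [S.mem_Adm_v] at hA1 ⊢
      exact ⟨hx.1, hx01.2, hx.2.trans hA1.2.2⟩
    have key : v x (t + S.B a - S.B x) = v a t +
        ∫ ξ in x..a, S.G ξ (u ξ (t + S.B a - S.B ξ), v ξ (t + S.B a - S.B ξ)) := by
      by_cases hq : t + S.B a < S.top t₀
      · have e1 := h1 hq a hA1 (mem_strip_of_mem_Adm hA1)
        have e2 := h1 hq x hA2 (mem_strip_of_mem_Adm hA2)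
        have hfa := (S.mem_Adm_v.1 hA1).2.2
        have hi := intervalIntegral.integral_add_adjacent_intervals
          (integrable_v_line hb hx.1 hx.2 hA1) (integrable_v_line hb ha.1 hfa
            (S.mem_Adm_v.2 ⟨ha.1.trans hfa, (S.footV_lt_one hq).le, le_rfl⟩))
        rw [add_sub_cancel_right] at e1
        rw [e2, ← hi, e1]
        ring
      -- This line entered at x = 1 no earlier than t₀; its entry value c is arbitrary and cancels
      -- when the equations at x and at a are subtracted.
      · obtain ⟨c, hc⟩ := h2 (not_lt.1 hq)
        have e1 := hc a ha
        have e2 := hc x hx01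
        have hi := intervalIntegral.integral_add_adjacent_intervals
          (integrable_v_line hb hx.1 hx.2 hA1) (integrable_v_line hb ha.1 ha.2
            (S.mem_Adm_upper zero_le_one le_rfl (not_lt.1 hq)))
        rw [add_sub_cancel_right] at e1
        rw [e2, ← hi, e1]
        ring
    rw [hS.charV_eq t ha hx01, key, hS.integral_G hx01 ha]
    congr 1
    refine intervalIntegral.integral_congr fun ξ hξ => ?_
    simp only [hS.charV_eq t ha (ordConnected_Icc.uIcc_subset hx01 ha hξ)]
  · have hi := intervalIntegral.integral_add_adjacent_intervals
      (hS.integrable_f0 ht₀ hb le_rfl ht) (hS.integrable_f0 ht₀ hb ht hs.1)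
    simp only
    rw [hb.ode s (ht.trans hs.1), hb.ode t ht, ← hi, add_assoc]

/-- Global solutions of the integrated equations solve the closed loop. -/
lemma isClosedLoopSolution_of_isLineSolution {t₀ : ℝ} (ht₀ : 0 ≤ t₀) {z₀ : HypState n}
    {U₀ V₀ : ℝ → ℝ} {u v : ℝ → ℝ → ℝ} {X : ℝ → Fin n → ℝ}
    (h : ∀ T, S.IsLineSolution t₀ U₀ V₀ z₀.2.2 T univ univ u v X)
    (hU : z₀.1 =ᵐ[unitMeasure] U₀) (hV : z₀.2.1 =ᵐ[unitMeasure] V₀) :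
    P.IsClosedLoopSolution K t₀ z₀
      (fun t => (fun x => u x (t - S.A x), fun x => v x (t + S.B x), X t))
      (fun t => v 1 (t + S.B 1)) := by
  have h0 : (0 : ℝ) ∈ Icc (0 : ℝ) 1 := left_mem_Icc.2 zero_le_one
  have h1 : (1 : ℝ) ∈ Icc (0 : ℝ) 1 := right_mem_Icc.2 zero_le_one
  have hu : ∀ x p, (x, p + S.w x) ∈ S.Adm t₀ → u x p = S.rhsU t₀ U₀ u v X x p := fun x p hA =>
    (h _).u_eq p (mem_univ _) x hA le_rfl
  have hv : ∀ x q, (x, q) ∈ S.Adm t₀ → v x q = S.rhsV t₀ V₀ u v X x q := fun x q hA =>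
    (h _).v_eq q (mem_univ _) x hA le_rfl
  have hB1 : ∀ {x}, x ∈ Icc (0 : ℝ) 1 → S.B x ≤ S.B 1 := fun hx => S.B.monotone hx.2
  have eF : ∀ p ξ, (u ξ (p + S.A ξ - S.A ξ), v ξ (p + S.A ξ + S.B ξ)) =
      (u ξ p, v ξ (p + S.w ξ)) := fun p ξ => by
    rw [add_sub_cancel_right, CharSystem.w, add_assoc]
  have eG : ∀ q ξ, (u ξ (q - S.B ξ - S.A ξ), v ξ (q - S.B ξ + S.B ξ)) =
      (u ξ (q - S.w ξ), v ξ q) := fun q ξ => by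
    rw [sub_add_cancel, CharSystem.w, sub_sub, add_comm (S.B ξ)]
  have hstrip : P.IsBroadSolution t₀ (HypSystem.strip t₀) (HypSystem.strip t₀) (Ici t₀) z₀
      (fun x t => u x (t - S.A x)) (fun x t => v x (t + S.B x)) X := by
    refine ⟨?_, ?_, fun T => ?_, fun T => ?_, ?_, ?_, ?_, ?_, fun t ht => ?_⟩
    · exact (h 0).regular.measurable_u.comp (measurable_fst.prodMk
        (measurable_snd.sub (S.measurable_A.comp measurable_fst)))
    · exact (h 0).regular.measurable_v.comp (measurable_fst.prodMk
        (measurable_snd.add (S.measurable_B.comp measurable_fst)))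
    · obtain ⟨M, hM, -⟩ := (h (T + S.B 1)).regular.bounded
      refine ⟨M, fun x t hD hT => ?_⟩
      have e : t - S.A x + S.w x = t + S.B x := by unfold CharSystem.w; ring
      refine hM _ _ ?_ ?_
      · rw [e]; exact ⟨hD.1.1, hD.1.2, by simpa using hD.2⟩
      · rw [e]; exact add_le_add hT (hB1 hD.1)
    · obtain ⟨M, -, hM, -⟩ := (h (T + S.B 1)).regular.bounded
      exact ⟨M, fun x t hD hT => hM _ _ ⟨hD.1.1, hD.1.2, by simpa using hD.2⟩
        (add_le_add hT (hB1 hD.1))⟩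
    · rw [ae_unitMeasure_iff]
      -- The line from a = 0 has p = t₀ and carries the boundary value in `dataU`, not the initial
      -- value.
      have hne : ∀ᵐ a : ℝ, a ≠ 0 := by simp [ae_iff, measure_singleton]
      filter_upwards [ae_unitMeasure_iff.1 hU, hne] with a hUa ha0 ha x hx _
      have hx01 : x ∈ Icc (0 : ℝ) 1 := ⟨ha.1.trans hx.1, hx.2⟩
      have hpos : 0 < S.A a := by
        simpa using S.A.strictMono (lt_of_le_of_ne ha.1 (Ne.symm ha0))
      have hlt : t₀ - S.A a < t₀ := by linarith
      have hsymm : S.A.symm (t₀ - (t₀ - S.A a)) = a := by simp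
      have hf : S.footU t₀ (t₀ - S.A a) = a := by rw [S.footU_of_lt hlt, hsymm]
      rw [hS.charU_eq t₀ ha hx01, add_sub_cancel_right,
        hu _ _ (S.mem_Adm_u.2 ⟨by rw [hf]; exact hx.1, hx.2⟩), CharSystem.rhsU,
        CharSystem.dataU, if_pos hlt, hsymm, hf, hUa ha, hS.integral_F ha hx01]
      congr 1
      refine intervalIntegral.integral_congr fun ξ hξ => ?_
      simp only [hS.charU_eq t₀ ha (ordConnected_Icc.uIcc_subset ha hx01 hξ), eF]
    · refine Eventually.of_forall fun s hs x hx _ => ?_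
      have hf := S.footU_of_le hs
      rw [hS.charU_eq s h0 hx, S.A_zero, sub_zero, add_sub_cancel_right,
        hu _ _ (S.mem_Adm_u.2 ⟨by rw [hf]; exact hx.1, hx.2⟩), CharSystem.rhsU,
        CharSystem.dataU, if_neg (not_lt.2 hs), hf, S.B_zero, add_zero, hS.integral_F h0 hx,
        hS.g s (ht₀.trans hs)]
      congr 1
      refine intervalIntegral.integral_congr fun ξ hξ => ?_
      simp only [hS.charU_eq s h0 (ordConnected_Icc.uIcc_subset h0 hx hξ), S.A_zero, sub_zero, eF]
    · rw [ae_unitMeasure_iff]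
      -- The line from a = 1 has q = `top t₀` and carries the feedback value, not the initial value.
      have hne : ∀ᵐ a : ℝ, a ≠ 1 := by simp [ae_iff, measure_singleton]
      filter_upwards [ae_unitMeasure_iff.1 hV, hne] with a hVa ha1 ha x hx _
      have hx01 : x ∈ Icc (0 : ℝ) 1 := ⟨hx.1, hx.2.trans ha.2⟩
      have hlt : t₀ + S.B a < S.top t₀ :=
        add_lt_add_right (S.B.strictMono (lt_of_le_of_ne ha.2 ha1)) t₀
      have hf : S.footV t₀ (t₀ + S.B a) = a := by simp [CharSystem.footV]
      rw [hS.charV_eq t₀ ha hx01, sub_add_cancel,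
        hv _ _ (S.mem_Adm_v.2 ⟨hx01.1, hx01.2, by rw [hf]; exact hx.2⟩), CharSystem.rhsV,
        if_pos hlt, hf, hVa ha, hS.integral_G hx01 ha]
      congr 1
      refine intervalIntegral.integral_congr fun ξ hξ => ?_
      simp only [hS.charV_eq t₀ ha (ordConnected_Icc.uIcc_subset hx01 ha hξ), eG]
    · intro t ht
      -- The extra unit of time makes [t₀, t + 1] a neighbourhood of t within [t₀, ∞).
      have hint := ((h (t + 1)).regular.integrable_f le_rfl (ht.trans (by linarith)) le_rfl)
      have hc := (intervalIntegral.continuousOn_primitive_interval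
        (hint.1.congr_set_ae Ioc_ae_eq_Icc.symm |> fun h => by
          rwa [uIcc_of_le (ht.trans (by linarith : t ≤ t + 1))])).const_add z₀.2.2
      rw [uIcc_of_le (ht.trans (by linarith : t ≤ t + 1))] at hc
      have hXc : ContinuousOn X (Icc t₀ (t + 1)) :=
        hc.congr fun s hs => (h (t + 1)).X_eq s hs.1 hs.2
      refine (hXc t ⟨ht, by linarith⟩).mono_of_mem_nhdsWithin ?_
      rw [← Ici_inter_Iic]
      exact inter_mem_nhdsWithin _ (Iic_mem_nhds (by linarith))
    · rw [(h t).X_eq t ht le_rfl, CharSystem.rhsX]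
      congr 1
      refine intervalIntegral.integral_congr fun s hs => ?_
      rw [uIcc_of_le ht] at hs
      simp only [S.B_zero, add_zero]
      exact hS.f s (ht₀.trans hs.1) _ _
  have hupper : ∀ q, S.top t₀ ≤ q → ∀ x ∈ Icc (0 : ℝ) 1,
      v x q = K (X q) q - ∫ ξ in (0 : ℝ)..x, S.G ξ (u ξ (q - S.w ξ), v ξ q) := fun q hq x hx => by
    rw [hv x q (S.mem_Adm_upper hx.1 hx.2 hq), CharSystem.rhsV, if_neg (not_lt.2 hq),
      hS.k q (ht₀.trans (S.le_top.trans hq))]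
  have hint : ∀ q, S.top t₀ ≤ q → IntervalIntegrable
      (fun ξ => S.G ξ (u ξ (q - S.w ξ), v ξ q)) volume 0 1 := fun q hq =>
    (h q).regular.integrable_v le_rfl zero_le_one
      (S.mem_Adm_upper zero_le_one le_rfl hq) le_rfl
  have hback : ∀ q, S.top t₀ ≤ q → ∀ x ∈ Icc (0 : ℝ) 1,
      v x q = v 1 q + ∫ ξ in x..1, S.G ξ (u ξ (q - S.w ξ), v ξ q) := fun q hq x hx => by
    have hsub1 : uIcc 0 x ⊆ uIcc (0 : ℝ) 1 := uIcc_subset_uIcc_left (by rwa [uIcc_of_le zero_le_one])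
    have hsub2 : uIcc x 1 ⊆ uIcc (0 : ℝ) 1 :=
      uIcc_subset_uIcc_right (by rwa [uIcc_of_le zero_le_one])
    rw [hupper q hq x hx, hupper q hq 1 h1, ← intervalIntegral.integral_add_adjacent_intervals
      ((hint q hq).mono_set hsub1) ((hint q hq).mono_set hsub2)]
    ring
  have htop : ∀ {t}, t₀ ≤ t → S.top t₀ ≤ S.top t := fun ht => add_le_add_left ht _
  refine ⟨hstrip, Eventually.of_forall fun t ht x hx => ?_, fun t ht => ?_⟩
  · simp only
    rw [hS.tauV_eq t hx, sub_add_cancel, hback _ (htop ht) x hx, hS.integral_G hx h1]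
    congr 1
    refine intervalIntegral.integral_congr fun ξ hξ => ?_
    simp only [hS.tauV_eq t (ordConnected_Icc.uIcc_subset hx h1 hξ), eG]
  -- The solution predicts itself from time t, and its own v on the line q = `top t` satisfies the
  -- target equation with the feedback value at x = 0; its value at x = 1 is therefore the output.
  · have hpred := hS.isPrediction_restart ht₀ ht hstrip (Eventually.of_forall fun q hq =>
      ⟨v 1 q, fun x hx => by simp only [eG]; rw [sub_add_cancel]; exact hback q hq x hx⟩)
    refine (hS.isAlgorithmOutput_iff (ht₀.trans ht) hpred).2
      ⟨fun x => v x (S.top t), ?_, fun x hx => ?_, rfl⟩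
    · have hi : IntegrableOn (fun ξ => S.G ξ (u ξ (S.top t - S.w ξ), v ξ (S.top t)))
          (uIcc 0 1) volume := by
        rw [uIcc_of_le (zero_le_one' ℝ)]
        exact (hint _ (htop ht)).1.congr_set_ae Ioc_ae_eq_Icc.symm
      have hc := (continuousOn_const (c := K (X (S.top t)) (S.top t))).sub
        (intervalIntegral.continuousOn_primitive_interval hi)
      rw [uIcc_of_le (zero_le_one' ℝ)] at hc
      exact hc.congr fun x hx => hupper _ (htop ht) x hx
    · change v x (S.top t) = _
      rw [hupper _ (htop ht) x hx]
      congr 1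
      refine intervalIntegral.integral_congr fun ξ _ => ?_
      simp only
      rw [CharSystem.w, sub_sub, add_comm (S.B ξ)]

end IsNormalForm

/-! ### From the algorithm to the feedback law, and uniqueness of the closed loop -/

namespace IsNormalForm

variable {n : ℕ} {P : HypSystem n} {K : (Fin n → ℝ) → ℝ → ℝ} {S : CharSystem n}
  (hS : IsNormalForm P K S)
include hS

/-- In the closed loop, the feedback law is the boundary value of `v` at `x = 0`. -/
lemma ae_upper_of_isClosedLoopSolution {t₀ : ℝ} (ht₀ : 0 ≤ t₀) {z₀ : HypState n}
    {z : ℝ → HypState n} {U : ℝ → ℝ} (h : P.IsClosedLoopSolution K t₀ z₀ z U) :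
    ∀ᵐ q, S.top t₀ ≤ q → ∀ x ∈ Icc (0 : ℝ) 1, (z (q - S.B x)).2.1 x = K (z q).2.2 q -
      ∫ ξ in (0 : ℝ)..x, S.G ξ ((z (q - S.B ξ)).1 ξ, (z (q - S.B ξ)).2.1 ξ) := by
  have h1 : (1 : ℝ) ∈ Icc (0 : ℝ) 1 := right_mem_Icc.2 zero_le_one
  have h0 : (0 : ℝ) ∈ Icc (0 : ℝ) 1 := left_mem_Icc.2 zero_le_one
  have hle : ∀ {q}, S.top t₀ ≤ q → t₀ ≤ q - S.B 1 := fun hq => by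
    unfold CharSystem.top at hq; linarith
  have htop : ∀ q, S.top (q - S.B 1) = q := fun q => by unfold CharSystem.top; ring
  have hvb : ∀ᵐ q, S.top t₀ ≤ q → ∀ x ∈ Icc (0 : ℝ) 1, (z (q - S.B x)).2.1 x = U (q - S.B 1) +
      ∫ ξ in x..1, S.G ξ ((z (q - S.B ξ)).1 ξ, (z (q - S.B ξ)).2.1 ξ) := by
    -- Lines are relabelled from the entry time at x = 1 to the arrival time q at x = 0; the shift
    -- preserves null sets.
    filter_upwards [ae_add_right h.v_boundary (-S.B 1)] with q hq hqt x hx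
    have := hq (by linarith [hle hqt]) x hx
    rw [← sub_eq_add_neg, hS.tauV_eq _ hx, htop] at this
    rw [this, hS.integral_G hx h1]
    congr 1
    refine intervalIntegral.integral_congr fun ξ hξ => ?_
    simp only [hS.tauV_eq _ (ordConnected_Icc.uIcc_subset hx h1 hξ), htop]
  have hup : ∀ᵐ q, S.top t₀ ≤ q → ∃ c, ∀ x ∈ Icc (0 : ℝ) 1, (z (q - S.B x)).2.1 x = c +
      ∫ ξ in x..1, S.G ξ ((z (q - S.B ξ)).1 ξ, (z (q - S.B ξ)).2.1 ξ) :=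
    hvb.mono fun q hq hqt => ⟨_, hq hqt⟩
  filter_upwards [hvb] with q hq hqt
  have ht := hle hqt
  have hpred := hS.isPrediction_restart ht₀ ht h.plant hup
  obtain ⟨vs, hc, hvs, hU⟩ := (hS.isAlgorithmOutput_iff (ht₀.trans ht) hpred).1 (h.feedback _ ht)
  have hint := hS.integrable_last_line hpred hc
  rw [htop] at hvs hint
  have hA : ((1 : ℝ), q) ∈ S.Adm t₀ := S.mem_Adm_upper zero_le_one le_rfl hqt
  have hint' := integrable_v_line h.plant le_rfl zero_le_one hA
  have hsub1 : ∀ {x}, x ∈ Icc (0 : ℝ) 1 → uIcc 0 x ⊆ uIcc (0 : ℝ) 1 := fun hx =>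
    uIcc_subset_uIcc_left (by rwa [uIcc_of_le zero_le_one])
  have hsub2 : ∀ {x}, x ∈ Icc (0 : ℝ) 1 → uIcc x 1 ⊆ uIcc (0 : ℝ) 1 := fun hx =>
    uIcc_subset_uIcc_right (by rwa [uIcc_of_le zero_le_one])
  have hback : ∀ x ∈ Icc (0 : ℝ) 1, vs x = U (q - S.B 1) +
      ∫ ξ in x..1, S.G ξ ((z (q - S.B ξ)).1 ξ, vs ξ) := fun x hx => by
    rw [hU, hvs x hx, hvs 1 h1, ← intervalIntegral.integral_add_adjacent_intervals
      (hint.mono_set (hsub1 hx)) (hint.mono_set (hsub2 hx))]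
    ring
  -- The target function and the plant's v solve the same equation on this line with the common
  -- value U at x = 1. Reflecting x to 1 - x turns that value into an initial one, as the scalar
  -- uniqueness lemma requires.
  have hflip : ∀ x, x ∈ Icc (0 : ℝ) 1 → 1 - x ∈ Icc (0 : ℝ) 1 := fun x hx =>
    ⟨by linarith [hx.2], by linarith [hx.1]⟩
  have hbdd : ∃ M, ∀ x ∈ Icc (0 : ℝ) 1,
      |vs (1 - x) - (z (q - S.B (1 - x))).2.1 (1 - x)| ≤ M := by
    obtain ⟨M₁, hM₁⟩ := isCompact_Icc.exists_bound_of_continuousOn hc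
    obtain ⟨M₂, hM₂⟩ := h.plant.bounded_v q
    refine ⟨M₁ + M₂, fun x hx => (abs_sub _ _).trans (add_le_add (hM₁ _ (hflip x hx)) ?_)⟩
    have hx' := hflip x hx
    exact hM₂ _ _ (mem_strip_of_mem_Adm (S.mem_Adm_upper hx'.1 hx'.2 hqt))
      (sub_le_self _ (S.B_nonneg hx'.1))
  have hrefl : ∀ (φ : ℝ → ℝ), IntervalIntegrable φ volume 0 1 →
      IntervalIntegrable (fun ξ => φ (1 - ξ)) volume 0 1 := fun φ hφ => by
    simpa using (hφ.comp_sub_left 1).symm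
  have hrev : ∀ (φ : ℝ → ℝ) (x : ℝ), ∫ ξ in (0 : ℝ)..x, φ (1 - ξ) = ∫ ξ in (1 - x)..1, φ ξ :=
    fun φ x => by rw [intervalIntegral.integral_comp_sub_left, sub_zero]
  have heq := eqOn_of_integral_eq
    (H := fun ξ a => S.G (1 - ξ) ((z (q - S.B (1 - ξ))).1 (1 - ξ), a))
    (y₁ := fun x => vs (1 - x)) (y₂ := fun x => (z (q - S.B (1 - x))).2.1 (1 - x))
    (c := U (q - S.B 1)) (mul_nonneg S.L_pos.le S.l_pos.le)
    (fun ξ a b => S.lip_v_line (fun x t => (z t).1 x) q (1 - ξ) a b) hbdd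
    (hrefl _ hint) (hrefl _ hint')
    (fun x hx => by
      rw [hback _ (hflip x hx)]
      exact congrArg _ (hrev (fun ξ => S.G ξ ((z (q - S.B ξ)).1 ξ, vs ξ)) x).symm)
    (fun x hx => by
      rw [hq hqt _ (hflip x hx)]
      exact congrArg _
        (hrev (fun ξ => S.G ξ ((z (q - S.B ξ)).1 ξ, (z (q - S.B ξ)).2.1 ξ)) x).symm)
  have heq' : ∀ x ∈ Icc (0 : ℝ) 1, vs x = (z (q - S.B x)).2.1 x := fun x hx => by
    simpa using heq (hflip x hx)
  intro x hx
  rw [← heq' x hx, hvs x hx]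
  congr 1
  refine intervalIntegral.integral_congr fun ξ hξ => ?_
  simp only [heq' ξ (ordConnected_Icc.uIcc_subset h0 hx hξ)]

/-- Uniqueness of solutions of the closed loop. -/
lemma isClosedLoopSolution_unique {t₀ : ℝ} (ht₀ : 0 ≤ t₀) {z₀ : HypState n}
    {z z' : ℝ → HypState n} {U U' : ℝ → ℝ} (h : P.IsClosedLoopSolution K t₀ z₀ z U)
    (h' : P.IsClosedLoopSolution K t₀ z₀ z' U') {t : ℝ} (ht : t₀ ≤ t) :
    (z' t).1 =ᵐ[unitMeasure] (z t).1 ∧ (z' t).2.1 =ᵐ[unitMeasure] (z t).2.1 ∧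
      (z' t).2.2 = (z t).2.2 ∧ U' t = U t := by
  have conv : ∀ {z : ℝ → HypState n} {U : ℝ → ℝ}, P.IsClosedLoopSolution K t₀ z₀ z U →
      ∃ Gu Gv, CharSystem.GoodLines (S.top t) Gu Gv ∧
        S.IsLineSolution t₀ z₀.1 z₀.2.1 z₀.2.2 (S.top t) Gu Gv
        (S.lineU fun x t => (z t).1 x)
        (fun x q => if q = S.top t₀ then 0 else S.lineV (fun x t => (z t).2.1 x) x q)
        ((Ici t₀).indicator fun t => (z t).2.2) := fun h =>
    hS.exists_isLineSolution_of_isBroadSolution ht₀ h.plant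
      (fun x q hA _ => mem_strip_of_mem_Adm hA) (fun x q hA _ _ => mem_strip_of_mem_Adm hA)
      Icc_subset_Ici_self measurableSet_Ici
      ((hS.ae_upper_of_isClosedLoopSolution ht₀ h).mono fun q hq h1 _ => hq h1.le)
      (EventuallyEq.refl _ _) (EventuallyEq.refl _ _)
  obtain ⟨Gu, Gv, hG, hl⟩ := conv h
  obtain ⟨Gu', Gv', hG', hl'⟩ := conv h'
  have key := (hl'.mono inter_subset_left inter_subset_left).closeOn (δ := 0) ht₀
    (hG'.inter hG) (hl.mono inter_subset_right inter_subset_right) le_rfl (by simp) (by simp)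
    (by simp)
  have hB1 : ∀ {x}, x ∈ Icc (0 : ℝ) 1 → t + S.B x ≤ S.top t := fun hx =>
    add_le_add_right (S.B.monotone hx.2) t
  have hA : ∀ {x}, x ∈ Icc (0 : ℝ) 1 → (x, t + S.B x) ∈ S.Adm t₀ := fun hx =>
    ⟨hx.1, hx.2, by simpa using ht⟩
  have hu : (z' t).1 =ᵐ[unitMeasure] (z t).1 := by
    refine ae_unitMeasure_iff.2 ?_
    filter_upwards [S.ae_sub_A (hG.ae_u.and hG'.ae_u) t] with x hp hx
    have e : t - S.A x + S.w x = t + S.B x := by unfold CharSystem.w; ring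
    have := key.u _ ⟨hp.2, hp.1⟩ x (by rw [e]; exact hA hx) (by rw [e]; exact hB1 hx)
    rw [mul_zero, zero_mul] at this
    simpa [CharSystem.lineU] using sub_eq_zero.1 (abs_nonpos_iff.1 this)
  have hv : (z' t).2.1 =ᵐ[unitMeasure] (z t).2.1 := by
    refine ae_unitMeasure_iff.2 ?_
    have hne : ∀ᵐ q : ℝ, q ≠ S.top t₀ := by simp [ae_iff, measure_singleton]
    filter_upwards [S.ae_add_B ((hG.ae_v.and hG'.ae_v).and hne) t] with x hq hx
    have := key.v _ ⟨hq.1.2 (hB1 hx), hq.1.1 (hB1 hx)⟩ x (hA hx) (hB1 hx)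
    rw [mul_zero, zero_mul, if_neg hq.2, if_neg hq.2] at this
    simpa [CharSystem.lineV] using sub_eq_zero.1 (abs_nonpos_iff.1 this)
  have hX : (z' t).2.2 = (z t).2.2 := by
    have := key.X t ht S.le_top
    rw [mul_zero, zero_mul, indicator_of_mem (mem_Ici.2 ht),
      indicator_of_mem (mem_Ici.2 ht)] at this
    exact sub_eq_zero.1 (norm_le_zero_iff.1 this)
  exact ⟨hu, hv, hX, hS.isAlgorithmOutput_unique (ht₀.trans ht)
    ((h'.feedback t ht).congr_state hu hv hX) (h.feedback t ht)⟩

/-- A solution attains its initial state. -/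
lemma initial_state_of_isClosedLoopSolution {t₀ : ℝ} {z₀ : HypState n}
    {z : ℝ → HypState n} {U : ℝ → ℝ} (h : P.IsClosedLoopSolution K t₀ z₀ z U) :
    (z t₀).1 =ᵐ[unitMeasure] z₀.1 ∧ (z t₀).2.1 =ᵐ[unitMeasure] z₀.2.1 ∧ (z t₀).2.2 = z₀.2.2 := by
  refine ⟨ae_unitMeasure_iff.2 ?_, ae_unitMeasure_iff.2 ?_, ?_⟩
  · filter_upwards [ae_unitMeasure_iff.1 h.plant.u_initial] with a ha ha01
    have := ha ha01 a ⟨le_rfl, ha01.2⟩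
    rw [hS.charU_eq t₀ ha01 ha01, sub_add_cancel, intervalIntegral.integral_same, add_zero] at this
    exact this ⟨ha01, mem_Ici.2 le_rfl⟩
  · filter_upwards [ae_unitMeasure_iff.1 h.plant.v_initial] with a ha ha01
    have := ha ha01 a ⟨ha01.1, le_rfl⟩
    rw [hS.charV_eq t₀ ha01 ha01, add_sub_cancel_right, intervalIntegral.integral_same,
      add_zero] at this
    exact this ⟨ha01, mem_Ici.2 le_rfl⟩
  · simpa using h.plant.ode t₀ (mem_Ici.2 le_rfl)

/-- The initial state of a solution is essentially bounded. -/
lemma memLp_of_isClosedLoopSolution {t₀ : ℝ} {z₀ : HypState n}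
    {z : ℝ → HypState n} {U : ℝ → ℝ} (h : P.IsClosedLoopSolution K t₀ z₀ z U) :
    MemLp z₀.1 ⊤ unitMeasure ∧ MemLp z₀.2.1 ⊤ unitMeasure := by
  obtain ⟨hu, hv, -⟩ := hS.initial_state_of_isClosedLoopSolution h
  obtain ⟨M₁, h1⟩ := h.plant.bounded_u t₀
  obtain ⟨M₂, h2⟩ := h.plant.bounded_v t₀
  have hm : Measurable fun x : ℝ => (x, t₀) := measurable_id.prodMk measurable_const
  exact ⟨(memLp_congr_ae hu).1 (memLp_top_of_bound
      (h.plant.measurable_u.comp hm).aestronglyMeasurable M₁ (ae_unitMeasure_iff.2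
        (Eventually.of_forall fun x hx => h1 x t₀ ⟨hx, mem_Ici.2 le_rfl⟩ le_rfl))),
    (memLp_congr_ae hv).1 (memLp_top_of_bound
      (h.plant.measurable_v.comp hm).aestronglyMeasurable M₂ (ae_unitMeasure_iff.2
        (Eventually.of_forall fun x hx => h2 x t₀ ⟨hx, mem_Ici.2 le_rfl⟩ le_rfl)))⟩

end IsNormalForm

/-! ### A priori bounds before and after the first prediction horizon -/

namespace CharSystem

variable {n : ℕ} {S : CharSystem n}

/-- The constant in the bound by the boundary values. -/
noncomputable def C₁ (S : CharSystem n) : ℝ := 2 * Real.exp (2 * S.L * S.l)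

/-- The constant in the bound on the determinate set. -/
noncomputable def C₀ (S : CharSystem n) (t₀ : ℝ) : ℝ :=
  2 * (S.c ^ 2 * Real.exp (S.β * (S.top t₀ + 1)))

lemma C₀_pos (S : CharSystem n) (t₀ : ℝ) : 0 < S.C₀ t₀ := by
  have := S.c_pos
  unfold C₀
  positivity

lemma one_le_C₁ (S : CharSystem n) : 1 ≤ S.C₁ := by
  have : 1 ≤ Real.exp (2 * S.L * S.l) := Real.one_le_exp (by
    have := S.L_pos
    have := S.l_pos
    positivity)
  unfold C₁
  linarith

/-- Bound on the determinate set by the initial data. -/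
lemma IsLineSolution.lower_bound {t₀ δ : ℝ} (ht₀ : 0 ≤ t₀) {U₀ V₀ : ℝ → ℝ} {X₀ : Fin n → ℝ}
    {u v : ℝ → ℝ → ℝ} {X : ℝ → Fin n → ℝ}
    (h : S.IsLineSolution t₀ U₀ V₀ X₀ (S.top t₀) univ univ u v X) (hU : ∀ a, |U₀ a| ≤ δ)
    (hV : ∀ a, |V₀ a| ≤ δ) (hX : ‖X₀‖ ≤ δ) :
    (∀ x q, (x, q) ∈ S.Adm t₀ → q ≤ S.top t₀ →
      |u x (q - S.w x)| ≤ S.C₀ t₀ * δ ∧ |v x q| ≤ S.C₀ t₀ * δ) ∧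
    ∀ t, t₀ ≤ t → t ≤ S.top t₀ → ‖X t‖ ≤ S.C₀ t₀ * δ := by
  have hδ : 0 ≤ δ := (abs_nonneg _).trans (hU 0)
  -- The bound is continuous dependence relative to the zero solution.
  have key := h.closeOn ht₀ (goodLines_univ _) (S.isLineSolution_zero t₀ _ univ univ) hδ
    (by simpa using hU) (by simpa using hV) (by simpa using hX)
  have hexp : ∀ {s}, s ≤ S.top t₀ + 1 → Real.exp (S.β * s) ≤ Real.exp (S.β * (S.top t₀ + 1)) :=
    fun hs => Real.exp_le_exp.2 (mul_le_mul_of_nonneg_left hs S.β_pos.le)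
  have hωV : ∀ {x q}, (x, q) ∈ S.Adm t₀ → q ≤ S.top t₀ →
      S.c * S.ωV t₀ x q ≤ S.c ^ 2 * Real.exp (S.β * (S.top t₀ + 1)) := fun hA hT => by
    have := hexp ((S.θ_le (t₀ := t₀) hA.1).trans (add_le_add hT hA.2.1))
    have hc := S.c_pos
    unfold ωV
    rw [← mul_assoc, ← sq]
    gcongr
  have hfin : ∀ {y b : ℝ}, y ≤ 2 * δ * b → b ≤ S.c ^ 2 * Real.exp (S.β * (S.top t₀ + 1)) →
      y ≤ S.C₀ t₀ * δ := fun {y b} hy hb => by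
    refine hy.trans ((mul_le_mul_of_nonneg_left hb (by linarith)).trans_eq ?_)
    unfold C₀
    ring
  refine ⟨fun x q hA hT => ⟨?_, ?_⟩, fun t ht hT => ?_⟩
  · have := key.u (q - S.w x) (mem_univ _) x (by rwa [sub_w_add_w]) (by rwa [sub_w_add_w])
    rw [sub_zero, ωU_sub_w] at this
    exact hfin this (hωV hA hT)
  · have := key.v q (mem_univ _) x hA hT
    rw [sub_zero] at this
    exact hfin this ((le_mul_of_one_le_left (S.ωV_pos _ _ _).le S.one_le_c).trans (hωV hA hT))
  · have := key.X t ht hT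
    rw [sub_zero] at this
    refine hfin this ((hexp (by linarith)).trans (le_mul_of_one_le_left (Real.exp_pos _).le
      (one_le_pow₀ S.one_le_c)))

/-- Bound after the determinate set by the boundary values. -/
lemma IsLineSolution.upper_bound {t₀ : ℝ} {U₀ V₀ : ℝ → ℝ} {X₀ : Fin n → ℝ}
    {u v : ℝ → ℝ → ℝ} {X : ℝ → Fin n → ℝ}
    (h : ∀ T, S.IsLineSolution t₀ U₀ V₀ X₀ T univ univ u v X) {m : ℝ → ℝ} (hm : Antitone m)
    (hm0 : ∀ p, 0 < m p)
    (hlow : ∀ x, (x, S.top t₀) ∈ S.Adm t₀ →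
      |u x (S.top t₀ - S.w x)| ≤ m (S.top t₀ - S.w x))
    (hX : ∀ q, S.top t₀ ≤ q → S.L ^ 2 * ‖X q‖ ≤ m q) {x q : ℝ} (hx : 0 ≤ x) (hx1 : x ≤ 1)
    (hq : S.top t₀ ≤ q) :
    |u x (q - S.w x)| ≤ S.C₁ * m (q - S.w x) ∧ |v x q| ≤ S.C₁ * m (q - S.w x) := by
  have hL := S.L_pos
  have hl := S.l_pos
  have hL1 := S.one_le_L
  -- With this rate, integrating a source of size L l M leaves exactly M/2.
  set b : ℝ := 2 * S.L * S.l with hb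
  have hb0 : 0 < b := by positivity
  have hLX : ∀ q, S.top t₀ ≤ q → S.L * ‖X q‖ ≤ m q := fun q hq => by
    refine le_trans ?_ (hX q hq)
    gcongr
    nlinarith
  have hvle : ∀ q x, S.top t₀ ≤ q → (x, q) ∈ S.Adm t₀ →
      v x q = S.k q (X q) - ∫ ξ in (0 : ℝ)..x, S.G ξ (u ξ (q - S.w ξ), v ξ q) :=
    fun q x hq hA => by
      rw [(h q).v_eq q (mem_univ _) x hA le_rfl, rhsV, if_neg (not_lt.2 hq)]
  -- Each u-line is followed back to where it enters the region q ≥ `top t₀`: at x = 0 if p ≥ `top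
  -- t₀`, where u = g(X, k(X)) costs L², and otherwise at its crossing with the line q = `top t₀`,
  -- where `hlow` applies.
  have hu_start : ∀ p x, (x, p + S.w x) ∈ S.Adm t₀ → S.top t₀ ≤ p + S.w x →
      ∃ y, 0 ≤ y ∧ y ≤ x ∧ S.top t₀ ≤ p + S.w y ∧ |u y p| ≤ m p ∧
        u x p = u y p + ∫ ξ in y..x, S.F ξ (u ξ p, v ξ (p + S.w ξ)) := by
    intro p x hA hqx
    obtain ⟨hfx, hx1⟩ := S.mem_Adm_u.1 hA
    have main : ∀ y, S.footU t₀ p ≤ y → y ≤ x →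
        u x p = u y p + ∫ ξ in y..x, S.F ξ (u ξ p, v ξ (p + S.w ξ)) := by
      intro y hfy hyx
      have hr := (h (p + S.w x)).regular
      have hwy : p + S.w y ≤ p + S.w x := add_le_add_right (S.w_mono hyx) p
      have hi := intervalIntegral.integral_add_adjacent_intervals
        (hr.integrable_u le_rfl hfy (hyx.trans hx1) hwy) (hr.integrable_u hfy hyx hx1 le_rfl)
      rw [(h (p + S.w x)).u_eq p (mem_univ _) x hA le_rfl,
        (h (p + S.w x)).u_eq p (mem_univ _) y (S.mem_Adm_u.2 ⟨hfy, hyx.trans hx1⟩) hwy,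
        rhsU, rhsU, ← hi, add_assoc]
    by_cases hp : S.top t₀ ≤ p
    · have hpt : t₀ ≤ p := S.le_top.trans hp
      have hf := S.footU_of_le hpt
      refine ⟨0, le_rfl, hA.1, by simpa using hp, ?_, main 0 hf.le hA.1⟩
      have hA0 : ((0 : ℝ), p + S.w 0) ∈ S.Adm t₀ := by simpa using S.zero_mem_Adm hpt
      rw [(h p).u_eq p (mem_univ _) 0 hA0 (by simp), rhsU, hf, intervalIntegral.integral_same,
        add_zero, dataU, if_neg (not_lt.2 hpt)]
      have hv0 : v 0 p = S.k p (X p) := by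
        rw [hvle p 0 hp (S.zero_mem_Adm hpt), intervalIntegral.integral_same, sub_zero]
      have hn : ‖(X p, v 0 p)‖ ≤ S.L * ‖X p‖ := max_le
        (le_mul_of_one_le_left (norm_nonneg _) hL1) (by
          change |v 0 p| ≤ _
          rw [hv0]; exact S.norm_k_le _ _)
      calc _ ≤ S.L * ‖(X p, v 0 p)‖ := S.norm_g_le _ _
        _ ≤ S.L * (S.L * ‖X p‖) := by gcongr
        _ = S.L ^ 2 * ‖X p‖ := by ring
        _ ≤ m p := hX p hp
    · have hp := not_le.1 hp
      set y : ℝ := S.densW.iso.symm (S.top t₀ - p) with hy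
      have hwy : p + S.w y = S.top t₀ := by
        rw [w_eq, hy, OrderIso.apply_symm_apply]; ring
      have hmono : StrictMono S.w := by rw [w_eq]; exact S.densW.iso.strictMono
      have hyx : y ≤ x := hmono.le_iff_le.1 (by linarith)
      have hy0 : 0 ≤ y := hmono.le_iff_le.1 (by rw [w_zero]; linarith)
      have hAy : (y, S.top t₀) ∈ S.Adm t₀ := S.mem_Adm_upper hy0 (hyx.trans hx1) le_rfl
      refine ⟨y, hy0, hyx, hwy.ge, ?_, main y (S.mem_Adm_u.1 (by rwa [hwy])).1 hyx⟩
      have := hlow y hAy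
      rwa [show S.top t₀ - S.w y = p by linarith] at this
  -- The comparison function exp(b y) m(p), with p the u-coordinate of the point, fits both
  -- families: p is constant along a u-line, while along a v-line the points between 0 and y have
  -- larger p, hence smaller m.
  obtain ⟨Ms, hMs, hB⟩ := exists_seq_bounds_tendsto (δ := 1)
      (B := fun M => ∀ r y, S.top t₀ ≤ r → r ≤ q → 0 ≤ y → y ≤ 1 →
        |u y (r - S.w y)| ≤ M * (Real.exp (b * (0 + y)) * m (r - S.w y)) ∧
        |v y r| ≤ M * (Real.exp (b * (0 + y)) * m (r - S.w y))) zero_le_one (by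
    obtain ⟨M, h1, h2, -⟩ := (h q).regular.bounded
    have hmq := hm0 q
    have hM : 0 ≤ M := (abs_nonneg _).trans (h2 q x (S.mem_Adm_upper hx hx1 hq) le_rfl)
    -- The p-coordinates involved are at most q, so m(q) > 0 is a lower bound for all the comparison
    -- values.
    refine ⟨M / m q, by positivity, fun r y hr hrq hy hy1 => ?_⟩
    have hA := S.mem_Adm_upper hy hy1 hr
    have hle : m q ≤ Real.exp (b * (0 + y)) * m (r - S.w y) := by
      have h3 : m q ≤ m (r - S.w y) := hm (by linarith [S.w_nonneg hy])
      exact h3.trans (le_mul_of_one_le_left (hm0 _).le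
        (Real.one_le_exp (by rw [zero_add]; positivity)))
    have hM' : M ≤ M / m q * (Real.exp (b * (0 + y)) * m (r - S.w y)) :=
      calc M = M / m q * m q := by field_simp
        _ ≤ _ := by gcongr
    exact ⟨(h1 _ _ (by rwa [sub_w_add_w]) (by rwa [sub_w_add_w])).trans hM',
      (h2 _ _ hA hrq).trans hM'⟩) <| by
    intro M hM hB r y hr hrq hy hy1
    have hA := S.mem_Adm_upper hy hy1 hr
    set p : ℝ := r - S.w y with hp
    have hpm := hm0 p
    have hpr : p + S.w y = r := by rw [hp]; ring
    have hE : 1 ≤ Real.exp (b * (0 + y)) := Real.one_le_exp (by rw [zero_add]; positivity)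
    have hexp : ∀ a, a ≤ y → (∫ ξ in a..y, S.L * S.l * (M * m p) * Real.exp (b * (0 + ξ))) ≤
        M / 2 * (Real.exp (b * (0 + y)) * m p) := fun a ha => by
      rw [intervalIntegral.integral_const_mul]
      refine (mul_le_mul_of_nonneg_left (integral_exp_add_le ha hb0 0) (by positivity)).trans_eq ?_
      rw [hb]
      field_simp
    have hint : ∀ a, IntervalIntegrable
        (fun ξ => S.L * S.l * (M * m p) * Real.exp (b * (0 + ξ))) volume a y := fun a =>
      Continuous.intervalIntegrable (by fun_prop) _ _
    have hsrc : ∀ {C a₁ a₂ ξ rr : ℝ}, rr ≤ S.l → |C| ≤ S.L * rr * ‖(a₁, a₂)‖ →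
        |a₁| ≤ M * (Real.exp (b * (0 + ξ)) * m p) → |a₂| ≤ M * (Real.exp (b * (0 + ξ)) * m p) →
        ‖C‖ ≤ S.L * S.l * (M * m p) * Real.exp (b * (0 + ξ)) := by
      intro C a₁ a₂ ξ rr hrr hC h1 h2
      have hn : ‖(a₁, a₂)‖ ≤ M * (Real.exp (b * (0 + ξ)) * m p) := max_le h1 h2
      calc _ ≤ S.L * rr * ‖(a₁, a₂)‖ := hC
        _ ≤ S.L * S.l * ‖(a₁, a₂)‖ := by gcongr
        _ ≤ S.L * S.l * (M * (Real.exp (b * (0 + ξ)) * m p)) := by gcongr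
        _ = _ := by ring
    constructor
    · obtain ⟨s, hs0, hsy, hst, hus, heq⟩ := hu_start p y (by rwa [hpr]) (by rwa [hpr])
      rw [heq]
      have key : ‖∫ ξ in s..y, S.F ξ (u ξ p, v ξ (p + S.w ξ))‖ ≤ _ :=
        (intervalIntegral.norm_integral_le_of_norm_le hsy
          (Eventually.of_forall fun ξ hξ => by
            have hξq : p + S.w ξ ≤ q := le_trans (by linarith [S.w_mono hξ.2]) hrq
            obtain ⟨h1, h2⟩ := hB (p + S.w ξ) ξ
              (hst.trans (add_le_add_right (S.w_mono hξ.1.le) p)) hξq (hs0.trans hξ.1.le)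
              (hξ.2.trans hy1)
            rw [add_sub_cancel_right] at h1 h2
            exact hsrc (S.densU.le ξ) (S.norm_F_le _ _) h1 h2) (hint s)).trans (hexp s hsy)
      refine (abs_add_le _ _).trans ((add_le_add hus key).trans ?_)
      nlinarith
    · rw [hvle r y hr hA]
      have key : ‖∫ ξ in (0 : ℝ)..y, S.G ξ (u ξ (r - S.w ξ), v ξ r)‖ ≤ _ :=
        (intervalIntegral.norm_integral_le_of_norm_le hy
          (Eventually.of_forall fun ξ hξ => by
            obtain ⟨h1, h2⟩ := hB r ξ hr hrq hξ.1.le (hξ.2.trans hy1)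
            have hmle : m (r - S.w ξ) ≤ m p := hm (by rw [hp]; linarith [S.w_mono hξ.2])
            have hmul : M * (Real.exp (b * (0 + ξ)) * m (r - S.w ξ)) ≤
              M * (Real.exp (b * (0 + ξ)) * m p) := by gcongr
            exact hsrc (S.densV.le ξ) (S.norm_G_le _ _) (h1.trans hmul) (h2.trans hmul))
          (hint 0)).trans (hexp 0 hy)
      have hk : |S.k r (X r)| ≤ m p :=
        (S.norm_k_le _ _).trans ((hLX r hr).trans (hm (by rw [hp]; linarith [S.w_nonneg hy])))
      refine (abs_sub _ _).trans ((add_le_add hk key).trans ?_)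
      nlinarith
  have hfin : 2 * 1 * (Real.exp (b * (0 + x)) * m (q - S.w x)) ≤ S.C₁ * m (q - S.w x) := by
    have h1 : Real.exp (b * (0 + x)) ≤ Real.exp (2 * S.L * S.l) :=
      Real.exp_le_exp.2 (by rw [zero_add]; exact mul_le_of_le_one_right hb0.le hx1)
    have := hm0 (q - S.w x)
    unfold C₁
    calc _ = 2 * Real.exp (b * (0 + x)) * m (q - S.w x) := by ring
      _ ≤ _ := by gcongr
  exact ⟨(ge_of_tendsto' (hMs.mul_const _) fun k => (hB k q x hq le_rfl hx hx1).1).trans hfin,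
    (ge_of_tendsto' (hMs.mul_const _) fun k => (hB k q x hq le_rfl hx hx1).2).trans hfin⟩

end CharSystem

lemma stateNorm_le {n : ℕ} {z : HypState n} {C : ℝ}
    (hu : ∀ x ∈ Icc (0 : ℝ) 1, |z.1 x| ≤ C) (hv : ∀ x ∈ Icc (0 : ℝ) 1, |z.2.1 x| ≤ C)
    (hX : ‖z.2.2‖ ≤ C) : stateNorm z ≤ ENNReal.ofReal C := by
  refine max_le (max_le ?_ ?_) ?_
  · rw [eLpNorm_exponent_top]
    exact eLpNormEssSup_le_of_ae_bound (ae_unitMeasure_iff.2 (Eventually.of_forall hu))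
  · rw [eLpNorm_exponent_top]
    exact eLpNormEssSup_le_of_ae_bound (ae_unitMeasure_iff.2 (Eventually.of_forall hv))
  · rw [← ofReal_norm]
    exact ENNReal.ofReal_le_ofReal hX

lemma stateNorm_congr {n : ℕ} {z z' : HypState n} (hu : z.1 =ᵐ[unitMeasure] z'.1)
    (hv : z.2.1 =ᵐ[unitMeasure] z'.2.1) (hX : z.2.2 = z'.2.2) : stateNorm z = stateNorm z' := by
  rw [stateNorm, stateNorm, eLpNorm_congr_ae hu, eLpNorm_congr_ae hv, hX]

lemma norm_le_of_stateNorm_le {n : ℕ} {z : HypState n} {C : ℝ} (hC : 0 ≤ C)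
    (h : stateNorm z ≤ ENNReal.ofReal C) :
    (∀ᵐ a ∂unitMeasure, |z.1 a| ≤ C) ∧ (∀ᵐ a ∂unitMeasure, |z.2.1 a| ≤ C) ∧ ‖z.2.2‖ ≤ C := by
  have h1 := (le_max_left _ _).trans h
  have h2 := (le_max_right _ _).trans h
  refine ⟨ae_abs_le_of_eLpNorm_le hC ((le_max_left _ _).trans h1),
    ae_abs_le_of_eLpNorm_le hC ((le_max_right _ _).trans h1), ?_⟩
  rwa [← ofReal_norm, ENNReal.ofReal_le_ofReal_iff hC] at h2

namespace CharSystem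

variable {n : ℕ} {S : CharSystem n}

/-- Bound of the state by the initial data and the nominal solution of the ordinary differential
equation. -/
lemma IsLineSolution.stateNorm_le {t₀ δ : ℝ} (ht₀ : 0 ≤ t₀) {U₀ V₀ : ℝ → ℝ} {X₀ : Fin n → ℝ}
    {u v : ℝ → ℝ → ℝ} {X : ℝ → Fin n → ℝ}
    (h : ∀ T, S.IsLineSolution t₀ U₀ V₀ X₀ T univ univ u v X) (hU : ∀ a, |U₀ a| ≤ δ)
    (hV : ∀ a, |V₀ a| ≤ δ) (hX₀ : ‖X₀‖ ≤ δ) {m : ℝ → ℝ} (hm : Antitone m)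
    (hm0 : ∀ p, 0 < m p) (hmδ : S.C₀ t₀ * δ ≤ m (S.top t₀))
    (hX : ∀ q, S.top t₀ ≤ q → S.L ^ 2 * ‖X q‖ ≤ m q) {t : ℝ} (ht : t₀ ≤ t) :
    stateNorm ((fun x => u x (t - S.A x), fun x => v x (t + S.B x), X t) : HypState n) ≤
      ENNReal.ofReal (S.C₁ * m (t - S.A 1)) := by
  obtain ⟨hlow, hlowX⟩ := (h (S.top t₀)).lower_bound ht₀ hU hV hX₀
  have hA1 : 0 ≤ S.A 1 := S.A_nonneg zero_le_one
  have hC1 := S.one_le_C₁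
  have hscale : ∀ {p}, m p ≤ S.C₁ * m p := fun {p} => le_mul_of_one_le_left (hm0 p).le hC1
  have key : ∀ x ∈ Icc (0 : ℝ) 1, |u x (t - S.A x)| ≤ S.C₁ * m (t - S.A 1) ∧
      |v x (t + S.B x)| ≤ S.C₁ * m (t - S.A 1) := by
    intro x hx
    have e : t - S.A x = t + S.B x - S.w x := by unfold w; ring
    have hAdm : (x, t + S.B x) ∈ S.Adm t₀ := ⟨hx.1, hx.2, by simpa using ht⟩
    -- The state at time t involves u-coordinates no smaller than t - A(1), where the antitone m is
    -- largest.
    have hmA : m (t - S.A x) ≤ m (t - S.A 1) := hm (by linarith [S.A.monotone hx.2])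
    have hmC : S.C₁ * m (t - S.A x) ≤ S.C₁ * m (t - S.A 1) :=
      mul_le_mul_of_nonneg_left hmA (by linarith)
    rw [e] at hmC ⊢
    rcases le_total (t + S.B x) (S.top t₀) with hq | hq
    · obtain ⟨h1, h2⟩ := hlow x _ hAdm hq
      have h3 : m (S.top t₀) ≤ S.C₁ * m (t + S.B x - S.w x) :=
        (hm (by linarith [S.w_nonneg hx.1])).trans hscale
      exact ⟨(h1.trans (hmδ.trans h3)).trans hmC, (h2.trans (hmδ.trans h3)).trans hmC⟩
    · obtain ⟨h1, h2⟩ := IsLineSolution.upper_bound h hm hm0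
        (fun y hA => ((hlow y _ hA le_rfl).1.trans hmδ).trans (hm (by linarith [S.w_nonneg hA.1])))
        hX hx.1 hx.2 hq
      exact ⟨h1.trans hmC, h2.trans hmC⟩
  refine _root_.stateNorm_le (fun x hx => (key x hx).1)
    (fun x hx => (key x hx).2) ?_
  rcases le_total t (S.top t₀) with hq | hq
  · exact ((hlowX t ht hq).trans (hmδ.trans (hm (by linarith)))).trans hscale
  · have h1 : ‖X t‖ ≤ S.L ^ 2 * ‖X t‖ :=
      le_mul_of_one_le_left (norm_nonneg _) (one_le_pow₀ S.one_le_L)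
    exact ((h1.trans (hX t hq)).trans (hm (by linarith))).trans hscale

end CharSystem

/-! ### Stability and attractivity of the closed loop -/

namespace IsNormalForm

variable {n : ℕ} {P : HypSystem n} {K : (Fin n → ℝ) → ℝ → ℝ} {S : CharSystem n}
  (hS : IsNormalForm P K S)
include hS

/-- Existence for the closed loop, in terms of the integrated equations. -/
lemma exists_isClosedLoopSolution {t₀ : ℝ} (ht₀ : 0 ≤ t₀) {z₀ : HypState n}
    (hu : MemLp z₀.1 ⊤ unitMeasure) (hv : MemLp z₀.2.1 ⊤ unitMeasure) {C : ℝ} (hC : 0 ≤ C)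
    (huC : ∀ᵐ a ∂unitMeasure, |z₀.1 a| ≤ C) (hvC : ∀ᵐ a ∂unitMeasure, |z₀.2.1 a| ≤ C) :
    ∃ (U₀ V₀ : ℝ → ℝ) (u v : ℝ → ℝ → ℝ) (X : ℝ → Fin n → ℝ),
      (∀ a, |U₀ a| ≤ C) ∧ (∀ a, |V₀ a| ≤ C) ∧
      (∀ T, S.IsLineSolution t₀ U₀ V₀ z₀.2.2 T univ univ u v X) ∧
      P.IsClosedLoopSolution K t₀ z₀
        (fun t => (fun x => u x (t - S.A x), fun x => v x (t + S.B x), X t))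
        (fun t => v 1 (t + S.B 1)) := by
  obtain ⟨U₀, hUm, hUC, hU⟩ := exists_bounded_representative hu.1 hC huC
  obtain ⟨V₀, hVm, hVC, hV⟩ := exists_bounded_representative hv.1 hC hvC
  obtain ⟨u, v, X, h⟩ := CharSystem.exists_isLineSolution (S := S) ht₀ hUm hVm hUC hVC z₀.2.2
  exact ⟨U₀, V₀, u, v, X, hUC, hVC, h, hS.isClosedLoopSolution_of_isLineSolution ht₀ h hU hV⟩

lemma exists_isClosedLoopSolution_of_memLp {t₀ : ℝ} (ht₀ : 0 ≤ t₀) {z₀ : HypState n}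
    (hu : MemLp z₀.1 ⊤ unitMeasure) (hv : MemLp z₀.2.1 ⊤ unitMeasure) :
    ∃ (C : ℝ) (U₀ V₀ : ℝ → ℝ) (u v : ℝ → ℝ → ℝ) (X : ℝ → Fin n → ℝ),
      (∀ a, |U₀ a| ≤ C) ∧ (∀ a, |V₀ a| ≤ C) ∧ ‖z₀.2.2‖ ≤ C ∧
      (∀ T, S.IsLineSolution t₀ U₀ V₀ z₀.2.2 T univ univ u v X) ∧
      P.IsClosedLoopSolution K t₀ z₀
        (fun t => (fun x => u x (t - S.A x), fun x => v x (t + S.B x), X t))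
        (fun t => v 1 (t + S.B 1)) := by
  obtain ⟨C, hC, h1⟩ := exists_ae_abs_le_of_memLp hu
  obtain ⟨C', hC', h2⟩ := exists_ae_abs_le_of_memLp hv
  have hle := le_max_left (max C C') ‖z₀.2.2‖
  obtain ⟨U₀, V₀, u, v, X, hU, hV, h⟩ := hS.exists_isClosedLoopSolution ht₀ hu hv
    (hC.trans ((le_max_left _ _).trans hle))
    (h1.mono fun a ha => ha.trans ((le_max_left _ _).trans hle))
    (h2.mono fun a ha => ha.trans ((le_max_right _ _).trans hle))
  exact ⟨_, U₀, V₀, u, v, X, hU, hV, le_max_right _ _, h⟩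

/-- After the first prediction horizon, the ordinary differential equation evolves according to the
nominal feedback law. -/
lemma isODESolution_of_isLineSolution {t₀ : ℝ} (ht₀ : 0 ≤ t₀) {z₀ : HypState n} {U₀ V₀ : ℝ → ℝ}
    {u v : ℝ → ℝ → ℝ} {X : ℝ → Fin n → ℝ} {z : ℝ → HypState n} {U : ℝ → ℝ}
    (h : ∀ T, S.IsLineSolution t₀ U₀ V₀ z₀.2.2 T univ univ u v X)
    (hz : P.IsClosedLoopSolution K t₀ z₀ z U) (hX : ∀ t, (z t).2.2 = X t) :
    IsODESolution (fun X t => P.f0 X (K X t) t) (S.top t₀) (X (S.top t₀)) X := by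
  have hc := hz.plant.continuous_X
  simp only [hX] at hc
  refine ⟨hc.mono (Ici_subset_Ici.2 S.le_top), fun t ht => ?_⟩
  have hr := (h t).regular
  have hi := intervalIntegral.integral_add_adjacent_intervals
    (hr.integrable_f le_rfl S.le_top ht) (hr.integrable_f S.le_top ht le_rfl)
  rw [(h t).X_eq t (S.le_top.trans ht) le_rfl, (h t).X_eq (S.top t₀) S.le_top ht,
    CharSystem.rhsX, CharSystem.rhsX, ← hi, add_assoc]
  congr 2
  refine intervalIntegral.integral_congr fun s hs => ?_
  rw [uIcc_of_le ht] at hs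
  have hs0 := S.le_top.trans hs.1
  have hv0 : v 0 s = K (X s) s := by
    rw [(h s).v_eq s (mem_univ _) 0 (S.zero_mem_Adm hs0) le_rfl, CharSystem.rhsV,
      if_neg (not_lt.2 hs.1), intervalIntegral.integral_same, sub_zero, hS.k s (ht₀.trans hs0)]
  simp only [hv0]
  exact hS.f s (ht₀.trans hs0) _ _

/-- Stability of the closed loop. -/
lemma closedLoop_stable (hP : SemilinearAssumption P K) {t₀ : ℝ} (ht₀ : 0 ≤ t₀) {ε : ℝ≥0∞}
    (hε : 0 < ε) : ∃ δ : ℝ≥0∞, 0 < δ ∧ ∀ z₀ z U, P.IsClosedLoopSolution K t₀ z₀ z U →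
      stateNorm z₀ < δ → ∀ t, t₀ ≤ t → stateNorm (z t) < ε := by
  obtain ⟨e, he0, heε⟩ := ENNReal.lt_iff_exists_nnreal_btwn.1 hε
  have he0 : (0 : ℝ) < e := by exact_mod_cast he0
  have hC1 : 0 < S.C₁ := by linarith [S.one_le_C₁]
  have hC0 := S.C₀_pos t₀
  have hL := S.L_pos
  set μ : ℝ := e / S.C₁ with hμ
  have hμ0 : 0 < μ := by positivity
  have htop0 : 0 ≤ S.top t₀ := ht₀.trans S.le_top
  -- Stability of the nominal equation is used from `top t₀`, when the feedback reaches x = 0;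
  -- division by L² prepares the hypothesis of `upper_bound`.
  obtain ⟨d, hd0, hd⟩ := hP.ode_stable.stable (S.top t₀) htop0 (ENNReal.ofReal (μ / S.L ^ 2))
    (by simp only [ENNReal.ofReal_pos]; positivity)
  obtain ⟨d', hd'0, hd'⟩ := ENNReal.lt_iff_exists_nnreal_btwn.1 hd0
  have hd'0 : (0 : ℝ) < d' := by exact_mod_cast hd'0
  -- The growth up to `top t₀` is at most `C₀`; δ keeps the state there below μ, and X(`top t₀`) in
  -- the stability neighbourhood.
  set δ : ℝ := min μ d' / S.C₀ t₀ with hδ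
  have hδ0 : 0 < δ := div_pos (lt_min hμ0 hd'0) hC0
  have hCδ : S.C₀ t₀ * δ = min μ d' := mul_div_cancel₀ _ hC0.ne'
  refine ⟨ENNReal.ofReal δ, by simpa using hδ0, fun z₀ z U hz hz₀ t ht => ?_⟩
  obtain ⟨hmu, hmv⟩ := hS.memLp_of_isClosedLoopSolution hz
  obtain ⟨h1, h2, h3⟩ := norm_le_of_stateNorm_le hδ0.le hz₀.le
  obtain ⟨U₀, V₀, u, v, X, hU, hV, hl, hsol⟩ :=
    hS.exists_isClosedLoopSolution ht₀ hmu hmv hδ0.le h1 h2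
  -- Stability concerns every solution; by uniqueness the given one may be replaced by the
  -- constructed one, which satisfies its equations on all lines.
  obtain ⟨hu', hv', hX', -⟩ := hS.isClosedLoopSolution_unique ht₀ hsol hz ht
  rw [stateNorm_congr hu' hv' hX']
  have hode := hS.isODESolution_of_isLineSolution ht₀ hl hsol fun _ => rfl
  have hXtop : ‖X (S.top t₀)‖ₑ < d := by
    refine lt_of_le_of_lt ?_ hd'
    have := ((hl (S.top t₀)).lower_bound ht₀ hU hV h3).2 _ S.le_top le_rfl
    rw [hCδ] at this
    rw [← ofReal_norm]
    refine (ENNReal.ofReal_le_ofReal (this.trans (min_le_right _ _))).trans ?_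
    rw [ENNReal.ofReal_coe_nnreal]
  have hXq : ∀ q, S.top t₀ ≤ q → S.L ^ 2 * ‖X q‖ ≤ μ := fun q hq => by
    have := (hd _ _ hode hXtop q hq).le
    rw [← ofReal_norm, ENNReal.ofReal_le_ofReal_iff (by positivity), le_div_iff₀' (by positivity)]
      at this
    exact this
  refine (CharSystem.IsLineSolution.stateNorm_le ht₀ hl hU hV h3 (m := fun _ => μ) antitone_const (fun _ => hμ0)
    (hCδ.le.trans (min_le_left _ _)) hXq ht).trans_lt ?_
  rwa [hμ, mul_div_cancel₀ _ hC1.ne', ENNReal.ofReal_coe_nnreal]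

/-- Attractivity of the origin of the closed loop. -/
lemma closedLoop_attractive (hP : SemilinearAssumption P K) {t₀ : ℝ} (ht₀ : 0 ≤ t₀)
    {z₀ : HypState n} {z : ℝ → HypState n} {U : ℝ → ℝ}
    (hz : P.IsClosedLoopSolution K t₀ z₀ z U) :
    Tendsto (fun t => stateNorm (z t)) atTop (𝓝 0) := by
  have hC1 : 0 < S.C₁ := by linarith [S.one_le_C₁]
  have hL := S.L_pos
  obtain ⟨hmu, hmv⟩ := hS.memLp_of_isClosedLoopSolution hz
  obtain ⟨C, U₀, V₀, u, v, X, hU, hV, h3, hl, hsol⟩ :=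
    hS.exists_isClosedLoopSolution_of_memLp ht₀ hmu hmv
  have hode := hS.isODESolution_of_isLineSolution ht₀ hl hsol fun _ => rfl
  have hlim := hP.ode_stable.attractive (S.top t₀) (ht₀.trans S.le_top) _ _ hode
  rw [ENNReal.tendsto_nhds_zero] at hlim ⊢
  intro ε hε
  obtain ⟨e, he0, heε⟩ := ENNReal.lt_iff_exists_nnreal_btwn.1 hε
  have he0 : (0 : ℝ) < e := by exact_mod_cast he0
  set η : ℝ := e / S.C₁ with hη
  have hη0 : 0 < η := by positivity
  obtain ⟨T₁, hT₁⟩ := eventually_atTop.1 (hlim (ENNReal.ofReal (η / S.L ^ 2))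
    (by simp only [gt_iff_lt, ENNReal.ofReal_pos]; positivity))
  have hXη : ∀ q, T₁ ≤ q → S.L ^ 2 * ‖X q‖ ≤ η := fun q hq => by
    have := hT₁ q hq
    rw [← ofReal_norm, ENNReal.ofReal_le_ofReal_iff (by positivity), le_div_iff₀' (by positivity)]
      at this
    exact this
  obtain ⟨M, hM⟩ := isCompact_Icc.exists_bound_of_continuousOn
    (hode.1.mono (Icc_subset_Ici_self : Icc (S.top t₀) T₁ ⊆ _))
  -- The summand 1 puts `top t₀` strictly before the jump, so that m takes its large value there.
  set T₂ : ℝ := max T₁ (S.top t₀ + 1) with hT₂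
  set D : ℝ := max η (max (S.L ^ 2 * M) (S.C₀ t₀ * C)) with hD
  -- The large value D covers the initial transient and X on the compact interval before T₁;
  -- afterwards η suffices. The final bound uses m at t - A(1), which is η once t ≥ T₂ + A(1).
  set m : ℝ → ℝ := fun p => if p < T₂ then D else η with hm
  have hηD : η ≤ D := le_max_left _ _
  have hanti : Antitone m := by
    intro a b hab
    simp only [hm]
    split_ifs with h1 h2 h2
    · exact le_rfl
    · exact absurd (hab.trans_lt h1) h2
    · exact hηD
    · exact le_rfl
  have hηm : ∀ p, η ≤ m p := fun p => by
    simp only [hm]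
    split_ifs
    · exact hηD
    · exact le_rfl
  have hXm : ∀ q, S.top t₀ ≤ q → S.L ^ 2 * ‖X q‖ ≤ m q := fun q hq => by
    rcases le_total T₁ q with h | h
    · exact (hXη q h).trans (hηm q)
    · rcases lt_or_ge q T₂ with h2 | h2
      · simp only [hm, if_pos h2]
        exact (mul_le_mul_of_nonneg_left (hM q ⟨hq, h⟩) (by positivity)).trans
          ((le_max_left _ _).trans (le_max_right _ _))
      · exact (hXη q ((le_max_left _ _).trans h2)).trans (hηm q)
  have hmtop : S.C₀ t₀ * C ≤ m (S.top t₀) := by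
    have : S.top t₀ < T₂ := lt_of_lt_of_le (by linarith) (le_max_right _ _)
    simp only [hm, if_pos this]
    exact (le_max_right _ _).trans (le_max_right _ _)
  filter_upwards [eventually_ge_atTop (max t₀ (T₂ + S.A 1))] with t ht
  have htt := (le_max_left _ _).trans ht
  have htT : ¬ t - S.A 1 < T₂ := by linarith [(le_max_right _ _).trans ht]
  obtain ⟨hu', hv', hX', -⟩ := hS.isClosedLoopSolution_unique ht₀ hsol hz htt
  rw [stateNorm_congr hu' hv' hX']
  refine (CharSystem.IsLineSolution.stateNorm_le ht₀ hl hU hV h3 hanti (fun p => hη0.trans_le (hηm p)) hmtop hXm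
    htt).trans ?_
  simp only [hm, if_neg htT]
  rw [hη, mul_div_cancel₀ _ hC1.ne', ENNReal.ofReal_coe_nnreal]
  exact heε.le

lemma closedLoop_equilibrium {t₀ : ℝ} (ht₀ : 0 ≤ t₀) :
    ∃ U, P.IsClosedLoopSolution K t₀ 0 (fun _ => 0) U :=
  ⟨_, hS.isClosedLoopSolution_of_isLineSolution ht₀ (z₀ := 0)
    (fun T => S.isLineSolution_zero t₀ T univ univ) (EventuallyEq.refl _ _)
    (EventuallyEq.refl _ _)⟩

end IsNormalForm

/-! ### The main theorem -/

theorem mainTheorem1 {n : ℕ} (P : HypSystem n) (K : (Fin n → ℝ) → ℝ → ℝ)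
    (hP : SemilinearAssumption P K) :
    -- the control algorithm defines an input at every time and for every state
    (∀ t : ℝ, 0 ≤ t → ∀ z : HypState n, MemLp z.1 ⊤ unitMeasure → MemLp z.2.1 ⊤ unitMeasure →
      ∃! U : ℝ, P.IsAlgorithmOutput K t z U) ∧
    -- the closed loop has a unique global solution for every initial state
    (∀ t₀ : ℝ, 0 ≤ t₀ → ∀ z₀ : HypState n,
      MemLp z₀.1 ⊤ unitMeasure → MemLp z₀.2.1 ⊤ unitMeasure →
      ∃ (z : ℝ → HypState n) (U : ℝ → ℝ), P.IsClosedLoopSolution K t₀ z₀ z U ∧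
        ∀ z' U', P.IsClosedLoopSolution K t₀ z₀ z' U' → ∀ t, t₀ ≤ t →
          (z' t).1 =ᵐ[unitMeasure] (z t).1 ∧ (z' t).2.1 =ᵐ[unitMeasure] (z t).2.1 ∧
          (z' t).2.2 = (z t).2.2 ∧ U' t = U t) ∧
    -- its origin is a globally asymptotically stable equilibrium
    IsGloballyAsymptoticallyStable stateNorm
      (fun t₀ z₀ z => ∃ U : ℝ → ℝ, P.IsClosedLoopSolution K t₀ z₀ z U) := by
  obtain ⟨S, hS⟩ := exists_isNormalForm hP
  refine ⟨fun t ht z hu hv => ?_, fun t₀ ht₀ z₀ hu hv => ?_, ⟨fun t₀ ht₀ => ?_,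
    fun t₀ ht₀ ε hε => ?_, fun t₀ ht₀ z₀ z ⟨U, hz⟩ => hS.closedLoop_attractive hP ht₀ hz⟩⟩
  -- An output at (t,z) is read off from a closed-loop solution started at time t from z: its
  -- feedback at that instant is an output for a state equal to z up to null sets.
  · obtain ⟨-, U₀, V₀, u, v, X, -, -, -, -, hsol⟩ :=
      hS.exists_isClosedLoopSolution_of_memLp ht hu hv
    obtain ⟨h1, h2, h3⟩ := hS.initial_state_of_isClosedLoopSolution hsol
    have hout := (hsol.feedback t le_rfl).congr_state h1 h2 h3
    exact ⟨_, hout, fun U hU => hS.isAlgorithmOutput_unique ht hU hout⟩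
  · obtain ⟨-, U₀, V₀, u, v, X, -, -, -, -, hsol⟩ :=
      hS.exists_isClosedLoopSolution_of_memLp ht₀ hu hv
    exact ⟨_, _, hsol, fun z' U' h' t ht => hS.isClosedLoopSolution_unique ht₀ hsol h' ht⟩
  · exact hS.closedLoop_equilibrium ht₀
  · obtain ⟨δ, hδ, h⟩ := hS.closedLoop_stable hP ht₀ hε
    exact ⟨δ, hδ, fun z₀ z ⟨U, hz⟩ => h z₀ z U hz⟩
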